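/- **Setting.** Let $z=(z(t))_{t\ge 0}$ be a one-dimensional purely jumping Lévy process on a probability space, with Lévy measure $\nu$: $\mathbb E e^{i\xi z(t)}=e^{t\psi(\xi)}$ with $\psi(\xi)=\int_{\mathbb R\setminus\{0\}}(e^{i\xi y}-1-i\xi y1_{\{|y|\le 1\}})\,\nu(dy)$. Let $\alpha\in(0,2)$, $K>0$, $0<\lambda_1\le\lambda_2$, and let $F:\mathbb R^2\to\mathbb R^2$ be bounded and Lipschitz, with $\|F\|_0=\sup_x|F(x)|$ and $\|F\|_{\rm Lip}=\sup_{x\ne y}|F(x)-F(y)|/|x-y|$. Put $\Gamma_K=(-\infty,-K]\cup[K,\infty)$, $\gamma_K=\nu(\Gamma_K)$, $\nu_K=\gamma_K^{-1}\nu|_{\Gamma_K}$. Assume: * (A1) $\sup_{t\ge0}\mathbb E\big|\int_0^te^{-\lambda(t-s)}dz(s)\big|^p<\infty$ for all $\lambda>0$ and $p\in(0,\alpha)$; * (A2) $\gamma_K>0$, and $\nu_K$ has a density $p_K$ with $\int_{\mathbb R}|p_K(u-z_1)-p_K(u-z_2)|\,du\le\beta_1|z_1-z_2|^{\beta_2}$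 for all $z_1,z_2\in\mathbb R$, for some $\beta_1,\beta_2>0$; * (A3) there are $M_0>0$ and $\beta_0\in(0,2)$ with $\int_{\mathbb R}|p_K(u-z_1)-p_K(u-z_2)|\,du\le\beta_0$ whenever $|z_1|+|z_2|\le M_0$; * (A4) $\gamma_K\ge 2\beta_2\|F\|_{\rm Lip}$. For $x\in\mathbb R^2$ let $X^x$ be the càdlàg solution of $$dX_1=(-\lambda_1X_1+F_1(X))\,dt+dz(t),\qquad dX_2=(-\lambda_2X_2+F_2(X))\,dt,\qquad X(0)=x .$$ Fix a waiting time $T>0$ and let $\tau=\inf\{t>T:|\Delta z(t)|\ge K\}$. For $\hat x,\hat y\in\mathbb R^2$ let $(\xi_x,\xi_y)$ be a maximal coupling (chosen measurably in $(\hat x_1,\hat y_1)$) of the laws of $\hat x_1+\eta$ and $\hat y_1+\eta$, where $\eta\sim\nu_K$, i.e. a coupling for which $\mathbb P(\xi_x\ne\xi_y)$ equals the total variation distance of these laws; let $P^{(2)}_{(\hat x,\hat y)}$ be the law of $\big((\xi_x,\hat x_2),(\xi_y,\hat y_2)\big)$, and let $P^{(1)}_{(x,y)}$ be the law of $(X^x(\tau-),X^y(\tau-))$.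 The coupling chain $S^{x,y}(k)=(S^x(k),S^y(k))$, $k\ge0$, is the Markov chain on $\mathbb R^2\times\mathbb R^2$ started at $(x,y)$ with transition probabilities $$P_{(x,y)}(A)=\int P^{(2)}_{(\hat x,\hat y)}(A)\,P^{(1)}_{(x,y)}(d\hat x,d\hat y).$$ For $M>0$ let $\tilde\sigma(x,y,M)=\inf\{k>0:|S^x(k)|+|S^y(k)|\le M\}\in\mathbb N\cup\{\infty\}$, with $\inf\emptyset=\infty$ and $e^\infty=\infty$. **Theorem 4.1.** Let $p\in(0,\alpha)$ and $T>T_0:=\frac{(p-1)\log 3}{p\lambda_1}\vee 0$. For every $B$ there exist $M,\tilde\vartheta,C>0$, depending only on $p,\lambda_1,\lambda_2,T$, $B$ and on the noise (the process $z$ and $\alpha$, $K$), such that for every $F$ as above with $\|F\|_0\le B$, every choice of the maximal couplings and all $x,y\in\mathbb R^2$, $$\mathbb E_{(x,y)}\big[e^{\tilde\vartheta\,\tilde\sigma(x,y,M)}\big]<C\,(1+|x|^p+|y|^p).$$ -/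

import Mathlib

open MeasureTheory ProbabilityTheory Set Filter Topology
open scoped NNReal ENNReal

namespace LevySDE

noncomputable section

/-- The plane with its Euclidean norm. The first and second coordinates of `x` are `x 0`, `x 1`. -/
abbrev Plane := EuclideanSpace ℝ (Fin 2)

/-- A path indexed by `[0, ∞)` is càdlàg: right continuous with left limits. -/
def IsCadlag {E : Type*} [TopologicalSpace E] (f : ℝ≥0 → E) : Prop :=
  (∀ t, ContinuousWithinAt f (Ici t) t) ∧ ∀ t, ∃ l, Tendsto f (𝓝[<] t) (𝓝 l)

/-! ### The noise -/

/-- `ν` is a Lévy measure on `ℝ`: no mass at `0` and `∫ min(1, y²) ν(dy) < ∞`. -/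
def IsLevyMeasure (ν : Measure ℝ) : Prop :=
  ν {0} = 0 ∧ ∫⁻ y, ENNReal.ofReal (min 1 (y ^ 2)) ∂ν < ⊤

/-- The purely discontinuous Lévy symbol
`ψ(ξ) = ∫ (e^{iξy} - 1 - iξy 1_{|y| ≤ 1}) ν(dy)`. -/
def levySymbol (ν : Measure ℝ) (ξ : ℝ) : ℂ :=
  ∫ y in {y : ℝ | y ≠ 0}, (Complex.exp (Complex.I * ξ * y) - 1 -
    if |y| ≤ 1 then Complex.I * ξ * y else 0) ∂ν

/-- `z` is a one-dimensional purely jumping Lévy process with Lévy measure `ν`: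
it starts at `0`, has independent and stationary increments and càdlàg paths, and
`E e^{iξ z(t)} = e^{t ψ(ξ)}`. -/
structure IsPureJumpLevyProcess {Ω : Type*} [MeasurableSpace Ω] (P : Measure Ω)
    (z : ℝ≥0 → Ω → ℝ) (ν : Measure ℝ) : Prop where
  levyMeasure : IsLevyMeasure ν
  measurable : ∀ t, Measurable (z t)
  zero : ∀ᵐ ω ∂P, z 0 ω = 0
  indep : HasIndepIncrements z P
  stationary : ∀ s t, IdentDistrib (fun ω => z (s + t) ω - z s ω) (z t) P P
  cadlag : ∀ᵐ ω ∂P, IsCadlag (fun t => z t ω)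
  charFun_eq : ∀ (t : ℝ≥0) (ξ : ℝ),
    ∫ ω, Complex.exp (Complex.I * ξ * z t ω) ∂P = Complex.exp (t * levySymbol ν ξ)

/-- The integral `∫₀ᵗ e^{-lam (t-s)} dz(s)` along a path of `z`. As the integrand is `C¹`, this is
the pathwise Riemann-Stieltjes integral, `g(t)z(t) - g(0)z(0) - ∫₀ᵗ g'(s) z(s) ds` with
`g(s) = e^{-lam (t-s)}`. -/
def expIntegral {Ω : Type*} (z : ℝ≥0 → Ω → ℝ) (lam : ℝ) (t : ℝ≥0) (ω : Ω) : ℝ :=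
  z t ω - Real.exp (-lam * t) * z 0 ω -
    ∫ s in (0 : ℝ)..t, lam * Real.exp (-lam * (t - s)) * z s.toNNReal ω

/-- For all `lam > 0` and `p ∈ (0, α)`: `sup_{t ≥ 0} E |∫₀ᵗ e^{-lam (t-s)} dz(s)|^p < ∞`. -/
def MomentAssumption {Ω : Type*} [MeasurableSpace Ω] (P : Measure Ω) (z : ℝ≥0 → Ω → ℝ)
    (α : ℝ) : Prop :=
  ∀ lam p : ℝ, 0 < lam → 0 < p → p < α →
    (⨆ t : ℝ≥0, ∫⁻ ω, ‖expIntegral z lam t ω‖ₑ ^ p ∂P) < ⊤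

/-- `Γ_K = (-∞, -K] ∪ [K, ∞)`, the jumps of size at least `K`. -/
def bigJumps (K : ℝ) : Set ℝ := Iic (-K) ∪ Ici K

/-- The law `ν_K = γ_K⁻¹ ν|_{Γ_K}` of a jump of size at least `K`, where `γ_K = ν(Γ_K)`. -/
def bigJumpLaw (ν : Measure ℝ) (K : ℝ) : Measure ℝ :=
  (ν (bigJumps K))⁻¹ • ν.restrict (bigJumps K)

/-- The conditions on the big jumps: `γ_K > 0` (so that `ν_K` makes sense), `ν_K` has a density
`p_K` whose translates are Hölder continuous in `L¹` with constants `β₁, β₂`, any two translates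
by small vectors overlap (`L¹` distance at most `β₀ < 2`), and `γ_K ≥ 2 β₂ L`, where `L` is to be
the Lipschitz constant of the drift. -/
def BigJumpAssumption (ν : Measure ℝ) (K L : ℝ) : Prop :=
  0 < ν (bigJumps K) ∧
  ∃ (pK : ℝ → ℝ) (β₁ β₂ M₀ β₀ : ℝ),
    Measurable pK ∧ (∀ u, 0 ≤ pK u) ∧
    bigJumpLaw ν K = volume.withDensity (fun u => ENNReal.ofReal (pK u)) ∧
    0 < β₁ ∧ 0 < β₂ ∧
    (∀ z₁ z₂ : ℝ, ∫ u, |pK (u - z₁) - pK (u - z₂)| ≤ β₁ * |z₁ - z₂| ^ β₂) ∧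
    0 < M₀ ∧ 0 < β₀ ∧ β₀ < 2 ∧
    (∀ z₁ z₂ : ℝ, |z₁| + |z₂| ≤ M₀ → ∫ u, |pK (u - z₁) - pK (u - z₂)| ≤ β₀) ∧
    2 * β₂ * L ≤ ν.real (bigJumps K)

/-! ### The equation -/

/-- `‖F‖_Lip = sup_{x ≠ y} |F x - F y| / |x - y|` (the diagonal contributes `0 / 0 = 0`). -/
def lipNorm (F : Plane → Plane) : ℝ :=
  ⨆ q : Plane × Plane, ‖F q.1 - F q.2‖ / ‖q.1 - q.2‖

/-- `X` solves `dX₁ = (-lam₁ X₁ + F₁(X)) dt + dz`, `dX₂ = (-lam₂ X₂ + F₂(X)) dt`, `X(0) = x`,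
with càdlàg paths. The noise is additive, so this is a pathwise integral equation. -/
structure IsSolution {Ω : Type*} [MeasurableSpace Ω] (P : Measure Ω) (z : ℝ≥0 → Ω → ℝ)
    (lam₁ lam₂ : ℝ) (F : Plane → Plane) (x : Plane) (X : ℝ≥0 → Ω → Plane) : Prop where
  aemeasurable : ∀ t, AEMeasurable (X t) P
  cadlag : ∀ᵐ ω ∂P, IsCadlag (fun t => X t ω)
  eq_fst : ∀ᵐ ω ∂P, ∀ t : ℝ≥0, X t ω 0 = x 0 +
    (∫ s in (0 : ℝ)..t, (-lam₁ * X s.toNNReal ω 0 + F (X s.toNNReal ω) 0)) + z t ω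
  eq_snd : ∀ᵐ ω ∂P, ∀ t : ℝ≥0, X t ω 1 = x 1 +
    ∫ s in (0 : ℝ)..t, (-lam₂ * X s.toNNReal ω 1 + F (X s.toNNReal ω) 1)

/-! ### The coupling chain -/

/-- The time `τ = inf {t > T : |Δz(t)| ≥ K}` of the first big jump after the waiting time `T`
(finite almost surely when `γ_K > 0`). -/
def jumpTime {Ω : Type*} (z : ℝ≥0 → Ω → ℝ) (K T : ℝ) (ω : Ω) : ℝ≥0 :=
  sInf {t : ℝ≥0 | T < t ∧ K ≤ |z t ω - Function.leftLim (fun s => z s ω) t|}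

/-- The law of `(X^x(τ-), X^y(τ-))`. -/
def preJumpLaw {Ω : Type*} [MeasurableSpace Ω] (P : Measure Ω) (z : ℝ≥0 → Ω → ℝ) (K T : ℝ)
    (X : Plane → ℝ≥0 → Ω → Plane) (x y : Plane) : Measure (Plane × Plane) :=
  P.map fun ω =>
    (Function.leftLim (fun s => X x s ω) (jumpTime z K T ω),
      Function.leftLim (fun s => X y s ω) (jumpTime z K T ω))

/-- Total variation distance of probability measures, `sup_A |μ(A) - μ'(A)|`. -/
def tvDist (μ μ' : Measure ℝ) : ℝ :=
  ⨆ A : {A : Set ℝ // MeasurableSet A}, |μ.real A - μ'.real A|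

/-- `π` is a maximal coupling of `μ` and `μ'`: the marginals are `μ` and `μ'`, and the
probability that the two components differ equals the total variation distance. -/
structure IsMaximalCoupling (π : Measure (ℝ × ℝ)) (μ μ' : Measure ℝ) : Prop where
  fst : π.map Prod.fst = μ
  snd : π.map Prod.snd = μ'
  maximal : π.real {u | u.1 ≠ u.2} = tvDist μ μ'

/-- `Q` is a measurable choice, for all `a, b ∈ ℝ`, of a maximal coupling of the laws of `a + η`
and `b + η`, where `η` has the law `ν_K`. -/
def IsMaximalJumpCoupling (ν : Measure ℝ) (K : ℝ) (Q : Kernel (ℝ × ℝ) (ℝ × ℝ)) : Prop :=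
  ∀ a b : ℝ, IsMaximalCoupling (Q (a, b))
    ((bigJumpLaw ν K).map (fun u => a + u)) ((bigJumpLaw ν K).map (fun u => b + u))

/-- The law of `((ξ_x, x̂₂), (ξ_y, ŷ₂))` when `(ξ_x, ξ_y)` has the law `Q (x̂₁, ŷ₁)`,
with `w = (x̂, ŷ)`. -/
def coupledJumpLaw (Q : Kernel (ℝ × ℝ) (ℝ × ℝ)) (w : Plane × Plane) : Measure (Plane × Plane) :=
  (Q (w.1 0, w.2 0)).map fun u => (!₂[u.1, w.1 1], !₂[u.2, w.2 1])

/-- `κ` is the transition kernel of the coupling chain,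
`κ((x, y), A) = ∫ P⁽²⁾_{(x̂, ŷ)}(A) P⁽¹⁾_{(x,y)}(dx̂, dŷ)`, where `P⁽¹⁾_{(x,y)}` is the law of
`(X^x(τ-), X^y(τ-))` and `P⁽²⁾` couples the jumps maximally. -/
def IsCouplingKernel {Ω : Type*} [MeasurableSpace Ω] (P : Measure Ω) (z : ℝ≥0 → Ω → ℝ)
    (K T : ℝ) (X : Plane → ℝ≥0 → Ω → Plane) (Q : Kernel (ℝ × ℝ) (ℝ × ℝ))
    (κ : Kernel (Plane × Plane) (Plane × Plane)) : Prop :=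
  ∀ (x y : Plane) (A : Set (Plane × Plane)), MeasurableSet A →
    κ (x, y) A = ∫⁻ w, coupledJumpLaw Q w A ∂(preJumpLaw P z K T X x y)

/-- `S` is a Markov chain with transition kernel `κ` started at `w`: the conditional law of
`S (k + 1)` given `S 0, …, S k` is `κ (S k)`. -/
structure IsMarkovChain {Ω E : Type*} [MeasurableSpace Ω] [MeasurableSpace E] (P : Measure Ω)
    (κ : Kernel E E) (w : E) (S : ℕ → Ω → E) : Prop where
  measurable : ∀ k, Measurable (S k)
  initial : ∀ᵐ ω ∂P, S 0 ω = w
  step : ∀ k, HasCondDistrib (S (k + 1)) (fun ω (i : Fin (k + 1)) => S i ω)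
    (κ.comap (fun h : Fin (k + 1) → E => h (Fin.last k)) (measurable_pi_apply _)) P

/-- The return time `inf {k > 0 : |S^x(k)| + |S^y(k)| ≤ M}`, with `inf ∅ = ∞`. -/
def returnTime {Ω : Type*} (M : ℝ) (S : ℕ → Ω → Plane × Plane) (ω : Ω) : ℕ∞ :=
  ⨅ (k : ℕ) (_ : 0 < k ∧ ‖(S k ω).1‖ + ‖(S k ω).2‖ ≤ M), (k : ℕ∞)

/-- `E e^{c σ} ∈ [0, ∞]` for a random time `σ` with values in `{0, 1, …, ∞}`, where `e^∞ = ∞`. -/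
def expMoment {Ω : Type*} [MeasurableSpace Ω] (P : Measure Ω) (c : ℝ) (σ : Ω → ℕ∞) : ℝ≥0∞ :=
  ∫⁻ ω, EReal.exp ((c : EReal) * (((σ ω : ℕ∞) : ℝ≥0∞) : EReal)) ∂P

end

end LevySDE

open LevySDE

/-! The theorem is a Foster-Lyapunov estimate with V(x, y) = |x|^p + |y|^p. Variation of constants
bounds |X^x(t)| by e^{-λ₁t}|x| + 2B/λ₁ + |Z(t)|, where Z(t) = ∫₀ᵗ e^{-λ₁(t-s)} dz(s). At τ ≥ T the
initial value has shrunk by at least e^{-λ₁T}, and the coupled jump adds to each component a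
variable of law ν_K. The inequality (ra + b)^p ≤ q a^p + C b^p, valid for every q > r^p, then gives
E V(S(1)) ≤ qV + C with q < 1 (`exists_drift`), once Z just before τ and the jump have finite p-th
moments. The constants involve F only through B. Outside a large ball U = 1 + V therefore contracts
by a factor r < 1, the probability of not having returned decays like r^k, and a geometric series
bounds the exponential moment (`expMoment_returnTime_le`).

The moment of Z before τ is delicate because τ depends on z. The process e^{λ₁t}Z(t) has independent
increments, so Etemadi's inequality turns (A1) into polynomial tails for the suprema of |Z| over
unit time windows, uniformly in the window (`exists_tail_expIntegral`). The time τ has an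
exponential tail (`exists_measure_no_jump_le`): by Fourier inversion E f(z(t))/t → ∫ f dν for smooth
f supported away from 0, so increments of size at least K over time t have probability at least ct
along t = 1/(n+1), and such increments are independent. Interpolating between the two tails makes
the sum over windows converge, with no independence of τ and Z (`exists_dominating_jumpTime`).

For the jump, z(1) = Z(1) + λ∫₀¹ Z(s) ds transfers moments from Z to z(1). These control 1 - E
cos(ξz(1)) near ξ = 0, hence ∫(1 - cos ξy) ν(dy), hence the tails of ν (`exists_tail_levyMeasure`).
-/

namespace LevySDE

/-! ### Càdlàg paths: measurability, local bounds, modulus of continuity. -/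

section Cadlag

/-- The `+ 1` puts the grid point strictly to the right of `s`, within distance `1/(n+1)`. Right
continuity thus suffices for convergence along the grid. -/
theorem tendsto_floor_add_one_div (s : ℝ) :
    Tendsto (fun n : ℕ => ((⌊(n + 1 : ℝ) * s⌋ : ℝ) + 1) / (n + 1)) atTop (𝓝[≥] s) := by
  refine tendsto_nhdsWithin_iff.2 ⟨?_, Eventually.of_forall fun n => ?_⟩
  · have h0 : Tendsto (fun n : ℕ => s + 1 / ((n : ℝ) + 1)) atTop (𝓝 (s + 0)) :=
      tendsto_const_nhds.add tendsto_one_div_add_atTop_nhds_zero_nat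
    rw [add_zero] at h0
    refine tendsto_of_tendsto_of_tendsto_of_le_of_le tendsto_const_nhds h0 (fun n => ?_)
      (fun n => ?_)
    · have hn : (0 : ℝ) < n + 1 := by positivity
      show s ≤ _
      rw [le_div_iff₀ hn]
      nlinarith [Int.lt_floor_add_one ((n + 1 : ℝ) * s)]
    · have hn : (0 : ℝ) < n + 1 := by positivity
      show _ ≤ s + 1 / ((n : ℝ) + 1)
      rw [div_le_iff₀ hn, add_mul s, div_mul_cancel₀ _ hn.ne']
      nlinarith [Int.floor_le ((n + 1 : ℝ) * s)]
  · have hn : (0 : ℝ) < n + 1 := by positivity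
    show s ≤ _
    rw [le_div_iff₀ hn]
    nlinarith [Int.lt_floor_add_one ((n + 1 : ℝ) * s)]

theorem measurable_of_continuousWithinAt_Ici {g : ℝ → ℝ}
    (hg : ∀ s, ContinuousWithinAt g (Ici s) s) : Measurable g := by
  have hm : ∀ n : ℕ, Measurable fun s : ℝ => g (((⌊(n + 1 : ℝ) * s⌋ : ℝ) + 1) / (n + 1)) := by
    intro n
    have h1 : Measurable fun k : ℤ => g (((k : ℝ) + 1) / (n + 1)) := measurable_from_top
    exact h1.comp (Int.measurable_floor.comp (measurable_const.mul measurable_id))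
  exact measurable_of_tendsto_metrizable hm (tendsto_pi_nhds.2 fun s =>
    (hg s).tendsto.comp (tendsto_floor_add_one_div s))

theorem IsCadlag.comp_continuous {E E' : Type*} [TopologicalSpace E] [TopologicalSpace E']
    {f : ℝ≥0 → E} (hf : IsCadlag f) {g : E → E'} (hg : Continuous g) :
    IsCadlag fun t => g (f t) := by
  refine ⟨fun t => hg.continuousAt.comp_continuousWithinAt (hf.1 t), fun t => ?_⟩
  obtain ⟨l, hl⟩ := hf.2 t
  exact ⟨g l, (hg.tendsto l).comp hl⟩

theorem IsCadlag.continuousWithinAt_toNNReal {E : Type*} [TopologicalSpace E]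
    {f : ℝ≥0 → E} (hf : IsCadlag f) (s : ℝ) :
    ContinuousWithinAt (fun u : ℝ => f u.toNNReal) (Ici s) s :=
  (hf.1 s.toNNReal).comp continuous_real_toNNReal.continuousWithinAt
    fun _ hu => Real.toNNReal_mono hu

theorem IsCadlag.measurable_toNNReal {f : ℝ≥0 → ℝ} (hf : IsCadlag f) :
    Measurable fun u : ℝ => f u.toNNReal :=
  measurable_of_continuousWithinAt_Ici hf.continuousWithinAt_toNNReal

/-- By compactness it is enough to bound `f` near each point, which the left limit and right
continuity do on the two sides. -/
theorem IsCadlag.exists_bound {f : ℝ≥0 → ℝ} (hf : IsCadlag f) (N : ℝ≥0) :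
    ∃ C, ∀ t ≤ N, |f t| ≤ C := by
  have h : ∃ C, ∀ t ∈ Icc 0 N, |f t| ≤ C := by
    refine (isCompact_Icc (a := (0 : ℝ≥0)) (b := N)).induction_on
      (p := fun s => ∃ C, ∀ t ∈ s, |f t| ≤ C) ⟨0, by simp⟩ ?_ ?_ ?_
    · rintro s t hst ⟨C, hC⟩
      exact ⟨C, fun u hu => hC u (hst hu)⟩
    · rintro s t ⟨C, hC⟩ ⟨D, hD⟩
      refine ⟨max C D, fun u hu => ?_⟩
      rcases hu with hu | hu
      · exact (hC u hu).trans (le_max_left _ _)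
      · exact (hD u hu).trans (le_max_right _ _)
    · intro x _
      obtain ⟨l, hl⟩ := hf.2 x
      have h1 : ∀ᶠ t in 𝓝[<] x, |f t| < |l| + 1 :=
        hl.abs.eventually (gt_mem_nhds (lt_add_one _))
      have h2 : ∀ᶠ t in 𝓝[≥] x, |f t| < |f x| + 1 :=
        (hf.1 x).tendsto.abs.eventually (gt_mem_nhds (lt_add_one _))
      have h3 : ∀ᶠ t in 𝓝 x, |f t| ≤ max (|l| + 1) (|f x| + 1) := by
        rw [← nhdsLT_sup_nhdsGE, eventually_sup]
        exact ⟨h1.mono fun t ht => ht.le.trans (le_max_left _ _),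
          h2.mono fun t ht => ht.le.trans (le_max_right _ _)⟩
      exact ⟨_, mem_nhdsWithin_of_mem_nhds h3, _, fun t ht => ht⟩
  obtain ⟨C, hC⟩ := h
  exact ⟨C, fun t ht => hC t ⟨zero_le, ht⟩⟩

theorem IsCadlag.intervalIntegrable {f : ℝ≥0 → ℝ} (hf : IsCadlag f) (a b : ℝ) :
    IntervalIntegrable (fun u : ℝ => f u.toNNReal) volume a b := by
  obtain ⟨C, hC⟩ := hf.exists_bound (max a b).toNNReal
  rw [intervalIntegrable_iff]
  refine Measure.integrableOn_of_bounded (M := C) (by simp [uIoc])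
    hf.measurable_toNNReal.aestronglyMeasurable ?_
  refine (ae_restrict_mem measurableSet_uIoc).mono fun u hu => ?_
  exact hC _ (Real.toNNReal_mono hu.2)

theorem IsCadlag.intervalIntegrable_mul {f : ℝ≥0 → ℝ} (hf : IsCadlag f) {h : ℝ → ℝ}
    (hh : Continuous h) (a b : ℝ) :
    IntervalIntegrable (fun u : ℝ => h u * f u.toNNReal) volume a b :=
  (hf.intervalIntegrable a b).continuousOn_mul hh.continuousOn

/-- If all jumps in `(t₀, t₁]` are less than `a`, then so are increments over short intervals. -/
theorem IsCadlag.exists_modulus {f : ℝ≥0 → ℝ} (hf : IsCadlag f) {a : ℝ} (ha : 0 < a) {t₀ t₁ : ℝ≥0}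
    (h : ∀ t, t₀ < t → t ≤ t₁ → |f t - Function.leftLim f t| < a) :
    ∃ δ > 0, ∀ s u : ℝ≥0, t₀ ≤ s → s ≤ u → u ≤ t₁ → (u : ℝ) - s < δ → |f u - f s| < a := by
  have key : ∀ t ∈ Icc t₀ t₁, ∃ U, IsOpen U ∧ t ∈ U ∧
      ∀ s ∈ U, ∀ u ∈ U, t₀ ≤ s → s ≤ u → |f u - f s| < a := by
    intro t ht
    obtain ⟨l, hl⟩ := hf.2 t
    have hright : ∀ ε > 0, ∀ᶠ s in 𝓝[≥] t, |f s - f t| < ε := fun ε hε => by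
      simpa [Real.dist_eq] using Metric.tendsto_nhds.1 (hf.1 t) ε hε
    have hleft : ∀ ε > 0, ∀ᶠ s in 𝓝[<] t, |f s - l| < ε := fun ε hε => by
      simpa [Real.dist_eq] using Metric.tendsto_nhds.1 hl ε hε
    -- The slack `a - |jump|` pays for two errors of size `ε`. At `t = t₀` the jump may be large,
    -- but no time before `t₀` is ever compared.
    have hjump : ∃ ε > 0, 2 * ε < a ∧ (t₀ < t → |f t - l| + 2 * ε < a) := by
      by_cases htt : t₀ < t
      · have : (𝓝[<] t).NeBot := nhdsLT_neBot_of_exists_lt ⟨t₀, htt⟩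
        have h1 := h t htt ht.2
        rw [leftLim_eq_of_tendsto hl] at h1
        exact ⟨(a - |f t - l|) / 3, by linarith, by linarith [abs_nonneg (f t - l)],
          fun _ => by linarith⟩
      · exact ⟨a / 3, by linarith, by linarith, fun h' => absurd h' htt⟩
    obtain ⟨ε, hε, hεa, hεj⟩ := hjump
    have hev : ∀ᶠ s in 𝓝 t, (s < t → |f s - l| < ε) ∧ (t ≤ s → |f s - f t| < ε) := by
      rw [← nhdsLT_sup_nhdsGE, eventually_sup]
      refine ⟨?_, ?_⟩
      · filter_upwards [hleft ε hε, self_mem_nhdsWithin] with s hs hst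
        exact ⟨fun _ => hs, fun h' => absurd hst (not_lt.2 h')⟩
      · filter_upwards [hright ε hε, self_mem_nhdsWithin] with s hs hst
        exact ⟨fun h' => absurd h' (not_lt.2 hst), fun _ => hs⟩
    obtain ⟨U, hU, hUo, htU⟩ := eventually_nhds_iff.1 hev
    refine ⟨U, hUo, htU, fun s hs u hu h0 hsu => ?_⟩
    rcases lt_or_ge s t with hst | hst
    · have htt : t₀ < t := h0.trans_lt hst
      have e1 := abs_lt.1 ((hU s hs).1 hst)
      have e3 := hεj htt
      have e4 := abs_le.1 (le_refl |f t - l|)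
      rcases lt_or_ge u t with hut | hut
      · have e2 := abs_lt.1 ((hU u hu).1 hut)
        rw [abs_lt]; constructor <;> linarith
      · have e2 := abs_lt.1 ((hU u hu).2 hut)
        rw [abs_lt]; constructor <;> linarith
    · have e1 := abs_lt.1 ((hU s hs).2 hst)
      have e2 := abs_lt.1 ((hU u hu).2 (hst.trans hsu))
      rw [abs_lt]; constructor <;> linarith
  choose! U hUo hUm hU using key
  obtain ⟨δ, hδ, hb⟩ := lebesgue_number_lemma_of_metric (isCompact_Icc (a := t₀) (b := t₁))
    (c := fun i : Icc t₀ t₁ => U i) (fun i => hUo i i.2)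
    (fun x hx => mem_iUnion.2 ⟨⟨x, hx⟩, hUm x hx⟩)
  refine ⟨δ, hδ, fun s u h0 hsu h1 hd => ?_⟩
  obtain ⟨i, hi⟩ := hb s ⟨h0, hsu.trans h1⟩
  refine hU i i.2 s (hi (Metric.mem_ball_self hδ)) u (hi ?_) h0 hsu
  rw [Metric.mem_ball, NNReal.dist_eq, abs_of_nonneg (sub_nonneg.2 (NNReal.coe_le_coe.2 hsu))]
  exact hd

/-- Path integrals of càdlàg processes are measurable functions of the path. -/
theorem exists_measurable_eq_integral {Ω : Type*} [MeasurableSpace Ω] {w : ℝ≥0 → Ω → ℝ}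
    (hw : ∀ u, Measurable (w u)) {h : ℝ → ℝ} (hh : Continuous h) {a b : ℝ} (hab : a ≤ b) :
    ∃ g : Ω → ℝ, Measurable g ∧ ∀ ω, IsCadlag (fun t => w t ω) →
      ∫ u in a..b, h u * w u.toNNReal ω = g ω := by
  let W : ℕ → ℝ → Ω → ℝ := fun n u ω => w (((⌊(n + 1 : ℝ) * u⌋ : ℝ) + 1) / (n + 1)).toNNReal ω
  have hW : ∀ n, Measurable fun q : Ω × ℝ => h q.2 * W n q.2 q.1 := by
    intro n
    have h1 : Measurable fun q : Ω × ℤ => w (((q.2 : ℝ) + 1) / (n + 1)).toNNReal q.1 :=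
      measurable_from_prod_countable_left fun k => hw (((k : ℝ) + 1) / (n + 1)).toNNReal
    have h2 : Measurable fun q : Ω × ℝ => (q.1, ⌊(n + 1 : ℝ) * q.2⌋) :=
      measurable_fst.prodMk (Int.measurable_floor.comp (measurable_const.mul measurable_snd))
    exact (hh.measurable.comp measurable_snd).mul (h1.comp h2)
  let I : ℕ → Ω → ℝ := fun n ω => ∫ u in Ioc a b, h u * W n u ω
  have hI : ∀ n, Measurable (I n) := fun n =>
    ((hW n).stronglyMeasurable.integral_prod_right (ν := volume.restrict (Ioc a b))).measurable
  -- The upper limit is measurable for all `ω`; it is a true limit, equal to the integral, on càdlàg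
  -- paths.
  refine ⟨fun ω => limsup (fun n => I n ω) atTop, Measurable.limsup hI, fun ω hω => ?_⟩
  refine (Tendsto.limsup_eq ?_).symm
  rw [intervalIntegral.integral_of_le hab]
  -- Grid points overshoot `b` by at most `1/(n+1) ≤ 1`, so a bound up to `b + 1` dominates.
  obtain ⟨C, hC⟩ := hω.exists_bound (b + 1).toNNReal
  refine tendsto_integral_of_dominated_convergence (fun u => |h u| * C) (fun n => ?_) ?_
    (fun n => ?_) (Eventually.of_forall fun u => ?_)
  · exact ((hW n).comp (measurable_const.prodMk measurable_id)).aestronglyMeasurable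
  · exact (hh.abs.mul continuous_const).integrableOn_Ioc
  · refine (ae_restrict_mem measurableSet_Ioc).mono fun u hu => ?_
    rw [norm_mul, Real.norm_eq_abs, Real.norm_eq_abs]
    refine mul_le_mul_of_nonneg_left (hC _ (Real.toNNReal_mono ?_)) (abs_nonneg _)
    have hn : (0 : ℝ) < n + 1 := by positivity
    rw [div_le_iff₀ hn]
    have := hu.2
    nlinarith [Int.floor_le ((n + 1 : ℝ) * u)]
  · exact tendsto_const_nhds.mul
      ((hω.continuousWithinAt_toNNReal u).tendsto.comp (tendsto_floor_add_one_div u))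

end Cadlag

/-! ### Independent increments and the maximal inequality. -/

section Independence

variable {Ω : Type*} [MeasurableSpace Ω] {P : Measure Ω}

/-- Fatou's lemma for arbitrary sets: the tail intersections increase, and continuity from below
needs no measurability. It carries bounds on discrete grids over to continuous time. -/
theorem measure_eventually_le {G : ℕ → Set Ω} {c : ℝ≥0∞} (h : ∀ᶠ n in atTop, P (G n) ≤ c) :
    P {ω | ∀ᶠ n in atTop, ω ∈ G n} ≤ c := by
  have h1 : {ω | ∀ᶠ n in atTop, ω ∈ G n} = ⋃ N, ⋂ n ≥ N, G n := by
    ext ω; simp [eventually_atTop]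
  have hm : Monotone fun N : ℕ => ⋂ n ≥ N, G n := by
    intro a b hab ω hω
    simp only [mem_iInter] at hω ⊢
    exact fun n hn => hω n (hab.trans hn)
  rw [h1, hm.measure_iUnion]
  refine iSup_le fun N => ?_
  obtain ⟨n, hn, hNn⟩ := (h.and (eventually_ge_atTop N)).exists
  exact (measure_mono (iInter₂_subset n hNn)).trans hn

theorem exists_monotone_subset_range (A : Finset ℝ≥0) :
    ∃ t : ℕ → ℝ≥0, Monotone t ∧ ∀ a ∈ A, ∃ i, t i = a := by
  rcases A.eq_empty_or_nonempty with rfl | hA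
  · exact ⟨fun _ => 0, monotone_const, by simp⟩
  have hc : 0 < A.card := hA.card_pos
  refine ⟨fun i => A.orderEmbOfFin rfl ⟨min i (A.card - 1), by omega⟩, fun i j hij => ?_, ?_⟩
  · exact (A.orderEmbOfFin rfl).monotone (by simp only [Fin.mk_le_mk]; omega)
  · intro a ha
    have : a ∈ Set.range (A.orderEmbOfFin rfl) := by simpa using ha
    obtain ⟨i, rfl⟩ := this
    have hi := i.2
    exact ⟨i, congrArg _ (Fin.ext (min_eq_left (by omega)))⟩

/-- The past and the future of a process with independent increments are independent. -/
theorem indepFun_past_future [IsProbabilityMeasure P] {X : ℝ≥0 → Ω → ℝ}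
    (hX : HasIndepIncrements X P) (hm : ∀ t, Measurable (X t)) (s : ℝ≥0) :
    IndepFun (fun ω (u : Iic s) => X u ω - X s ω) (fun ω (u : Ici s) => X u ω - X s ω) P := by
  classical
  refine IndepFun.process_indepFun_process (fun u => (hm u).sub (hm s))
    (fun u => (hm u).sub (hm s)) fun I J => ?_
  obtain ⟨t, ht, htA⟩ := exists_monotone_subset_range
    (insert s (I.image Subtype.val ∪ J.image Subtype.val))
  -- The index `k` of the time `s` separates the increments: those before `k` generate the past,
  -- those from `k` on the future.
  obtain ⟨k, hk⟩ := htA s (Finset.mem_insert_self _ _)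
  let D : ℕ → Ω → ℝ := fun i ω => X (t (i + 1)) ω - X (t i) ω
  have hD : ∀ i, Measurable (D i) := fun i => (hm _).sub (hm _)
  let m : ℕ → MeasurableSpace Ω := fun i => MeasurableSpace.comap (D i) inferInstance
  have hi : iIndep m P := hX.nat ht
  have hind := indep_iSup_of_disjoint (fun i => (hD i).comap_le) hi
    (S := Iio k) (T := Ici k) (by
      rw [Set.disjoint_left]; intro a ha hb; exact absurd (mem_Iio.1 ha) (not_lt.2 hb))
  have hDm : ∀ (S : Set ℕ) (i : ℕ), i ∈ S → Measurable[⨆ i ∈ S, m i] (D i) := fun S i hi =>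
    (comap_measurable (D i)).mono (le_iSup₂_of_le i hi le_rfl) le_rfl
  have tele : ∀ i j, i ≤ j → ∀ ω, X (t j) ω - X (t i) ω = ∑ l ∈ Finset.Ico i j, D l ω := by
    intro i j hij ω
    exact (Finset.sum_Ico_sub (fun l => X (t l) ω) hij).symm
  rw [IndepFun_iff_Indep]
  refine indep_of_indep_of_le_left (indep_of_indep_of_le_right hind ?_) ?_
  · refine Measurable.comap_le (@measurable_pi_lambda _ _ _ (_) _ _ fun u => ?_)
    obtain ⟨i, hi⟩ := htA u.1 (by
      refine Finset.mem_insert_of_mem (Finset.mem_union_right _ (Finset.mem_image_of_mem _ u.2)))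
    -- The enumeration may repeat values. If the index found lies on the wrong side of `k`,
    -- monotonicity forces `u = s`, and `k` itself serves.
    obtain ⟨i, hi, hik⟩ : ∃ i, t i = u.1 ∧ k ≤ i := by
      rcases le_total k i with h | h
      · exact ⟨i, hi, h⟩
      · refine ⟨k, le_antisymm ?_ ?_, le_rfl⟩
        · rw [hk]; exact u.1.2
        · rw [← hi]; exact ht h
    have : (fun ω => X u.1 ω - X s ω) = fun ω => ∑ l ∈ Finset.Ico k i, D l ω := by
      funext ω; rw [← tele k i hik, hi, hk]
    rw [this]
    exact Finset.measurable_fun_sum _ fun l hl => hDm _ l (Finset.mem_Ico.1 hl).1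
  · refine Measurable.comap_le (@measurable_pi_lambda _ _ _ (_) _ _ fun u => ?_)
    obtain ⟨i, hi⟩ := htA u.1 (by
      refine Finset.mem_insert_of_mem (Finset.mem_union_left _ (Finset.mem_image_of_mem _ u.2)))
    obtain ⟨i, hi, hik⟩ : ∃ i, t i = u.1 ∧ i ≤ k := by
      rcases le_total i k with h | h
      · exact ⟨i, hi, h⟩
      · refine ⟨k, le_antisymm ?_ ?_, le_rfl⟩
        · rw [← hi]; exact ht h
        · rw [hk]; exact u.1.2
    have : (fun ω => X u.1 ω - X s ω) = fun ω => -∑ l ∈ Finset.Ico i k, D l ω := by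
      funext ω; rw [← tele i k hik, hi, hk]; ring
    rw [this]
    exact (Finset.measurable_fun_sum _ fun l hl => hDm _ l (Finset.mem_Ico.1 hl).2).neg

/-- Etemadi's maximal inequality. -/
theorem measure_exists_le_of_indepFun [IsProbabilityMeasure P] {S : ℕ → Ω → ℝ}
    (hS : ∀ k, Measurable (S k)) {n : ℕ}
    (hind : ∀ k ≤ n, IndepFun (fun ω (i : Iic k) => S i ω) (fun ω => S n ω - S k ω) P)
    {a : ℝ} {c : ℝ≥0∞} (hc : ∀ k ≤ n, P {ω | a ≤ |S k ω|} ≤ c) :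
    P {ω | ∃ k ≤ n, 3 * a ≤ |S k ω|} ≤ 3 * c := by
  -- `A k` says that the level `3 * a` is first reached at step `k`. On it, either `|S n| ≥ a` or
  -- the later increment `S n - S k`, independent of `A k`, is at least `2 * a`.
  let A : ℕ → Set Ω := fun k => {ω | 3 * a ≤ |S k ω| ∧ ∀ i < k, |S i ω| < 3 * a}
  have hAm : ∀ k, MeasurableSet (A k) := by
    intro k
    have h1 : MeasurableSet {ω | ∀ i < k, |S i ω| < 3 * a} := by
      have : {ω | ∀ i < k, |S i ω| < 3 * a} = ⋂ i, ⋂ (_ : i < k), {ω | |S i ω| < 3 * a} := by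
        ext ω; simp
      rw [this]
      exact MeasurableSet.iInter fun i => MeasurableSet.iInter fun _ =>
        measurableSet_lt (hS i).abs measurable_const
    exact (measurableSet_le measurable_const (hS k).abs).inter h1
  have hAd : Pairwise (Function.onFun Disjoint A) := by
    have key : ∀ i j, i < j → Disjoint (A i) (A j) := fun i j hij => by
      rw [Set.disjoint_left]
      intro ω h1 h2
      exact absurd h1.1 (not_le.2 (h2.2 i hij))
    intro i j hij
    rcases lt_or_gt_of_ne hij with h | h
    · exact key i j h
    · exact (key j i h).symm
  have hsub : {ω | ∃ k ≤ n, 3 * a ≤ |S k ω|} ⊆ {ω | a ≤ |S n ω|} ∪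
      ⋃ k ∈ Finset.range (n + 1), (A k ∩ {ω | 2 * a ≤ |S n ω - S k ω|}) := by
    intro ω hω
    by_cases hn : a ≤ |S n ω|
    · exact Or.inl hn
    · right
      classical
      have hf := Nat.find_spec hω
      have hmin := fun i (hi : i < Nat.find hω) => Nat.find_min hω hi
      simp only [mem_iUnion]
      refine ⟨Nat.find hω, Finset.mem_range.2 (by omega), ⟨hf.2, fun i hi => ?_⟩, ?_⟩
      · have := hmin i hi
        push Not at this
        exact this (by omega)
      · have h1 := hf.2
        have h2 := abs_sub_abs_le_abs_sub (S (Nat.find hω) ω) (S n ω)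
        rw [abs_sub_comm] at h2
        simp only [mem_ofPred_eq]
        linarith
  have hprod : ∀ k ∈ Finset.range (n + 1),
      P (A k ∩ {ω | 2 * a ≤ |S n ω - S k ω|}) ≤ P (A k) * (2 * c) := by
    intro k hk
    have hk' : k ≤ n := by simpa [Nat.lt_succ_iff] using hk
    have h1 : P (A k ∩ {ω | 2 * a ≤ |S n ω - S k ω|}) =
        P (A k) * P {ω | 2 * a ≤ |S n ω - S k ω|} := by
      have hB : MeasurableSet {f : Iic k → ℝ | 3 * a ≤ |f ⟨k, mem_Iic.2 le_rfl⟩| ∧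
          ∀ i : Iic k, i.1 < k → |f i| < 3 * a} := by
        have h1 : MeasurableSet {f : Iic k → ℝ | ∀ i : Iic k, i.1 < k → |f i| < 3 * a} := by
          have : {f : Iic k → ℝ | ∀ i : Iic k, i.1 < k → |f i| < 3 * a} =
              ⋂ i : Iic k, ⋂ (_ : i.1 < k), {f | |f i| < 3 * a} := by
            ext ω; simp
          rw [this]
          exact MeasurableSet.iInter fun i => MeasurableSet.iInter fun _ =>
            measurableSet_lt (measurable_pi_apply i).abs measurable_const
        exact (measurableSet_le measurable_const (measurable_pi_apply _).abs).inter h1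
      have := (hind k hk').measure_inter_preimage_eq_mul _ _ hB
        (measurableSet_le measurable_const measurable_id.abs : MeasurableSet {x : ℝ | 2 * a ≤ |x|})
      have hA : A k = (fun ω (i : Iic k) => S i ω) ⁻¹' {f : Iic k → ℝ |
          3 * a ≤ |f ⟨k, mem_Iic.2 le_rfl⟩| ∧ ∀ i : Iic k, i.1 < k → |f i| < 3 * a} := by
        ext ω
        simp only [A, mem_ofPred_eq, mem_preimage, Subtype.forall, mem_Iic]
        exact ⟨fun h => ⟨h.1, fun i _ hi => h.2 i hi⟩, fun h => ⟨h.1, fun i hi => h.2 i hi.le hi⟩⟩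
      rw [hA]
      exact this
    rw [h1]
    gcongr
    calc P {ω | 2 * a ≤ |S n ω - S k ω|} ≤ P ({ω | a ≤ |S n ω|} ∪ {ω | a ≤ |S k ω|}) := by
          refine measure_mono fun ω hω => ?_
          by_contra hcon
          simp only [mem_union, mem_ofPred_eq, not_or, not_le] at hcon hω
          linarith [abs_sub (S n ω) (S k ω)]
      _ ≤ c + c := (measure_union_le _ _).trans (add_le_add (hc n le_rfl) (hc k hk'))
      _ = 2 * c := (two_mul c).symm
  calc P {ω | ∃ k ≤ n, 3 * a ≤ |S k ω|}
      ≤ c + ∑ k ∈ Finset.range (n + 1), P (A k) * (2 * c) := by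
        refine (measure_mono hsub).trans ((measure_union_le _ _).trans ?_)
        refine add_le_add (hc n le_rfl) ?_
        exact (measure_biUnion_finset_le _ _).trans (Finset.sum_le_sum hprod)
    _ = c + P (⋃ k ∈ Finset.range (n + 1), A k) * (2 * c) := by
        rw [← Finset.sum_mul, measure_biUnion_finset (fun i _ j _ hij => hAd hij)
          fun k _ => hAm k]
    _ ≤ c + 1 * (2 * c) := by gcongr; exact prob_le_one
    _ = 3 * c := by ring

end Independence

/-! ### Moments from tails. -/

section Tail

variable {Ω : Type*} [MeasurableSpace Ω] {P : Measure Ω}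

/-- A polynomial tail bound gives finite moments of lower order. -/
theorem lintegral_rpow_lt_top_of_tail [IsFiniteMeasure P] {f : Ω → ℝ≥0∞} {C p q : ℝ} (hp : 0 < p)
    (hpq : p < q) (hC : 0 ≤ C)
    (h : ∀ a : ℝ, 0 < a → P {ω | ENNReal.ofReal a < f ω} ≤ ENNReal.ofReal (C * a ^ (-q))) :
    ∫⁻ ω, f ω ^ p ∂P < ⊤ := by
  -- The values of `f` are sorted dyadically. Since `f` need not be measurable, measurable hulls of
  -- its superlevel sets replace them.
  let A : ℕ → Set Ω := fun n => toMeasurable P {ω | ENNReal.ofReal (2 ^ n / 2) < f ω}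
  let b : ℕ → ℝ := fun n => ((2 : ℝ) ^ (n + 1)) ^ p
  have hb1 : ∀ n, 1 ≤ b n := fun n => Real.one_le_rpow (one_le_pow₀ (by norm_num)) hp.le
  have hpt : ∀ ω, f ω ^ p ≤ 1 + ∑' n, (A n).indicator (fun _ => ENNReal.ofReal (b n)) ω := by
    intro ω
    have hA : ∀ n, ENNReal.ofReal (2 ^ n / 2) < f ω → ω ∈ A n := fun n hn =>
      subset_toMeasurable P _ hn
    rcases le_or_gt (f ω) 1 with h1 | h1
    · exact (ENNReal.rpow_le_one h1 hp.le).trans le_self_add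
    · by_cases htop : f ω = ⊤
      · have hsum : ∑' n, (A n).indicator (fun _ => ENNReal.ofReal (b n)) ω = ⊤ := by
          refine top_unique ?_
          rw [← ENNReal.tsum_const_eq_top_of_ne_zero (α := ℕ) one_ne_zero]
          refine ENNReal.tsum_le_tsum fun n => ?_
          rw [indicator_of_mem (hA n (by rw [htop]; exact ENNReal.ofReal_lt_top))]
          exact ENNReal.one_le_ofReal.2 (hb1 n)
        rw [hsum]; simp
      · obtain ⟨x, hx⟩ : ∃ x : ℝ, f ω = ENNReal.ofReal x := ⟨_, (ENNReal.ofReal_toReal htop).symm⟩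
        have hx1 : 1 < x := by rw [hx] at h1; simpa using h1
        obtain ⟨n, hn1, hn2⟩ := exists_nat_pow_near hx1.le (one_lt_two)
        refine le_trans ?_ (le_add_left (ENNReal.le_tsum n))
        have hpow : (0 : ℝ) < 2 ^ n := by positivity
        rw [indicator_of_mem (hA n (by
          rw [hx]; exact (ENNReal.ofReal_lt_ofReal_iff (by linarith)).2 (by linarith))), hx,
          ENNReal.ofReal_rpow_of_pos (by linarith)]
        exact ENNReal.ofReal_le_ofReal (Real.rpow_le_rpow (by linarith) hn2.le hp.le)
  have hterm : ∀ n, ENNReal.ofReal (b n) * P (A n) ≤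
      ENNReal.ofReal (2 ^ p * C * 2 ^ q * ((2 : ℝ) ^ (p - q)) ^ n) := by
    intro n
    rw [measure_toMeasurable]
    refine (mul_le_mul_right (h _ (by positivity)) _).trans_eq ?_
    rw [← ENNReal.ofReal_mul (by positivity)]
    congr 1
    have e1 : b n = 2 ^ p * 2 ^ (n * p) := by
      simp only [b]
      rw [← Real.rpow_natCast, ← Real.rpow_mul (by norm_num), ← Real.rpow_add (by norm_num)]
      push_cast; ring_nf
    have e2 : ((2 : ℝ) ^ n / 2) ^ (-q) = 2 ^ q * 2 ^ (-(n * q)) := by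
      rw [← Real.rpow_natCast, ← Real.rpow_sub_one (by norm_num), ← Real.rpow_mul (by norm_num),
        ← Real.rpow_add (by norm_num)]
      ring_nf
    have e3 : ((2 : ℝ) ^ (p - q)) ^ n = 2 ^ (n * p) * 2 ^ (-(n * q)) := by
      rw [← Real.rpow_natCast, ← Real.rpow_mul (by norm_num), ← Real.rpow_add (by norm_num)]
      ring_nf
    rw [e1, e2, e3]; ring
  calc ∫⁻ ω, f ω ^ p ∂P
      ≤ ∫⁻ ω, 1 + ∑' n, (A n).indicator (fun _ => ENNReal.ofReal (b n)) ω ∂P := lintegral_mono hpt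
    _ = P univ + ∑' n, ENNReal.ofReal (b n) * P (A n) := by
        rw [lintegral_add_left measurable_const, lintegral_tsum fun n =>
          (measurable_const.indicator (measurableSet_toMeasurable _ _)).aemeasurable]
        simp [A]
    _ ≤ P univ + ∑' n : ℕ, ENNReal.ofReal (2 ^ p * C * 2 ^ q * ((2 : ℝ) ^ (p - q)) ^ n) := by
        gcongr with n; exact hterm n
    _ < ⊤ := by
        refine ENNReal.add_lt_top.2 ⟨measure_lt_top _ _, ?_⟩
        have hs : Summable fun n : ℕ => 2 ^ p * C * 2 ^ q * ((2 : ℝ) ^ (p - q)) ^ n :=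
          (summable_geometric_of_lt_one (by positivity)
            (Real.rpow_lt_one_of_one_lt_of_neg (by norm_num) (by linarith))).mul_left _
        rw [← ENNReal.ofReal_tsum_of_nonneg (fun n => by positivity) hs]
        exact ENNReal.ofReal_lt_top

end Tail

/-! ### Pathwise calculus for the exponential integral. -/

section Path

theorem IsCadlag.comp_min {f : ℝ≥0 → ℝ} (hf : IsCadlag f) (s : ℝ≥0) :
    IsCadlag fun t => f (min t s) := by
  refine ⟨fun t => (hf.1 (min t s)).comp (f := fun t => min t s) (by fun_prop)
    fun u hu => mem_Ici.2 (min_le_min_right _ (mem_Ici.1 hu)), fun t => ?_⟩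
  rcases le_or_gt t s with h | h
  · obtain ⟨l, hl⟩ := hf.2 t
    refine ⟨l, hl.congr' ?_⟩
    filter_upwards [self_mem_nhdsWithin] with u hu
    rw [min_eq_left ((le_of_lt hu).trans h)]
  · refine ⟨f s, tendsto_const_nhds.congr' ?_⟩
    filter_upwards [mem_nhdsWithin_of_mem_nhds (Ioi_mem_nhds h)] with u hu
    rw [min_eq_right (le_of_lt hu)]

theorem IsCadlag.comp_max {f : ℝ≥0 → ℝ} (hf : IsCadlag f) (s : ℝ≥0) :
    IsCadlag fun t => f (max t s) := by
  refine ⟨fun t => (hf.1 (max t s)).comp (f := fun t => max t s) (by fun_prop)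
    fun u hu => mem_Ici.2 (max_le_max_right _ (mem_Ici.1 hu)), fun t => ?_⟩
  rcases le_or_gt t s with h | h
  · refine ⟨f s, tendsto_const_nhds.congr' ?_⟩
    filter_upwards [self_mem_nhdsWithin] with u hu
    rw [max_eq_right ((le_of_lt hu).trans h)]
  · obtain ⟨l, hl⟩ := hf.2 t
    refine ⟨l, hl.congr' ?_⟩
    filter_upwards [mem_nhdsWithin_of_mem_nhds (Ioi_mem_nhds h)] with u hu
    rw [max_eq_left (le_of_lt hu)]

variable {Ω : Type*} {z : ℝ≥0 → Ω → ℝ} {ω : Ω}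

/-- The factor `e^{lam t}` frees the integrand of `t`: the result is `∫₀ᵗ e^{lam u} dz(u)`, a
process with independent increments. -/
theorem exp_mul_expIntegral (lam : ℝ) (t : ℝ≥0) (h0 : z 0 ω = 0) :
    Real.exp (lam * t) * expIntegral z lam t ω =
      Real.exp (lam * t) * z t ω - ∫ u in (0 : ℝ)..t, lam * Real.exp (lam * u) * z u.toNNReal ω := by
  have h1 : ∫ u in (0 : ℝ)..t, lam * Real.exp (-lam * (t - u)) * z u.toNNReal ω =
      Real.exp (-(lam * t)) * ∫ u in (0 : ℝ)..t, lam * Real.exp (lam * u) * z u.toNNReal ω := by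
    rw [← intervalIntegral.integral_const_mul]
    congr 1; funext u
    have : Real.exp (-lam * (t - u)) = Real.exp (-(lam * t)) * Real.exp (lam * u) := by
      rw [← Real.exp_add]; ring_nf
    rw [this]; ring
  rw [expIntegral, h1, h0, mul_zero, sub_zero, mul_sub, ← mul_assoc, ← Real.exp_add]
  simp

theorem continuous_mul_exp (lam : ℝ) : Continuous fun u : ℝ => lam * Real.exp (lam * u) := by
  fun_prop

theorem integral_mul_exp (lam a b : ℝ) :
    ∫ u in a..b, lam * Real.exp (lam * u) = Real.exp (lam * b) - Real.exp (lam * a) := by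
  refine intervalIntegral.integral_eq_sub_of_hasDerivAt (f := fun u => Real.exp (lam * u))
    (fun u _ => ?_) ((continuous_mul_exp lam).intervalIntegrable _ _)
  have := ((hasDerivAt_id u).const_mul lam).exp
  simpa [mul_comm] using this

/-- The increment after `s` involves only `z u - z s` for `u ≥ s`; the multiples of `z s` cancel
because `lam * e^{lam u}` integrates to the difference of the exponentials. The maximum with `s`
makes this dependence explicit. -/
theorem exp_mul_expIntegral_sub (hc : IsCadlag fun t => z t ω) (h0 : z 0 ω = 0) (lam : ℝ)
    {s t : ℝ≥0} (hst : s ≤ t) :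
    Real.exp (lam * t) * expIntegral z lam t ω - Real.exp (lam * s) * expIntegral z lam s ω =
      Real.exp (lam * t) * (z t ω - z s ω) -
        ∫ u in (s : ℝ)..t, lam * Real.exp (lam * u) * (z (max u.toNNReal s) ω - z s ω) := by
  have hi := hc.intervalIntegrable_mul (continuous_mul_exp lam)
  have h1 : ∫ u in (s : ℝ)..t, lam * Real.exp (lam * u) * (z (max u.toNNReal s) ω - z s ω) =
      (∫ u in (s : ℝ)..t, lam * Real.exp (lam * u) * z u.toNNReal ω) -
        (Real.exp (lam * t) - Real.exp (lam * s)) * z s ω := by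
    rw [← integral_mul_exp, ← intervalIntegral.integral_mul_const,
      ← intervalIntegral.integral_sub (hi _ _) (Continuous.intervalIntegrable (by fun_prop) _ _)]
    refine intervalIntegral.integral_congr fun u hu => ?_
    rw [uIcc_of_le (NNReal.coe_le_coe.2 hst)] at hu
    have : s ≤ u.toNNReal := by rw [← Real.toNNReal_coe (r := s)]; exact Real.toNNReal_mono hu.1
    simp only [max_eq_left this]
    ring
  rw [exp_mul_expIntegral lam t h0, exp_mul_expIntegral lam s h0, h1,
    ← intervalIntegral.integral_add_adjacent_intervals (hi 0 s) (hi s t)]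
  ring

theorem continuousWithinAt_expIntegral (hc : IsCadlag fun t => z t ω) (h0 : z 0 ω = 0) (lam : ℝ)
    (t : ℝ≥0) : ContinuousWithinAt (fun t => expIntegral z lam t ω) (Ici t) t := by
  have h1 : (fun t : ℝ≥0 => expIntegral z lam t ω) = fun t : ℝ≥0 => Real.exp (-(lam * t)) *
      (Real.exp (lam * t) * z t ω - ∫ u in (0 : ℝ)..t, lam * Real.exp (lam * u) * z u.toNNReal ω) := by
    funext t
    rw [← exp_mul_expIntegral lam t h0, ← mul_assoc, ← Real.exp_add]
    simp
  have hcont : Continuous fun t : ℝ≥0 => ∫ u in (0 : ℝ)..t, lam * Real.exp (lam * u) *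
      z u.toNNReal ω :=
    (intervalIntegral.continuous_primitive
      (fun a b => hc.intervalIntegrable_mul (continuous_mul_exp lam) a b) 0).comp
      NNReal.continuous_coe
  rw [h1]
  have e1 : Continuous fun t : ℝ≥0 => Real.exp (-(lam * t)) := by fun_prop
  have e2 : Continuous fun t : ℝ≥0 => Real.exp (lam * t) := by fun_prop
  exact e1.continuousWithinAt.mul
    ((e2.continuousWithinAt.mul (hc.1 t)).sub hcont.continuousWithinAt)

/-- With `Z` the exponential integral, `dz = dZ + lam Z dt`, so `z 1 = Z 1 + lam ∫₀¹ Z`. Here `g` is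
the last term: it vanishes at `0` and has right derivative `lam * Z`. -/
theorem abs_le_of_expIntegral_le (hc : IsCadlag fun t => z t ω) (h0 : z 0 ω = 0) {lam : ℝ}
    (hlam : 0 < lam) {a : ℝ} (h : ∀ t ≤ (1 : ℝ≥0), |expIntegral z lam t ω| ≤ a) :
    |z 1 ω| ≤ (1 + lam) * a := by
  let I : ℝ → ℝ := fun t => ∫ u in (0 : ℝ)..t, lam * Real.exp (lam * u) * z u.toNNReal ω
  have hI : ∀ t, HasDerivWithinAt I (lam * Real.exp (lam * t) * z t.toNNReal ω) (Ici t) t := by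
    intro t
    have hr : ContinuousWithinAt (fun u : ℝ => lam * Real.exp (lam * u) * z u.toNNReal ω)
        (Ici t) t := (continuous_mul_exp lam).continuousWithinAt.mul
          (hc.continuousWithinAt_toNNReal t)
    refine intervalIntegral.integral_hasDerivWithinAt_right
      (hc.intervalIntegrable_mul (continuous_mul_exp lam) 0 t) ?_ (hr.mono Ioi_subset_Ici_self)
    exact (((continuous_mul_exp lam).measurable.mul
      hc.measurable_toNNReal).stronglyMeasurable).stronglyMeasurableAtFilter
  let g : ℝ → ℝ := fun t => Real.exp (-(lam * t)) * I t
  have hIc : Continuous I := intervalIntegral.continuous_primitive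
      (fun a b => hc.intervalIntegrable_mul (continuous_mul_exp lam) a b) 0
  have hE : ∀ t : ℝ≥0, Real.exp (-(lam * t)) * (Real.exp (lam * t) * expIntegral z lam t ω) =
      expIntegral z lam t ω := fun t => by rw [← mul_assoc, ← Real.exp_add]; simp
  have hg : ∀ t ∈ Ico (0 : ℝ) 1, HasDerivWithinAt g (lam * expIntegral z lam t.toNNReal ω)
      (Ici t) t := by
    intro t ht
    have h1 : HasDerivAt (fun t : ℝ => Real.exp (-(lam * t))) (Real.exp (-(lam * t)) * -lam) t := by
      simpa using (((hasDerivAt_id t).const_mul lam).neg).exp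
    refine (h1.hasDerivWithinAt.mul (hI t)).congr_deriv ?_
    rw [← hE, exp_mul_expIntegral lam _ h0, Real.coe_toNNReal t ht.1]
    ring
  have hb := norm_image_sub_le_of_norm_deriv_right_le_segment (f := g) (a := 0) (b := 1)
    (C := lam * a) (by fun_prop) hg (fun t ht => by
      rw [norm_mul, Real.norm_of_nonneg hlam.le]
      refine mul_le_mul_of_nonneg_left (h _ ?_) hlam.le
      rw [← Real.toNNReal_one]; exact Real.toNNReal_mono ht.2.le) 1 ⟨zero_le_one, le_rfl⟩
  have e1 : expIntegral z lam 1 ω = z 1 ω - g 1 := by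
    rw [← hE, exp_mul_expIntegral lam 1 h0]
    simp only [g, I, NNReal.coe_one]
    rw [mul_sub, ← mul_assoc, ← Real.exp_add]; simp
  have e2 : g 0 = 0 := by simp [g, I]
  rw [e2, sub_zero, Real.norm_eq_abs, sub_zero, mul_one] at hb
  have := h 1 le_rfl
  rw [e1] at this
  have h3 := abs_sub_abs_le_abs_sub (z 1 ω) (g 1)
  linarith

end Path

/-! ### Tails of the exponential integral over unit windows. -/

section Maximal

variable {Ω : Type*} [MeasurableSpace Ω] {P : Measure Ω} {z : ℝ≥0 → Ω → ℝ} {ν : Measure ℝ}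

theorem IsPureJumpLevyProcess.ae_cadlag_zero (hz : IsPureJumpLevyProcess P z ν) :
    ∀ᵐ ω ∂P, IsCadlag (fun t => z t ω) ∧ z 0 ω = 0 := hz.cadlag.and hz.zero

/-- Independence of the past and future increments can only be transferred through measurable
functionals of paths, which this lemma and the next one supply. -/
theorem exists_past_functional (hz : IsPureJumpLevyProcess P z ν) (lam : ℝ) {t s : ℝ≥0}
    (hts : t ≤ s) : ∃ g : (Iic s → ℝ) → ℝ, Measurable g ∧
      (fun ω => Real.exp (lam * t) * expIntegral z lam t ω) =ᵐ[P]
        fun ω => g fun u => z u ω - z s ω := by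
  -- Subtracting the coordinate at time `0` recovers `z u` from the increments `z u - z s`, because
  -- `z 0 = 0` almost surely.
  let w : ℝ≥0 → (Iic s → ℝ) → ℝ := fun u x =>
    x ⟨min u s, mem_Iic.2 (min_le_right _ _)⟩ - x ⟨0, mem_Iic.2 zero_le⟩
  have hwm : ∀ u, Measurable (w u) := fun u =>
    (measurable_pi_apply _).sub (measurable_pi_apply _)
  obtain ⟨g, hg, hgw⟩ := exists_measurable_eq_integral hwm (continuous_mul_exp lam)
    (a := 0) (b := t) t.coe_nonneg
  refine ⟨fun x => Real.exp (lam * t) * w t x - g x,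
    (Measurable.const_mul (hwm t) _).sub hg, ?_⟩
  filter_upwards [hz.ae_cadlag_zero] with ω ⟨hc, h0⟩
  have hw : ∀ u, w u (fun u => z u ω - z s ω) = z (min u s) ω := fun u => by simp [w, h0]
  have hwc : IsCadlag fun u => w u (fun u => z u ω - z s ω) := by
    simp only [hw]; exact hc.comp_min s
  rw [exp_mul_expIntegral lam t h0, ← hgw _ hwc, hw, min_eq_left hts]
  congr 1
  refine intervalIntegral.integral_congr fun u hu => ?_
  rw [uIcc_of_le t.coe_nonneg] at hu
  have : u.toNNReal ≤ s := (Real.toNNReal_le_iff_le_coe.2 hu.2).trans hts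
  simp only [hw, min_eq_left this]

theorem exists_future_functional (hz : IsPureJumpLevyProcess P z ν) (lam : ℝ) {s t : ℝ≥0}
    (hst : s ≤ t) : ∃ g : (Ici s → ℝ) → ℝ, Measurable g ∧
      (fun ω => Real.exp (lam * t) * expIntegral z lam t ω -
        Real.exp (lam * s) * expIntegral z lam s ω) =ᵐ[P] fun ω => g fun u => z u ω - z s ω := by
  let w : ℝ≥0 → (Ici s → ℝ) → ℝ := fun u x => x ⟨max u s, mem_Ici.2 (le_max_right _ _)⟩
  obtain ⟨g, hg, hgw⟩ := exists_measurable_eq_integral (w := w)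
    (fun u => measurable_pi_apply _) (continuous_mul_exp lam)
    (a := s) (b := t) (NNReal.coe_le_coe.2 hst)
  refine ⟨fun x => Real.exp (lam * t) * w t x - g x,
    (measurable_const.mul (measurable_pi_apply _)).sub hg, ?_⟩
  filter_upwards [hz.ae_cadlag_zero] with ω ⟨hc, h0⟩
  have hwc : IsCadlag fun u => w u (fun u => z u ω - z s ω) :=
    (hc.comp_max s).comp_continuous (g := fun x => x - z s ω) (by fun_prop)
  rw [exp_mul_expIntegral_sub hc h0 lam hst, ← hgw _ hwc]
  simp only [w, max_eq_left hst]

theorem aemeasurable_expIntegral (hz : IsPureJumpLevyProcess P z ν) (lam : ℝ) (t : ℝ≥0) :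
    AEMeasurable (fun ω => Real.exp (lam * t) * expIntegral z lam t ω) P := by
  obtain ⟨g, hg, hge⟩ := exists_past_functional hz lam (le_refl t)
  exact ⟨_, hg.comp (measurable_pi_lambda _ fun u => (hz.measurable _).sub (hz.measurable _)), hge⟩

theorem indepFun_expIntegral [IsProbabilityMeasure P] (hz : IsPureJumpLevyProcess P z ν)
    (lam : ℝ) {τ : ℕ → ℝ≥0} (hτ : Monotone τ) {k n : ℕ} (hkn : k ≤ n) :
    IndepFun (fun ω (i : Iic k) => Real.exp (lam * τ i) * expIntegral z lam (τ i) ω)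
      (fun ω => Real.exp (lam * τ n) * expIntegral z lam (τ n) ω -
        Real.exp (lam * τ k) * expIntegral z lam (τ k) ω) P := by
  choose g hg hge using fun i : Iic k => exists_past_functional hz lam (hτ i.2)
  obtain ⟨f, hf, hfe⟩ := exists_future_functional hz lam (hτ hkn)
  have h1 := (indepFun_past_future hz.indep hz.measurable (τ k)).comp
    (measurable_pi_lambda (fun x (i : Iic k) => g i x) hg) hf
  refine (IndepFun.process_congr_left h1 fun i => (hge i).symm).congr ?_ hfe.symm
  exact .rfl

/-- Etemadi's inequality applies to `Y t = e^{lam t} Z(t)` on grids of mesh `1/(N+1)`, and right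
continuity lets the grid see every time in the window. The weight varies by at most `e^{lam}` over
the window, which is the loss in the level. -/
theorem measure_exists_lt_expIntegral_le [IsProbabilityMeasure P]
    (hz : IsPureJumpLevyProcess P z ν) {lam : ℝ} (hlam : 0 < lam) {a : ℝ} (ha : 0 < a) {c : ℝ≥0∞}
    (hc : ∀ t, P {ω | a ≤ |expIntegral z lam t ω|} ≤ c) (j : ℕ) :
    P {ω | ∃ t : ℝ≥0, j ≤ t ∧ t ≤ j + 1 ∧ 3 * Real.exp lam * a < |expIntegral z lam t ω|} ≤
      3 * c := by
  let Y : ℝ≥0 → Ω → ℝ := fun t ω => Real.exp (lam * t) * expIntegral z lam t ω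
  have hY : ∀ t, AEMeasurable (Y t) P := aemeasurable_expIntegral hz lam
  let τ : ℕ → ℕ → ℝ≥0 := fun N k => j + k / (N + 1)
  have hτ : ∀ N, Monotone (τ N) := fun N a b hab => by
    simp only [τ]; gcongr
  -- The weight at the right end: `|Y| ≥ b` inside the window forces `|Z| ≥ a`, while `|Z| > 3
  -- e^{lam} a` forces `|Y| ≥ 3 * b`.
  let b := a * Real.exp (lam * (j + 1))
  have hτ1 : ∀ N k, k ≤ N + 1 → τ N k ≤ j + 1 := by
    intro N k hk
    simp only [τ]
    gcongr
    exact div_le_one_of_le₀ (by exact_mod_cast hk) zero_le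
  have hbound : ∀ N, P {ω | ∃ k ≤ N + 1, 3 * b ≤ |Y (τ N k) ω|} ≤ 3 * c := by
    intro N
    have hmk : ∀ k, (fun ω => (hY (τ N k)).mk _ ω) =ᵐ[P] Y (τ N k) := fun k =>
      (hY (τ N k)).ae_eq_mk.symm
    have hcongr : P {ω | ∃ k ≤ N + 1, 3 * b ≤ |Y (τ N k) ω|} =
        P {ω | ∃ k ≤ N + 1, 3 * b ≤ |(hY (τ N k)).mk _ ω|} := by
      refine measure_congr ?_
      filter_upwards [ae_all_iff.2 hmk] with ω hω
      refine propext ?_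
      show (∃ k ≤ N + 1, 3 * b ≤ |Y (τ N k) ω|) ↔ ∃ k ≤ N + 1, 3 * b ≤ |(hY (τ N k)).mk _ ω|
      simp only [hω]
    rw [hcongr]
    refine measure_exists_le_of_indepFun (S := fun k => (hY (τ N k)).mk _)
      (fun k => (hY (τ N k)).measurable_mk) (fun k hk => ?_) (fun k hk => ?_)
    · refine (IndepFun.process_congr_left (indepFun_expIntegral hz lam (hτ N) hk)
        fun i => (hmk i).symm).congr .rfl ?_
      exact (hmk _).symm.sub (hmk _).symm
    · refine le_trans (measure_mono_ae ?_) (hc (τ N k))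
      filter_upwards [hmk k] with ω hω h
      have h' : b ≤ |(hY (τ N k)).mk _ ω| := h
      rw [hω] at h'
      simp only [Y, abs_mul, Real.abs_exp, b] at h'
      have h2 : Real.exp (lam * τ N k) ≤ Real.exp (lam * (j + 1)) := by
        have : ((τ N k : ℝ≥0) : ℝ) ≤ j + 1 := by exact_mod_cast hτ1 N k hk
        exact Real.exp_le_exp.2 (mul_le_mul_of_nonneg_left this hlam.le)
      have h3 : a * Real.exp (lam * (j + 1)) ≤ |expIntegral z lam (τ N k) ω| *
          Real.exp (lam * (j + 1)) := by
        rw [mul_comm |_|]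
        exact h'.trans (mul_le_mul_of_nonneg_right h2 (abs_nonneg _))
      exact le_of_mul_le_mul_right h3 (Real.exp_pos _)
  refine le_trans (measure_mono_ae ?_) (measure_eventually_le (Eventually.of_forall hbound))
  filter_upwards [hz.ae_cadlag_zero] with ω ⟨hcad, h0⟩ hω
  obtain ⟨t, ht0, ht1, hlt⟩ := hω
  show ∀ᶠ N in atTop, ∃ k ≤ N + 1, 3 * b ≤ |Y (τ N k) ω|
  have hYb : ∀ s : ℝ≥0, j ≤ s → 3 * Real.exp lam * a < |expIntegral z lam s ω| →
      3 * b ≤ |Y s ω| := by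
    intro s hs h
    simp only [Y, abs_mul, Real.abs_exp, b]
    have h2 : Real.exp (lam * j) ≤ Real.exp (lam * s) := by
      have : (j : ℝ) ≤ s := by exact_mod_cast hs
      exact Real.exp_le_exp.2 (mul_le_mul_of_nonneg_left this hlam.le)
    calc 3 * (a * Real.exp (lam * (j + 1))) = Real.exp (lam * j) * (3 * Real.exp lam * a) := by
          rw [mul_add, Real.exp_add, mul_one]; ring
      _ ≤ _ := mul_le_mul h2 h.le (by positivity) (Real.exp_pos _).le
  -- The right end belongs to every grid. It is treated apart because approximation from the right
  -- would leave the window there.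
  rcases eq_or_lt_of_le ht1 with heq | hlt1
  · refine Eventually.of_forall fun N => ⟨N + 1, le_rfl, ?_⟩
    have : τ N (N + 1) = t := by
      simp only [τ]
      rw [heq]; push_cast
      rw [div_self (by positivity)]
    rw [this]
    exact hYb t ht0 hlt
  · have hZ := (continuousWithinAt_expIntegral hcad h0 lam t).abs.tendsto
    have hgrid : Tendsto (fun N : ℕ => (((⌊(N + 1 : ℝ) * t⌋ : ℝ) + 1) / (N + 1)).toNNReal) atTop
        (𝓝[≥] t) := by
      have h1 : Tendsto Real.toNNReal (𝓝[≥] (t : ℝ)) (𝓝[≥] t) := by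
        refine tendsto_nhdsWithin_iff.2 ⟨?_, ?_⟩
        · have := (continuous_real_toNNReal.tendsto (t : ℝ)).mono_left
            (nhdsWithin_le_nhds (s := Ici (t : ℝ)))
          simpa using this
        · filter_upwards [self_mem_nhdsWithin] with u hu
          rw [mem_Ici, ← Real.toNNReal_coe (r := t)]
          exact Real.toNNReal_mono hu
      exact h1.comp (tendsto_floor_add_one_div t)
    have hev := (hZ.comp hgrid).eventually (lt_mem_nhds hlt)
    filter_upwards [hev] with N hN
    have hN1 : (0 : ℝ) < N + 1 := by positivity
    have ht0' : (j : ℝ) ≤ t := by exact_mod_cast ht0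
    have ht1' : (t : ℝ) < j + 1 := by exact_mod_cast hlt1
    have hfl : ((j * (N + 1) : ℕ) : ℤ) ≤ ⌊(N + 1 : ℝ) * t⌋ := by
      rw [Int.le_floor]; push_cast; nlinarith
    have hfu : ⌊(N + 1 : ℝ) * t⌋ < (((j + 1) * (N + 1) : ℕ) : ℤ) := by
      rw [Int.floor_lt]; push_cast; nlinarith
    obtain ⟨k, hk⟩ := Int.eq_ofNat_of_zero_le
      (show 0 ≤ ⌊(N + 1 : ℝ) * t⌋ + 1 - ((j * (N + 1) : ℕ) : ℤ) by omega)
    have hkN : k ≤ N + 1 := by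
      push_cast at hfu hk
      have : (k : ℤ) ≤ N + 1 := by nlinarith
      exact_mod_cast this
    have hτk : (((⌊(N + 1 : ℝ) * t⌋ : ℝ) + 1) / (N + 1)).toNNReal = τ N k := by
      have h2 : ((⌊(N + 1 : ℝ) * t⌋ : ℝ) + 1) = j * (N + 1) + k := by
        have : (⌊(N + 1 : ℝ) * t⌋ : ℤ) + 1 = j * (N + 1) + k := by push_cast at hk; linarith
        exact_mod_cast this
      rw [h2, ← NNReal.coe_inj, Real.coe_toNNReal _ (by positivity)]
      simp only [τ]
      push_cast
      field_simp
    refine ⟨k, hkN, hYb _ ?_ ?_⟩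
    · simp only [τ]; exact le_self_add
    · rw [← hτk]; exact hN

/-- The suprema of `∫₀ᵗ e^{-lam (t-s)} dz(s)` over unit time windows have uniform polynomial
tails. -/
theorem exists_tail_expIntegral [IsProbabilityMeasure P] (hz : IsPureJumpLevyProcess P z ν)
    {α : ℝ} (hmom : MomentAssumption P z α) {lam q : ℝ} (hlam : 0 < lam) (hq : 0 < q)
    (hqα : q < α) : ∃ C : ℝ, 0 ≤ C ∧ ∀ (j : ℕ) (a : ℝ), 0 < a →
      P {ω | ∃ t : ℝ≥0, j ≤ t ∧ t ≤ j + 1 ∧ a < |expIntegral z lam t ω|} ≤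
        ENNReal.ofReal (C * a ^ (-q)) := by
  obtain ⟨D, hD⟩ : ∃ D : ℝ≥0, (D : ℝ≥0∞) = ⨆ t : ℝ≥0, ∫⁻ ω, ‖expIntegral z lam t ω‖ₑ ^ q ∂P :=
    ⟨_, ENNReal.coe_toNNReal (hmom lam q hlam hq hqα).ne⟩
  have htail : ∀ a : ℝ, 0 < a → ∀ t, P {ω | a ≤ |expIntegral z lam t ω|} ≤
      ENNReal.ofReal (D * a ^ (-q)) := by
    intro a ha t
    have h1 : ∫⁻ ω, ‖expIntegral z lam t ω‖ₑ ^ q ∂P ≤ D := by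
      rw [hD]; exact le_iSup (fun t => ∫⁻ ω, ‖expIntegral z lam t ω‖ₑ ^ q ∂P) t
    have hm : AEMeasurable (fun ω => expIntegral z lam t ω) P := by
      have := (aemeasurable_expIntegral hz lam t).const_mul (Real.exp (-(lam * t)))
      refine this.congr (ae_of_all _ fun ω => ?_)
      simp only
      rw [← mul_assoc, ← Real.exp_add]; simp
    have h2 := mul_meas_ge_le_lintegral₀ (hm.enorm.pow_const q) (ENNReal.ofReal (a ^ q))
    have h3 : {ω | a ≤ |expIntegral z lam t ω|} ⊆
        {ω | ENNReal.ofReal (a ^ q) ≤ ‖expIntegral z lam t ω‖ₑ ^ q} := by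
      intro ω hω
      rw [mem_ofPred_eq, ← ENNReal.ofReal_rpow_of_pos ha]
      refine ENNReal.rpow_le_rpow ?_ hq.le
      rw [Real.enorm_eq_ofReal_abs]
      exact ENNReal.ofReal_le_ofReal hω
    refine (measure_mono h3).trans ?_
    have hpos : 0 < a ^ q := Real.rpow_pos_of_pos ha q
    rw [Real.rpow_neg ha.le, ← div_eq_mul_inv, ENNReal.ofReal_div_of_pos hpos,
      ENNReal.ofReal_coe_nnreal, ENNReal.le_div_iff_mul_le (Or.inl (by simpa using hpos))
      (Or.inl ENNReal.ofReal_ne_top), mul_comm]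
    exact h2.trans h1
  refine ⟨3 * D * (3 * Real.exp lam) ^ q, by positivity, fun j a ha => ?_⟩
  have he : (0 : ℝ) < 3 * Real.exp lam := by positivity
  have h := measure_exists_lt_expIntegral_le hz hlam (div_pos ha he) (htail _ (div_pos ha he)) j
  rw [mul_div_cancel₀ _ he.ne'] at h
  refine h.trans_eq ?_
  rw [← ENNReal.ofReal_ofNat, ← ENNReal.ofReal_mul (by norm_num), Real.div_rpow ha.le he.le,
    Real.rpow_neg he.le]
  congr 1
  field_simp

/-- With `lam = 1`, `|z 1|` is at most twice the supremum of the exponential integral over `[0, 1]`.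
Its tail is available at an order `r` above `q`, which leaves room to integrate. -/
theorem lintegral_enorm_rpow_lt_top [IsProbabilityMeasure P] (hz : IsPureJumpLevyProcess P z ν)
    {α : ℝ} (hmom : MomentAssumption P z α) {q : ℝ} (hq : 0 < q) (hqα : q < α) :
    ∫⁻ ω, ‖z 1 ω‖ₑ ^ q ∂P < ⊤ := by
  obtain ⟨r, hqr, hrα⟩ := exists_between hqα
  obtain ⟨C, hC, h⟩ := exists_tail_expIntegral hz hmom one_pos (hq.trans hqr) hrα
  refine lintegral_rpow_lt_top_of_tail hq hqr (C := C * 2 ^ r) (by positivity) fun a ha => ?_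
  have ha2 : 0 < a / 2 := by positivity
  refine (measure_mono_ae ?_).trans ((h 0 (a / 2) ha2).trans_eq ?_)
  · filter_upwards [hz.ae_cadlag_zero] with ω ⟨hc, h0⟩ hω
    by_contra hcon
    have hle : ∀ t ≤ (1 : ℝ≥0), |expIntegral z 1 t ω| ≤ a / 2 := by
      intro t ht
      by_contra hlt
      exact hcon ⟨t, by simp, by simpa using ht, not_le.1 hlt⟩
    have h1 := abs_le_of_expIntegral_le hc h0 one_pos hle
    have hω' : ENNReal.ofReal a < ‖z 1 ω‖ₑ := hω
    rw [Real.enorm_eq_ofReal_abs] at hω'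
    have := (ENNReal.ofReal_lt_ofReal_iff'.1 hω').1
    linarith
  · rw [Real.div_rpow ha.le (by norm_num), Real.rpow_neg (by norm_num : (0:ℝ) ≤ 2)]
    congr 1
    field_simp

end Maximal

/-! ### The Lévy symbol and the tails of the Lévy measure. -/

section LevyMeasure

/-- The integrand of the Lévy symbol. -/
noncomputable def levyIntegrand (ξ y : ℝ) : ℂ :=
  Complex.exp (Complex.I * ξ * y) - 1 - if |y| ≤ 1 then Complex.I * ξ * y else 0

theorem norm_exp_I_mul_mul (ξ y : ℝ) : ‖Complex.exp (Complex.I * ξ * y)‖ = 1 := by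
  rw [mul_assoc, ← Complex.ofReal_mul, Complex.norm_exp_I_mul_ofReal]

theorem measurable_levyIntegrand : Measurable fun q : ℝ × ℝ => levyIntegrand q.1 q.2 := by
  unfold levyIntegrand
  refine Measurable.sub (by fun_prop) (Measurable.ite ?_ (by fun_prop) measurable_const)
  exact measurableSet_le (by fun_prop) measurable_const

/-- The bound factors into a function of `ξ` and a `ν`-integrable function of `y`, the form needed
for Fubini and domination. -/
theorem norm_levyIntegrand_le (ξ y : ℝ) :
    ‖levyIntegrand ξ y‖ ≤ 3 * (1 + ξ ^ 2) * min 1 (y ^ 2) := by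
  unfold levyIntegrand
  by_cases hy : |y| ≤ 1
  · have hy2 : y ^ 2 ≤ 1 := by rw [← sq_abs]; exact pow_le_one₀ (abs_nonneg _) hy
    rw [if_pos hy, min_eq_right hy2]
    have hn : ‖(Complex.I * ξ * y : ℂ)‖ = |ξ * y| := by
      simp [abs_mul]
    by_cases h : |ξ * y| ≤ 1
    · refine (Complex.norm_exp_sub_one_sub_id_le (hn ▸ h)).trans ?_
      rw [hn, sq_abs]
      nlinarith [sq_nonneg (ξ * y), sq_nonneg y]
    · have h1 : ‖Complex.exp (Complex.I * ξ * y) - 1 - Complex.I * ξ * y‖ ≤ 1 + 1 + |ξ * y| := by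
        refine (norm_sub_le _ _).trans (add_le_add ((norm_sub_le _ _).trans ?_) hn.le)
        rw [norm_exp_I_mul_mul]; simp
      refine h1.trans ?_
      push Not at h
      have : |ξ * y| ^ 2 = ξ ^ 2 * y ^ 2 := by rw [sq_abs]; ring
      nlinarith [sq_nonneg y]
  · have hy2 : 1 ≤ y ^ 2 := by
      rw [← sq_abs]; exact one_le_pow₀ (not_le.1 hy).le
    rw [if_neg hy, min_eq_left hy2, sub_zero]
    have h1 : ‖Complex.exp (Complex.I * ξ * y) - 1‖ ≤ 1 + 1 := by
      refine (norm_sub_le _ _).trans ?_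
      rw [norm_exp_I_mul_mul]; simp
    nlinarith [sq_nonneg ξ]

variable {ν : Measure ℝ}

theorem IsLevyMeasure.integrable_min (hν : IsLevyMeasure ν) :
    Integrable (fun y : ℝ => min 1 (y ^ 2)) ν := by
  refine ⟨by fun_prop, ?_⟩
  rw [hasFiniteIntegral_iff_ofReal (ae_of_all _ fun y => le_min zero_le_one (sq_nonneg y))]
  exact hν.2

theorem IsLevyMeasure.restrict_ne_zero (hν : IsLevyMeasure ν) :
    ν.restrict {y : ℝ | y ≠ 0} = ν := by
  refine Measure.restrict_eq_self_of_ae_mem ?_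
  rw [ae_iff]
  convert! hν.1 using 2
  ext y
  simp

theorem IsLevyMeasure.measure_le_abs_lt_top (hν : IsLevyMeasure ν) {r : ℝ} (hr : 0 < r) :
    ν {y | r ≤ |y|} < ⊤ := by
  have h0 : 0 < min 1 (r ^ 2) := lt_min one_pos (by positivity)
  have h := hν.integrable_min.measure_ge_lt_top h0
  refine (measure_mono fun y hy => ?_).trans_lt h
  have : r ^ 2 ≤ y ^ 2 := by rw [← sq_abs y]; exact pow_le_pow_left₀ hr.le hy 2
  exact min_le_min_left _ this

theorem IsLevyMeasure.sigmaFinite (hν : IsLevyMeasure ν) : SigmaFinite ν := by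
  refine ⟨⟨⟨fun n => {0} ∪ {y : ℝ | 1 / ((n : ℝ) + 1) ≤ |y|}, fun _ => trivial, fun n => ?_, ?_⟩⟩⟩
  · refine (measure_union_le _ _).trans_lt ?_
    rw [hν.1, zero_add]
    exact hν.measure_le_abs_lt_top (by positivity)
  · refine eq_univ_of_forall fun y => ?_
    by_cases hy : y = 0
    · exact mem_iUnion.2 ⟨0, Or.inl hy⟩
    · obtain ⟨n, hn⟩ := exists_nat_one_div_lt (abs_pos.2 hy)
      exact mem_iUnion.2 ⟨n, Or.inr hn.le⟩

theorem IsLevyMeasure.levySymbol_eq (hν : IsLevyMeasure ν) (ξ : ℝ) :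
    levySymbol ν ξ = ∫ y, levyIntegrand ξ y ∂ν := by
  rw [levySymbol, hν.restrict_ne_zero]; rfl

theorem IsLevyMeasure.integrable_levyIntegrand (hν : IsLevyMeasure ν) (ξ : ℝ) :
    Integrable (levyIntegrand ξ) ν :=
  (hν.integrable_min.const_mul (3 * (1 + ξ ^ 2))).mono'
    (measurable_levyIntegrand.comp (measurable_const.prodMk measurable_id)).aestronglyMeasurable
    (ae_of_all _ fun y => norm_levyIntegrand_le ξ y)

theorem re_exp_I_mul_mul (ξ y : ℝ) :
    (Complex.exp (Complex.I * ξ * y)).re = Real.cos (ξ * y) := by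
  rw [mul_assoc, mul_comm, ← Complex.ofReal_mul, Complex.exp_ofReal_mul_I_re]

theorem re_levyIntegrand (ξ y : ℝ) : (levyIntegrand ξ y).re = Real.cos (ξ * y) - 1 := by
  unfold levyIntegrand
  rw [Complex.sub_re, Complex.sub_re, re_exp_I_mul_mul, Complex.one_re]
  split_ifs <;> simp

theorem IsLevyMeasure.integrable_one_sub_cos (hν : IsLevyMeasure ν) (ξ : ℝ) :
    Integrable (fun y => 1 - Real.cos (ξ * y)) ν := by
  have := (hν.integrable_levyIntegrand ξ).re.neg
  refine this.congr (ae_of_all _ fun y => ?_)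
  simp [re_levyIntegrand]

theorem IsLevyMeasure.re_levySymbol (hν : IsLevyMeasure ν) (ξ : ℝ) :
    (levySymbol ν ξ).re = -∫ y, (1 - Real.cos (ξ * y)) ∂ν := by
  rw [hν.levySymbol_eq, ← integral_neg]
  have := integral_re (hν.integrable_levyIntegrand ξ)
  simp only [RCLike.re_to_complex] at this
  rw [← this]
  simp [re_levyIntegrand]

theorem IsLevyMeasure.re_levySymbol_nonpos (hν : IsLevyMeasure ν) (ξ : ℝ) :
    (levySymbol ν ξ).re ≤ 0 := by
  rw [hν.re_levySymbol, neg_nonpos]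
  exact integral_nonneg fun y => sub_nonneg.2 (Real.cos_le_one _)

theorem IsLevyMeasure.norm_levySymbol_le (hν : IsLevyMeasure ν) (ξ : ℝ) :
    ‖levySymbol ν ξ‖ ≤ 3 * (1 + ξ ^ 2) * ∫ y, min 1 (y ^ 2) ∂ν := by
  rw [hν.levySymbol_eq, ← integral_const_mul]
  exact norm_integral_le_of_norm_le (hν.integrable_min.const_mul _)
    (ae_of_all _ fun y => norm_levyIntegrand_le ξ y)

theorem one_sub_cos_le_rpow (u : ℝ) {q : ℝ} (hq : 0 < q) (hq2 : q ≤ 2) :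
    1 - Real.cos u ≤ 2 * |u| ^ q := by
  rcases le_or_gt |u| 1 with h | h
  · have h1 := Real.one_sub_sq_div_two_le_cos (x := u)
    have h2 : u ^ 2 ≤ |u| ^ q := by
      rw [← sq_abs, ← Real.rpow_natCast]
      exact Real.rpow_le_rpow_of_exponent_ge_of_imp (abs_nonneg _) h (by exact_mod_cast hq2)
        (fun _ h0 => absurd h0 (by norm_num))
    nlinarith [sq_nonneg u]
  · have h1 := Real.neg_one_le_cos u
    have h2 : 1 ≤ |u| ^ q := Real.one_le_rpow h.le hq.le
    linarith

variable {Ω : Type*} [MeasurableSpace Ω] {P : Measure Ω} [IsProbabilityMeasure P]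
  {z : ℝ≥0 → Ω → ℝ}

/-- The integral `h` is `-Re ψ(ξ)`, so `E cos(ξ z 1) ≤ e^{-h}`, while the moment gives `1 - E cos(ξ
z 1) ≤ 2 ξ^q m`. As `h` is at most `H` for `ξ ≤ 1`, the inequality `h e^{-h} ≤ 1 - e^{-h}` bounds
`h` itself. -/
theorem exists_integral_one_sub_cos_le (hz : IsPureJumpLevyProcess P z ν) {q : ℝ} (hq : 0 < q)
    (hq2 : q ≤ 2) (hm : ∫⁻ ω, ‖z 1 ω‖ₑ ^ q ∂P < ⊤) :
    ∃ D : ℝ, 0 ≤ D ∧ ∀ ξ : ℝ, 0 < ξ → ξ ≤ 1 → ∫ y, (1 - Real.cos (ξ * y)) ∂ν ≤ D * ξ ^ q := by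
  have hint : Integrable (fun ω => |z 1 ω| ^ q) P := by
    refine ⟨((hz.measurable 1).abs.pow_const q).aestronglyMeasurable, ?_⟩
    rw [hasFiniteIntegral_iff_ofReal (ae_of_all _ fun ω => Real.rpow_nonneg (abs_nonneg _) q)]
    refine lt_of_le_of_lt (lintegral_mono fun ω => ?_) hm
    rw [Real.enorm_eq_ofReal_abs, ENNReal.ofReal_rpow_of_nonneg (abs_nonneg _) hq.le]
  set m := ∫ ω, |z 1 ω| ^ q ∂P
  set H := 6 * ∫ y, min 1 (y ^ 2) ∂ν
  have hm0 : 0 ≤ m := integral_nonneg fun ω => Real.rpow_nonneg (abs_nonneg _) q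
  refine ⟨Real.exp H * (2 * m), by positivity, fun ξ hξ0 hξ1 => ?_⟩
  set h := ∫ y, (1 - Real.cos (ξ * y)) ∂ν with hh
  have hre : (levySymbol ν ξ).re = -h := hz.levyMeasure.re_levySymbol ξ
  have h0 : 0 ≤ h := integral_nonneg fun y => sub_nonneg.2 (Real.cos_le_one _)
  have hmin0 : 0 ≤ ∫ y, min 1 (y ^ 2) ∂ν :=
    integral_nonneg fun y => le_min zero_le_one (sq_nonneg y)
  have hH : h ≤ H := by
    have h1 := (Complex.abs_re_le_norm (levySymbol ν ξ)).trans
      (hz.levyMeasure.norm_levySymbol_le ξ)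
    rw [hre, abs_neg, abs_of_nonneg h0] at h1
    refine h1.trans (mul_le_mul_of_nonneg_right ?_ hmin0)
    nlinarith
  have hexpint : Integrable (fun ω => Complex.exp (Complex.I * ξ * z 1 ω)) P := by
    refine (integrable_const (1 : ℝ)).mono' ?_ (ae_of_all _ fun ω => (norm_exp_I_mul_mul _ _).le)
    have := hz.measurable 1
    exact (by fun_prop : Measurable fun ω => Complex.exp (Complex.I * ξ * z 1 ω)).aestronglyMeasurable
  have hcos : ∫ ω, Real.cos (ξ * z 1 ω) ∂P ≤ Real.exp (-h) := by
    have h1 := integral_re hexpint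
    simp only [RCLike.re_to_complex, re_exp_I_mul_mul] at h1
    rw [h1, hz.charFun_eq 1 ξ]
    refine (Complex.re_le_norm _).trans ?_
    rw [Complex.norm_exp]
    simp [hre]
  have hcosint : Integrable (fun ω => Real.cos (ξ * z 1 ω)) P := by
    have := hexpint.re
    simpa only [RCLike.re_to_complex, re_exp_I_mul_mul] using this
  have hle : 1 - ∫ ω, Real.cos (ξ * z 1 ω) ∂P ≤ 2 * ξ ^ q * m := by
    have : 1 - ∫ ω, Real.cos (ξ * z 1 ω) ∂P = ∫ ω, (1 - Real.cos (ξ * z 1 ω)) ∂P := by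
      rw [integral_sub (integrable_const _) hcosint]; simp
    rw [this, ← integral_const_mul]
    refine integral_mono ((integrable_const _).sub hcosint) (hint.const_mul _) fun ω => ?_
    refine (one_sub_cos_le_rpow _ hq hq2).trans_eq ?_
    rw [abs_mul, abs_of_pos hξ0, Real.mul_rpow hξ0.le (abs_nonneg _)]
    ring
  have h1 : h * Real.exp (-h) ≤ 1 - Real.exp (-h) := by
    have := Real.add_one_le_exp h
    have h2 : Real.exp h * Real.exp (-h) = 1 := by rw [← Real.exp_add]; simp
    nlinarith [Real.exp_pos (-h)]
  have h2 : h * Real.exp (-H) ≤ h * Real.exp (-h) :=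
    mul_le_mul_of_nonneg_left (Real.exp_le_exp.2 (by linarith)) h0
  have h3 : h * Real.exp (-H) ≤ 2 * ξ ^ q * m := by linarith
  have h4 : Real.exp H * Real.exp (-H) = 1 := by rw [← Real.exp_add]; simp
  calc h = Real.exp H * (h * Real.exp (-H)) := by linear_combination -h * h4
    _ ≤ Real.exp H * (2 * ξ ^ q * m) := mul_le_mul_of_nonneg_left h3 (Real.exp_pos _).le
    _ = _ := by ring

/-- Moments of the process bound the tails of its Lévy measure. -/
theorem exists_tail_levyMeasure (hz : IsPureJumpLevyProcess P z ν) {q : ℝ} (hq : 0 < q)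
    (hq2 : q ≤ 2) (hm : ∫⁻ ω, ‖z 1 ω‖ₑ ^ q ∂P < ⊤) :
    ∃ C : ℝ, 0 ≤ C ∧ ∀ a : ℝ, 1 ≤ a → ν {y | a ≤ |y|} ≤ ENNReal.ofReal (C * a ^ (-q)) := by
  obtain ⟨D, hD, h⟩ := exists_integral_one_sub_cos_le hz hq hq2 hm
  have hc1 : Real.cos 1 < 1 := by
    have := Real.cos_lt_cos_of_nonneg_of_le_pi le_rfl
      (by linarith [Real.pi_gt_three] : (1 : ℝ) ≤ Real.pi) one_pos
    simpa using this
  -- At frequency `1/b` the annulus has `|y|/b` in `[1, 2] ⊂ [0, π]`, where `1 - cos` is at least `1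
  -- - cos 1`. Dyadic annuli then cover the tail.
  have hann : ∀ b : ℝ, 1 ≤ b → ν {y | b ≤ |y| ∧ |y| ≤ 2 * b} ≤
      ENNReal.ofReal (D / (1 - Real.cos 1) * b ^ (-q)) := by
    intro b hb
    have hb0 : 0 < b := by linarith
    have h1 := mul_meas_ge_le_integral_of_nonneg
      (ae_of_all _ fun y => sub_nonneg.2 (Real.cos_le_one _))
      (hz.levyMeasure.integrable_one_sub_cos (1 / b)) (1 - Real.cos 1)
    have h2 := h1.trans (h (1 / b) (by positivity) ((div_le_one hb0).2 hb))
    have hsub : {y | b ≤ |y| ∧ |y| ≤ 2 * b} ⊆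
        {y | 1 - Real.cos 1 ≤ 1 - Real.cos (1 / b * y)} := by
      intro y hy
      have e1 : Real.cos (1 / b * y) = Real.cos (|y| / b) := by
        rw [← Real.cos_abs (1 / b * y), abs_mul, abs_of_pos (by positivity : 0 < 1 / b)]
        ring_nf
      show 1 - Real.cos 1 ≤ 1 - Real.cos (1 / b * y)
      rw [e1]
      have e2 : 1 ≤ |y| / b := (one_le_div hb0).2 hy.1
      have e3 : |y| / b ≤ 2 := (div_le_iff₀ hb0).2 hy.2
      have := Real.cos_le_cos_of_nonneg_of_le_pi zero_le_one
        (by linarith [Real.pi_gt_three]) e2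
      linarith
    have hfin : ν {y | 1 - Real.cos 1 ≤ 1 - Real.cos (1 / b * y)} ≠ ⊤ :=
      ((hz.levyMeasure.integrable_one_sub_cos (1 / b)).measure_ge_lt_top (by linarith)).ne
    refine (measure_mono hsub).trans ?_
    rw [← ENNReal.ofReal_toReal hfin]
    refine ENNReal.ofReal_le_ofReal ?_
    rw [div_mul_eq_mul_div, le_div_iff₀ (by linarith), mul_comm]
    refine h2.trans_eq ?_
    rw [Real.rpow_neg hb0.le, one_div, Real.inv_rpow hb0.le]
  set E := D / (1 - Real.cos 1)
  have hE : 0 ≤ E := div_nonneg hD (by linarith)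
  have hr : (2 : ℝ) ^ (-q) < 1 := Real.rpow_lt_one_of_one_lt_of_neg (by norm_num) (by linarith)
  have hr0 : (0 : ℝ) ≤ 2 ^ (-q) := by positivity
  refine ⟨E * (1 - 2 ^ (-q))⁻¹, mul_nonneg hE (inv_nonneg.2 (by linarith)), fun a ha => ?_⟩
  have ha0 : 0 < a := by linarith
  have hcov : {y : ℝ | a ≤ |y|} ⊆ ⋃ k : ℕ, {y | a * 2 ^ k ≤ |y| ∧ |y| ≤ 2 * (a * 2 ^ k)} := by
    intro y hy
    obtain ⟨k, hk1, hk2⟩ := exists_nat_pow_near ((one_le_div ha0).2 hy) one_lt_two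
    refine mem_iUnion.2 ⟨k, ?_, ?_⟩
    · rw [le_div_iff₀ ha0] at hk1; linarith
    · rw [div_lt_iff₀ ha0, pow_succ] at hk2; linarith
  refine (measure_mono hcov).trans ((measure_iUnion_le _).trans ?_)
  have hs : Summable fun k : ℕ => E * a ^ (-q) * ((2 : ℝ) ^ (-q)) ^ k :=
    (summable_geometric_of_lt_one hr0 hr).mul_left _
  calc ∑' k : ℕ, ν {y | a * 2 ^ k ≤ |y| ∧ |y| ≤ 2 * (a * 2 ^ k)}
      ≤ ∑' k : ℕ, ENNReal.ofReal (E * a ^ (-q) * ((2 : ℝ) ^ (-q)) ^ k) := by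
        refine ENNReal.tsum_le_tsum fun k => (hann _ ?_).trans_eq ?_
        · exact one_le_mul_of_one_le_of_one_le ha (one_le_pow₀ (by norm_num))
        · rw [Real.mul_rpow ha0.le (by positivity), ← Real.rpow_natCast, ← Real.rpow_natCast,
            ← Real.rpow_mul (by norm_num), ← Real.rpow_mul (by norm_num)]
          ring_nf
    _ = ENNReal.ofReal (∑' k : ℕ, E * a ^ (-q) * ((2 : ℝ) ^ (-q)) ^ k) :=
        (ENNReal.ofReal_tsum_of_nonneg (fun k => by positivity) hs).symm
    _ = _ := by
        rw [tsum_mul_left, tsum_geometric_of_lt_one hr0 hr]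
        ring_nf

/-- A tail of order `q` strictly between `p` and `α` makes the `p`-th moment finite. Below level `1`
the finite total mass replaces the tail bound. -/
theorem lintegral_bigJumpLaw_lt_top (hz : IsPureJumpLevyProcess P z ν) {α : ℝ} (hα2 : α < 2)
    (hmom : MomentAssumption P z α) {p : ℝ} (hp : 0 < p) (hpα : p < α) {K : ℝ} (hK : 0 < K)
    (hpos : 0 < ν (bigJumps K)) : ∫⁻ y, ‖y‖ₑ ^ p ∂(bigJumpLaw ν K) < ⊤ := by
  obtain ⟨q, hpq, hqα⟩ := exists_between hpα
  obtain ⟨C, hC, h⟩ := exists_tail_levyMeasure hz (hp.trans hpq) (hqα.trans hα2).le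
    (lintegral_enorm_rpow_lt_top hz hmom (hp.trans hpq) hqα)
  have hfin : ν (bigJumps K) < ⊤ := by
    refine (measure_mono fun y hy => ?_).trans_lt (hz.levyMeasure.measure_le_abs_lt_top hK)
    rcases hy with hy | hy
    · exact (le_neg.1 hy).trans (neg_le_abs y)
    · exact (mem_Ici.1 hy).trans (le_abs_self y)
  have : IsFiniteMeasure (ν.restrict (bigJumps K)) := ⟨by simpa using hfin⟩
  rw [bigJumpLaw, lintegral_smul_measure, smul_eq_mul]
  refine ENNReal.mul_lt_top (ENNReal.inv_lt_top.2 hpos) ?_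
  set G := (ν (bigJumps K)).toReal
  refine lintegral_rpow_lt_top_of_tail hp hpq (C := C + G) (by positivity) fun a ha => ?_
  have hcoe : ∀ y : ℝ, ENNReal.ofReal a < ‖y‖ₑ → a ≤ |y| := fun y hy => by
    rw [Real.enorm_eq_ofReal_abs] at hy
    exact (ENNReal.ofReal_lt_ofReal_iff'.1 hy).1.le
  have hpw : 0 ≤ a ^ (-q) := Real.rpow_nonneg ha.le _
  rcases le_or_gt 1 a with h1 | h1
  · refine (Measure.restrict_apply_le _ _).trans ((measure_mono hcoe).trans ((h a h1).trans ?_))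
    exact ENNReal.ofReal_le_ofReal (by nlinarith [ENNReal.toReal_nonneg (a := ν (bigJumps K))])
  · refine (measure_mono (subset_univ _)).trans ?_
    rw [Measure.restrict_apply_univ, ← ENNReal.ofReal_toReal hfin.ne]
    refine ENNReal.ofReal_le_ofReal ?_
    have : 1 ≤ a ^ (-q) := Real.one_le_rpow_of_pos_of_le_one_of_nonpos ha h1.le (by linarith)
    have hG : 0 ≤ G := ENNReal.toReal_nonneg
    change G ≤ _
    nlinarith

end LevyMeasure

/-! ### Small-time asymptotics by Fourier inversion. -/

section SmallTime

open scoped FourierTransform SchwartzMap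

theorem norm_exp_sub_one_le_of_re_nonpos {w : ℂ} (hw : w.re ≤ 0) :
    ‖Complex.exp w - 1‖ ≤ 2 * ‖w‖ := by
  rcases le_or_gt ‖w‖ 1 with h | h
  · exact Complex.norm_exp_sub_one_le h
  · have h1 : ‖Complex.exp w‖ ≤ 1 := by rw [Complex.norm_exp]; exact Real.exp_le_one_iff.2 hw
    have h2 := norm_sub_le (Complex.exp w) 1
    rw [norm_one] at h2
    linarith

theorem tendsto_mul_exp_div_sub_one (w : ℂ) :
    Tendsto (fun n : ℕ => ((n : ℂ) + 1) * (Complex.exp (w / (n + 1)) - 1)) atTop (𝓝 w) := by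
  have h1 : HasDerivAt (fun s : ℂ => Complex.exp (s * w)) w 0 := by
    simpa using ((hasDerivAt_id (0 : ℂ)).mul_const w).cexp
  have h2 := h1.tendsto_slope_zero
  have h3 : Tendsto (fun n : ℕ => (1 : ℂ) / (n + 1)) atTop (𝓝[≠] 0) := by
    refine tendsto_nhdsWithin_iff.2 ⟨tendsto_one_div_add_atTop_nhds_zero_nat, ?_⟩
    exact Eventually.of_forall fun n => by
      simp only [mem_compl_iff, mem_singleton_iff]
      exact one_div_ne_zero (Nat.cast_add_one_ne_zero n)
  refine (h2.comp h3).congr fun n => ?_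
  simp [div_eq_inv_mul]

variable {Ω : Type*} [MeasurableSpace Ω] {P : Measure Ω} [IsProbabilityMeasure P]
  {z : ℝ≥0 → Ω → ℝ} {ν : Measure ℝ}

/-- If `f` is the Fourier integral of `g`, this writes `E f(z t)` as the integral of `e^{tψ} g`,
whose derivative at `t = 0` is the integral of `ψ g`. -/
theorem integral_fourier_comp (hz : IsPureJumpLevyProcess P z ν) {g : ℝ → ℂ} (hg : Integrable g)
    {ξ : ℝ → ℝ} (hξ : Continuous ξ) (t : ℝ≥0) :
    ∫ ω, (∫ v, Complex.exp (Complex.I * ξ v * z t ω) * g v) ∂P =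
      ∫ v, Complex.exp (t * levySymbol ν (ξ v)) * g v := by
  have hzt := hz.measurable t
  have hm : Measurable fun q : Ω × ℝ => Complex.exp (Complex.I * ξ q.2 * z t q.1) := by
    have := hξ.measurable
    fun_prop
  have hint : Integrable (Function.uncurry fun ω v => Complex.exp (Complex.I * ξ v * z t ω) * g v)
      (P.prod volume) := by
    have h1 : Integrable (fun q : Ω × ℝ => g q.2) (P.prod volume) := hg.comp_snd P
    refine h1.norm.mono' (hm.aestronglyMeasurable.mul h1.aestronglyMeasurable)
      (ae_of_all _ fun q => ?_)
    simp only [Function.uncurry]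
    rw [norm_mul, norm_exp_I_mul_mul, one_mul]
  rw [integral_integral_swap hint]
  congr 1; funext v
  rw [integral_mul_const, hz.charFun_eq]

theorem IsLevyMeasure.measurable_levySymbol (hν : IsLevyMeasure ν) :
    Measurable fun ξ => levySymbol ν ξ := by
  have := hν.sigmaFinite
  simp only [hν.levySymbol_eq]
  exact (measurable_levyIntegrand.stronglyMeasurable.integral_prod_right' (ν := ν)).measurable

theorem integral_levySymbol_mul (hν : IsLevyMeasure ν) {g : ℝ → ℂ} (hgc : Continuous g)
    {ξ : ℝ → ℝ} (hξ : Continuous ξ) (hg : Integrable fun v => (1 + ξ v ^ 2) * ‖g v‖) :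
    ∫ v, levySymbol ν (ξ v) * g v = ∫ y, ∫ v, levyIntegrand (ξ v) y * g v ∂volume ∂ν := by
  have := hν.sigmaFinite
  have hint : Integrable (Function.uncurry fun v y => levyIntegrand (ξ v) y * g v)
      (volume.prod ν) := by
    have h1 := (hg.const_mul 3).mul_prod hν.integrable_min
    refine h1.mono' ?_ (ae_of_all _ fun q => ?_)
    · refine Measurable.aestronglyMeasurable ?_
      exact (measurable_levyIntegrand.comp
        ((hξ.measurable.comp measurable_fst).prodMk measurable_snd)).mul
        (hgc.measurable.comp measurable_fst)
    · simp only [Function.uncurry]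
      rw [norm_mul]
      refine (mul_le_mul_of_nonneg_right (norm_levyIntegrand_le _ _) (norm_nonneg _)).trans_eq ?_
      ring
  rw [← integral_integral_swap hint]
  congr 1; funext v
  rw [hν.levySymbol_eq, integral_mul_const]

/-- `t⁻¹ E f(z(t)) → ∫ f dν` as `t → 0`, for smooth `f` with compact support away from `0`. -/
theorem tendsto_mul_integral_comp (hz : IsPureJumpLevyProcess P z ν) {f : ℝ → ℝ}
    (hf : ContDiff ℝ ((⊤ : ℕ∞) : WithTop ℕ∞) f) (hfc : HasCompactSupport f) (hf0 : ∀ᶠ y in 𝓝 0, f y = 0) :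
    Tendsto (fun n : ℕ => ((n : ℝ) + 1) * ∫ ω, f (z (1 / (n + 1)) ω) ∂P) atTop
      (𝓝 (∫ y, f y ∂ν)) := by
  let F : 𝓢(ℝ, ℂ) := (hfc.comp_left (g := fun x : ℝ => (x : ℂ)) rfl).toSchwartzMap
    (Complex.ofRealCLM.contDiff.comp hf)
  have hF : ∀ y, F y = f y := fun y => rfl
  let g : 𝓢(ℝ, ℂ) := 𝓕⁻ F
  let ξ : ℝ → ℝ := fun v => -2 * Real.pi * v
  have hξ : Continuous ξ := by fun_prop
  have hgint : Integrable (fun v => g v) := g.integrable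
  have hFg : ∀ y, F y = ∫ v, Complex.exp (Complex.I * ξ v * y) * g v := by
    intro y
    have h1 : F = 𝓕 g := (FourierTransform.fourier_fourierInv_eq F).symm
    rw [h1, SchwartzMap.fourier_coe, Real.fourier_real_eq_integral_exp_smul]
    congr 1; funext v
    rw [smul_eq_mul]
    congr 2
    simp only [ξ]; push_cast; ring
  have hg2 : Integrable fun v => (1 + ξ v ^ 2) * ‖g v‖ := by
    have h1 := g.integrable_pow_mul volume 2
    have h2 := hgint.norm.add (h1.const_mul (4 * Real.pi ^ 2))
    refine h2.congr (ae_of_all _ fun v => ?_)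
    simp only [ξ, Pi.add_apply, Real.norm_eq_abs, sq_abs]
    ring
  have hξg : Integrable fun v => (ξ v : ℂ) * g v := by
    refine hg2.mono' ((Complex.continuous_ofReal.comp hξ).mul g.continuous).aestronglyMeasurable
      (ae_of_all _ fun v => ?_)
    rw [norm_mul, Complex.norm_real, Real.norm_eq_abs]
    refine mul_le_mul_of_nonneg_right ?_ (norm_nonneg _)
    rw [← sq_abs]
    nlinarith [sq_nonneg (|ξ v| - 1)]
  have hexp : ∀ y : ℝ, Integrable fun v => Complex.exp (Complex.I * ξ v * y) * g v := by
    intro y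
    have hm : Continuous fun v => Complex.exp (Complex.I * ξ v * y) := by fun_prop
    refine hgint.norm.mono' (hm.mul g.continuous).aestronglyMeasurable (ae_of_all _ fun v => ?_)
    rw [norm_mul, norm_exp_I_mul_mul, one_mul]
  have hg0 : ∫ v, g v = 0 := by
    have h1 := hFg 0
    rw [hF, hf0.self_of_nhds] at h1
    simpa using h1.symm
  set c : ℂ := ∫ v, (ξ v : ℂ) * g v with hc
  have hL : ∀ y : ℝ, ∫ v, levyIntegrand (ξ v) y * g v =
      F y - if |y| ≤ 1 then Complex.I * y * c else 0 := by
    intro y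
    rw [hFg]
    unfold levyIntegrand
    by_cases hy : |y| ≤ 1
    · simp only [if_pos hy]
      have h1 : ∀ v, (Complex.exp (Complex.I * ξ v * y) - 1 - Complex.I * ξ v * y) * g v =
          (Complex.exp (Complex.I * ξ v * y) * g v - g v) - Complex.I * y * (ξ v * g v) :=
        fun v => by ring
      simp only [h1]
      have h2 : Integrable fun v => Complex.exp (Complex.I * ξ v * y) * g v - g v :=
        (hexp y).sub hgint
      rw [integral_sub h2 (hξg.const_mul _), integral_sub (hexp y) hgint, hg0,
        integral_const_mul, sub_zero]
    · simp only [if_neg hy, sub_zero]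
      have h1 : ∀ v, (Complex.exp (Complex.I * ξ v * y) - 1) * g v =
          Complex.exp (Complex.I * ξ v * y) * g v - g v := fun v => by ring
      simp only [h1]
      rw [integral_sub (hexp y) hgint, hg0, sub_zero]
  have hLb : ∀ y : ℝ, ‖∫ v, levyIntegrand (ξ v) y * g v‖ ≤
      3 * (∫ v, (1 + ξ v ^ 2) * ‖g v‖) * min 1 (y ^ 2) := by
    intro y
    rw [mul_right_comm, ← integral_const_mul]
    refine norm_integral_le_of_norm_le (hg2.const_mul _) (ae_of_all _ fun v => ?_)
    rw [norm_mul]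
    refine (mul_le_mul_of_nonneg_right (norm_levyIntegrand_le _ _) (norm_nonneg _)).trans_eq ?_
    ring
  -- Up to a factor `i`, `c` is the derivative of `f` at `0`. For small `y > 0`, where `f` vanishes,
  -- the integral in `hL` has norm `y * ‖c‖` but is bounded by `D * y ^ 2`. Hence the compensator
  -- contributes nothing.
  have hc0 : c = 0 := by
    set D := 3 * ∫ v, (1 + ξ v ^ 2) * ‖g v‖
    have hev : ∀ᶠ y : ℝ in 𝓝[>] 0, ‖c‖ ≤ D * y := by
      filter_upwards [nhdsWithin_le_nhds hf0, Ioo_mem_nhdsGT one_pos] with y hy hy1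
      have h1 := hLb y
      have hyabs : |y| = y := abs_of_pos hy1.1
      rw [hL, hF, hy, if_pos (by rw [hyabs]; exact hy1.2.le), Complex.ofReal_zero, zero_sub,
        norm_neg, norm_mul, norm_mul, Complex.norm_I, one_mul, Complex.norm_real,
        Real.norm_eq_abs, hyabs, min_eq_right (by nlinarith [hy1.1, hy1.2])] at h1
      have h2 : y * ‖c‖ ≤ y * (D * y) := by linarith
      exact le_of_mul_le_mul_left h2 hy1.1
    have hlim : Tendsto (fun y : ℝ => D * y) (𝓝[>] 0) (𝓝 0) := by
      have : Tendsto (fun y : ℝ => D * y) (𝓝 0) (𝓝 (D * 0)) := by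
        exact (continuous_const.mul continuous_id).tendsto 0
      rw [mul_zero] at this
      exact this.mono_left nhdsWithin_le_nhds
    exact norm_le_zero_iff.1 (ge_of_tendsto hlim hev)
  have hlimit : ∫ v, levySymbol ν (ξ v) * g v = ((∫ y, f y ∂ν : ℝ) : ℂ) := by
    rw [integral_levySymbol_mul hz.levyMeasure g.continuous hξ hg2, ← integral_complex_ofReal]
    congr 1; funext y
    rw [hL, hc0, hF]
    simp
  have hterm : ∀ n : ℕ, ((((n : ℝ) + 1) * ∫ ω, f (z (1 / (n + 1)) ω) ∂P : ℝ) : ℂ) =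
      ∫ v, (((n : ℂ) + 1) * (Complex.exp (levySymbol ν (ξ v) / (n + 1)) - 1)) * g v := by
    intro n
    rw [Complex.ofReal_mul, ← integral_complex_ofReal]
    have h1 : ∫ ω, ((f (z (1 / (n + 1)) ω) : ℝ) : ℂ) ∂P =
        ∫ v, Complex.exp (((1 / (n + 1) : ℝ≥0) : ℂ) * levySymbol ν (ξ v)) * g v := by
      rw [← integral_fourier_comp hz hgint hξ]
      congr 1; funext ω
      rw [← hF, hFg]
    have hexp2 : Integrable fun v =>
        Complex.exp (((1 / (n + 1) : ℝ≥0) : ℂ) * levySymbol ν (ξ v)) * g v := by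
      refine hgint.norm.mono' ?_ (ae_of_all _ fun v => ?_)
      · have hms : AEStronglyMeasurable (fun v => levySymbol ν (ξ v)) volume :=
          (hz.levyMeasure.measurable_levySymbol.comp hξ.measurable).aestronglyMeasurable
        exact (Complex.continuous_exp.comp_aestronglyMeasurable
          (hms.const_mul _)).mul g.continuous.aestronglyMeasurable
      · rw [norm_mul, Complex.norm_exp]
        refine mul_le_of_le_one_left (norm_nonneg _) (Real.exp_le_one_iff.2 ?_)
        have h3 : ((((1 / (n + 1) : ℝ≥0) : ℂ) * levySymbol ν (ξ v))).re =
            ((1 / (n + 1) : ℝ≥0) : ℝ) * (levySymbol ν (ξ v)).re := by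
          rw [← Complex.re_ofReal_mul]
        rw [h3]
        exact mul_nonpos_of_nonneg_of_nonpos NNReal.zero_le_coe
          (hz.levyMeasure.re_levySymbol_nonpos _)
    rw [h1]
    have h2 : ∫ v, Complex.exp (((1 / (n + 1) : ℝ≥0) : ℂ) * levySymbol ν (ξ v)) * g v =
        ∫ v, (Complex.exp (((1 / (n + 1) : ℝ≥0) : ℂ) * levySymbol ν (ξ v)) * g v - g v) := by
      rw [integral_sub hexp2 hgint, hg0, sub_zero]
    rw [h2, ← integral_const_mul]
    congr 1; funext v
    have h3 : (((1 / (n + 1) : ℝ≥0) : ℂ) * levySymbol ν (ξ v)) =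
        levySymbol ν (ξ v) / ((n : ℂ) + 1) := by
      push_cast; ring
    rw [h3]; push_cast; ring
  have hmain : Tendsto (fun n : ℕ =>
      ((((n : ℝ) + 1) * ∫ ω, f (z (1 / (n + 1)) ω) ∂P : ℝ) : ℂ)) atTop
      (𝓝 ((∫ y, f y ∂ν : ℝ) : ℂ)) := by
    simp only [hterm]
    rw [← hlimit]
    -- Domination uses `Re ψ ≤ 0`: then `|e^{ψ/(n+1)} - 1| ≤ 2|ψ|/(n+1)`, and `ψ` grows at most
    -- quadratically.
    refine tendsto_integral_of_dominated_convergence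
      (fun v => 2 * ((3 * ∫ y, min 1 (y ^ 2) ∂ν) * ((1 + ξ v ^ 2) * ‖g v‖))) (fun n => ?_)
      ((hg2.const_mul _).const_mul _) (fun n => ae_of_all _ fun v => ?_)
      (ae_of_all _ fun v => (tendsto_mul_exp_div_sub_one _).mul_const _)
    · have hms : AEStronglyMeasurable (fun v => levySymbol ν (ξ v)) volume :=
        (hz.levyMeasure.measurable_levySymbol.comp hξ.measurable).aestronglyMeasurable
      have hcont : Continuous fun w : ℂ => ((n : ℂ) + 1) * (Complex.exp (w / (n + 1)) - 1) := by
        fun_prop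
      exact (hcont.comp_aestronglyMeasurable hms).mul g.continuous.aestronglyMeasurable
    · have hpos : (0 : ℝ) < n + 1 := by positivity
      have hnn : ‖(n : ℂ) + 1‖ = n + 1 := by
        have : (n : ℂ) + 1 = ((n + 1 : ℕ) : ℂ) := by push_cast; ring
        rw [this, Complex.norm_natCast]; push_cast; ring
      have hre : (levySymbol ν (ξ v) / ((n : ℂ) + 1)).re ≤ 0 := by
        have h4 : levySymbol ν (ξ v) / ((n : ℂ) + 1) =
            levySymbol ν (ξ v) / (((n + 1 : ℝ)) : ℂ) := by push_cast; ring
        rw [h4, Complex.div_ofReal_re]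
        exact div_nonpos_of_nonpos_of_nonneg (hz.levyMeasure.re_levySymbol_nonpos _) hpos.le
      have h5 := norm_exp_sub_one_le_of_re_nonpos hre
      rw [norm_div, hnn] at h5
      rw [norm_mul, norm_mul, hnn]
      have h6 := hz.levyMeasure.norm_levySymbol_le (ξ v)
      have h7 : ((n : ℝ) + 1) * ‖Complex.exp (levySymbol ν (ξ v) / ((n : ℂ) + 1)) - 1‖ ≤
          2 * ‖levySymbol ν (ξ v)‖ := by
        refine (mul_le_mul_of_nonneg_left h5 hpos.le).trans_eq ?_
        field_simp
      refine (mul_le_mul_of_nonneg_right (h7.trans (mul_le_mul_of_nonneg_left h6 zero_le_two))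
        (norm_nonneg _)).trans_eq ?_
      ring
  have := (Complex.continuous_re.tendsto _).comp hmain
  simpa only [Function.comp_def, Complex.ofReal_re] using this

/-- Increments of size at least `K` over intervals of length `t` have probability at least `c t`
when the Lévy measure charges `{|y| > K}`. -/
theorem exists_le_mul_measure_increment (hz : IsPureJumpLevyProcess P z ν) {K : ℝ} (hK : 0 < K)
    (hν : ν {y | K < |y|} ≠ 0) :
    ∃ c : ℝ, 0 < c ∧ ∀ᶠ n : ℕ in atTop, c ≤ (n + 1) * P.real {ω | K ≤ |z (1 / (n + 1)) ω|} := by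
  have hopen : IsOpen {y : ℝ | K < |y|} := isOpen_lt continuous_const continuous_abs
  -- Some point of this open set has only neighbourhoods of positive mass. A bump function at such a
  -- point, supported in the set, has positive integral.
  have hex : ∃ x ∈ {y : ℝ | K < |y|}, ∀ u ∈ 𝓝[{y : ℝ | K < |y|}] x, ν u ≠ 0 := by
    by_contra hcon
    push Not at hcon
    exact hν (measure_null_of_locally_null _ hcon)
  obtain ⟨x, hx, hxu⟩ := hex
  obtain ⟨f, hfs, hfc, hfd, hfr, hfx⟩ := exists_contDiff_tsupport_subset (n := ⊤)
    (hopen.mem_nhds hx)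
  have hf01 : ∀ y, 0 ≤ f y ∧ f y ≤ 1 := fun y => hfr (mem_range_self y)
  have hfK : ∀ y, |y| ≤ K → f y = 0 := fun y hy => by
    by_contra h
    exact absurd (hfs (subset_tsupport f h)) (not_lt.2 hy)
  have hf0 : ∀ᶠ y in 𝓝 (0 : ℝ), f y = 0 := by
    filter_upwards [Metric.closedBall_mem_nhds (0 : ℝ) hK] with y hy
    exact hfK y (by simpa using hy)
  have hfmeas : Measurable f := hfd.continuous.measurable
  have hle : ∀ y, f y ≤ {y : ℝ | K ≤ |y|}.indicator (fun _ => (1 : ℝ)) y := by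
    intro y
    by_cases hy : K ≤ |y|
    · rw [indicator_of_mem (by exact hy)]; exact (hf01 y).2
    · rw [indicator_of_notMem (by exact hy), hfK y (not_le.1 hy).le]
  have hKm : MeasurableSet {y : ℝ | K ≤ |y|} := measurableSet_le measurable_const (by fun_prop)
  have hfint : Integrable f ν := by
    have hind : Integrable ({y : ℝ | K ≤ |y|}.indicator (fun _ => (1 : ℝ))) ν := by
      rw [integrable_indicator_iff hKm]
      exact integrableOn_const (hz.levyMeasure.measure_le_abs_lt_top hK).ne
    refine hind.mono' hfmeas.aestronglyMeasurable (ae_of_all _ fun y => ?_)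
    rw [Real.norm_of_nonneg (hf01 y).1]
    exact hle y
  have hpos : 0 < ∫ y, f y ∂ν := by
    rw [integral_pos_iff_support_of_nonneg (fun y => (hf01 y).1) hfint]
    refine pos_iff_ne_zero.2 (hxu _ (mem_nhdsWithin_of_mem_nhds ?_))
    have : ∀ᶠ y in 𝓝 x, f y ≠ 0 :=
      hfd.continuous.continuousAt.eventually_ne (by rw [hfx]; exact one_ne_zero)
    exact this
  refine ⟨(∫ y, f y ∂ν) / 2, by positivity, ?_⟩
  have hlim := tendsto_mul_integral_comp hz hfd hfc hf0
  filter_upwards [hlim.eventually (lt_mem_nhds (half_lt_self hpos))] with n hn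
  refine hn.le.trans (mul_le_mul_of_nonneg_left ?_ (by positivity))
  have hzm := hz.measurable (1 / (n + 1))
  have hset : MeasurableSet {ω | K ≤ |z (1 / (n + 1)) ω|} := hzm hKm
  rw [← integral_indicator_one hset]
  refine integral_mono ?_ ((integrable_const (1 : ℝ)).indicator hset) fun ω => ?_
  · refine (integrable_const (1 : ℝ)).mono' (hfmeas.comp hzm).aestronglyMeasurable
      (ae_of_all _ fun ω => ?_)
    rw [Real.norm_of_nonneg (hf01 _).1]; exact (hf01 _).2
  · exact hle _

end SmallTime

/-! ### The first big jump after the waiting time. -/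

section JumpTime

variable {Ω : Type*} [MeasurableSpace Ω] {P : Measure Ω} [IsProbabilityMeasure P]
  {z : ℝ≥0 → Ω → ℝ} {ν : Measure ℝ}

/-- The waiting time for a jump of size at least `K` has an exponential tail. -/
theorem exists_measure_no_jump_le (hz : IsPureJumpLevyProcess P z ν) {K : ℝ} (hK : 0 < K)
    (hν : ν {y | K < |y|} ≠ 0) :
    ∃ c : ℝ, 0 < c ∧ ∀ (T : ℝ≥0) (m : ℕ),
      P {ω | ∀ t, T < t → t ≤ T + m → |z t ω - Function.leftLim (fun s => z s ω) t| < K} ≤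
        ENNReal.ofReal (Real.exp (-(c * m))) := by
  obtain ⟨c, hc, hev⟩ := exists_le_mul_measure_increment hz hK hν
  refine ⟨c, hc, fun T m => ?_⟩
  let τ : ℕ → ℕ → ℝ≥0 := fun n i => T + i / (n + 1)
  have hτ : ∀ n, Monotone (τ n) := fun n a b hab => by simp only [τ]; gcongr
  have hτs : ∀ n i, τ n (i + 1) = τ n i + 1 / (n + 1) := fun n i => by
    simp only [τ]; push_cast; rw [add_div, add_assoc]
  -- All grid increments are below `K`. By independence this has probability `(1 - r)^{m(n+1)} ≤
  -- e^{-cm}`, and a path without big jumps satisfies it for all large `n`.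
  let G : ℕ → Set Ω := fun n =>
    {ω | ∀ i ∈ Finset.range (m * (n + 1)), |z (τ n (i + 1)) ω - z (τ n i) ω| < K}
  have hG : ∀ᶠ n in atTop, P (G n) ≤ ENNReal.ofReal (Real.exp (-(c * m))) := by
    filter_upwards [hev] with n hn
    set r := P.real {ω | K ≤ |z (1 / (n + 1)) ω|}
    have hset : MeasurableSet {x : ℝ | |x| < K} := measurableSet_lt (by fun_prop) measurable_const
    have hone : ∀ i, P ((fun ω => z (τ n (i + 1)) ω - z (τ n i) ω) ⁻¹' {x | |x| < K}) =
        ENNReal.ofReal (1 - r) := by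
      intro i
      have h1 := (hz.stationary (τ n i) (1 / (n + 1))).measure_mem_eq hset
      simp only [hτs]
      rw [h1]
      have h2 : z (1 / (n + 1)) ⁻¹' {x | |x| < K} = {ω | K ≤ |z (1 / (n + 1)) ω|}ᶜ := by
        ext ω; simp
      have hm : MeasurableSet {ω | K ≤ |z (1 / (n + 1)) ω|} :=
        measurableSet_le measurable_const (hz.measurable _).abs
      rw [h2, ← probReal_compl_eq_one_sub hm, ofReal_measureReal]
    have hprod := (hz.indep.nat (hτ n)).measure_inter_preimage_eq_mul
      (Finset.range (m * (n + 1))) (sets := fun _ => {x : ℝ | |x| < K}) (fun _ _ => hset)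
    have hGeq : G n = ⋂ i ∈ Finset.range (m * (n + 1)),
        (fun ω => z (τ n (i + 1)) ω - z (τ n i) ω) ⁻¹' {x | |x| < K} := by
      ext ω; simp [G]
    have hr1 : 0 ≤ 1 - r := sub_nonneg.2 measureReal_le_one
    rw [hGeq, hprod]
    simp only [hone]
    rw [Finset.prod_const, Finset.card_range, ← ENNReal.ofReal_pow hr1]
    refine ENNReal.ofReal_le_ofReal ?_
    have h1 : 1 - r ≤ Real.exp (-r) := by linarith [Real.add_one_le_exp (-r)]
    refine (pow_le_pow_left₀ hr1 h1 _).trans ?_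
    rw [← Real.exp_nat_mul]
    refine Real.exp_le_exp.2 ?_
    push_cast
    have hm0 : (0 : ℝ) ≤ m := by positivity
    nlinarith
  refine (measure_mono_ae ?_).trans (measure_eventually_le hG)
  filter_upwards [hz.cadlag] with ω hω hno
  obtain ⟨δ, hδ, hmod⟩ := hω.exists_modulus hK hno
  have h1 : ∀ᶠ n : ℕ in atTop, (1 : ℝ) / (n + 1) < δ :=
    tendsto_one_div_add_atTop_nhds_zero_nat.eventually (gt_mem_nhds hδ)
  show ∀ᶠ n in atTop, ω ∈ G n
  filter_upwards [h1] with n hn i hi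
  refine hmod _ _ le_self_add (hτ n (Nat.le_succ i)) ?_ ?_
  · have hi' : i + 1 ≤ m * (n + 1) := Finset.mem_range.1 hi
    simp only [τ]
    gcongr
    rw [div_le_iff₀ (by positivity)]
    exact_mod_cast hi'
  · rw [hτs]; push_cast; linarith

/-- Even the lower bound requires a jump to exist, since the infimum of the empty set in `ℝ≥0` is
`0`. -/
theorem jumpTime_le_of_exists {Ω : Type*} {z : ℝ≥0 → Ω → ℝ} {ω : Ω} {K T : ℝ} (hT : 0 ≤ T) {u : ℝ≥0}
    (h : ∃ t, T.toNNReal < t ∧ t ≤ u ∧ K ≤ |z t ω - Function.leftLim (fun s => z s ω) t|) :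
    T.toNNReal ≤ jumpTime z K T ω ∧ jumpTime z K T ω ≤ u := by
  obtain ⟨t, h1, h2, h3⟩ := h
  have hmem : t ∈ {t : ℝ≥0 | T < t ∧ K ≤ |z t ω - Function.leftLim (fun s => z s ω) t|} :=
    ⟨(Real.toNNReal_lt_iff_lt_coe hT).1 h1, h3⟩
  refine ⟨le_csInf ⟨t, hmem⟩ fun s hs => (Real.toNNReal_le_iff_le_coe).2 hs.1.le, ?_⟩
  exact (csInf_le (OrderBot.bddBelow _) hmem).trans h2

/-- The values of `∫₀ᵗ e^{-lam (t-s)} dz(s)` shortly before the first big jump after time `T` are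
dominated by a random variable with a finite moment of order `p`. -/
theorem exists_dominating_jumpTime (hz : IsPureJumpLevyProcess P z ν) {K : ℝ} (hK : 0 < K)
    (hν : ν {y | K < |y|} ≠ 0) {α : ℝ} (hmom : MomentAssumption P z α) {lam p : ℝ}
    (hlam : 0 < lam) (hp : 0 < p) (hpα : p < α) {T : ℝ} (hT : 0 < T) :
    ∃ R : Ω → ℝ≥0∞, ∫⁻ ω, R ω ^ p ∂P < ⊤ ∧ ∀ᵐ ω ∂P, T.toNNReal ≤ jumpTime z K T ω ∧
      ∀ᶠ t in 𝓝[<] (jumpTime z K T ω), ‖expIntegral z lam t ω‖ₑ ≤ R ω := by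
  -- Three orders `p < q < r < α`: `r` for the window suprema, `q` for what is left after
  -- interpolation, `p` for the moment.
  obtain ⟨r, hpr, hrα⟩ := exists_between hpα
  obtain ⟨q, hpq, hqr⟩ := exists_between hpr
  have hr : 0 < r := hp.trans hpr
  have hq : 0 < q := hp.trans hpq
  obtain ⟨C, hC, hsup⟩ := exists_tail_expIntegral hz hmom hlam hr hrα
  obtain ⟨c, hc, hno⟩ := exists_measure_no_jump_le hz hK hν
  set T' := T.toNNReal with hT'
  have hT'0 : 0 < T' := Real.toNNReal_pos.2 hT
  let N : ℕ → Set Ω := fun m =>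
    {ω | ∀ t, T' < t → t ≤ T' + m → |z t ω - Function.leftLim (fun s => z s ω) t| < K}
  have hjump : ∀ᵐ ω ∂P, ∃ m, ω ∉ N m := by
    rw [ae_iff]
    push Not
    refine le_antisymm (ge_of_tendsto (f := fun m : ℕ => ENNReal.ofReal (Real.exp (-(c * m))))
      (x := atTop) ?_ (Eventually.of_forall fun m => ?_)) zero_le
    · rw [← ENNReal.ofReal_zero]
      refine ENNReal.tendsto_ofReal (Real.tendsto_exp_atBot.comp ?_)
      exact tendsto_neg_atTop_atBot.comp (tendsto_natCast_atTop_atTop.const_mul_atTop hc)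
    · exact (measure_mono fun ω (hω : ∀ m, ω ∈ N m) => hω m).trans (hno T' m)
  have hnotN : ∀ ω m, ω ∉ N m → T' ≤ jumpTime z K T ω ∧ jumpTime z K T ω ≤ T' + m := by
    intro ω m h
    simp only [N, mem_ofPred_eq, not_forall, not_lt] at h
    obtain ⟨t, h1, h2, h3⟩ := h
    exact jumpTime_le_of_exists hT.le ⟨t, h1, h2, h3⟩
  -- The shift by one gives `J < τ ≤ J + 1`, so times just before `τ` lie in the window of index
  -- `J`.
  let J : Ω → ℕ := fun ω => ⌈jumpTime z K T ω⌉₊ - 1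
  let W : ℕ → Ω → ℝ≥0∞ := fun j ω =>
    ⨆ (t : ℝ≥0) (_ : (j : ℝ≥0) ≤ t ∧ t ≤ j + 1), ‖expIntegral z lam t ω‖ₑ
  let θ : ℝ := q / r
  have hθ0 : 0 < θ := div_pos hq hr
  have hθ1 : θ < 1 := (div_lt_one hr).2 hqr
  let A : ℝ := Real.exp (c * ⌈T'⌉₊)
  let ρ : ℝ := Real.exp (-(c * (1 - θ)))
  have hρ1 : ρ < 1 := by
    rw [← Real.exp_zero]; exact Real.exp_lt_exp.2 (by nlinarith)
  have hρ0 : 0 ≤ ρ := (Real.exp_pos _).le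
  have hs : ∀ D : ℝ, Summable fun j : ℕ => D * ρ ^ j := fun D =>
    (summable_geometric_of_lt_one hρ0 hρ1).mul_left _
  refine ⟨fun ω => W (J ω) ω, ?_, ?_⟩
  · refine lintegral_rpow_lt_top_of_tail hp hpq
      (C := C ^ θ * A ^ (1 - θ) * (1 - ρ)⁻¹)
      (mul_nonneg (by positivity) (inv_nonneg.2 (by linarith))) fun a ha => ?_
    -- Being in window `j` means that no big jump occurs after `T` and up to `j`. For `j ≤ ⌈T'⌉₊`
    -- the truncated subtraction makes this condition empty.
    have hcov : P {ω | ENNReal.ofReal a < W (J ω) ω} ≤ P (⋃ j : ℕ, N (j - ⌈T'⌉₊) ∩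
        {ω | ∃ t : ℝ≥0, j ≤ t ∧ t ≤ j + 1 ∧ a < |expIntegral z lam t ω|}) := by
      refine measure_mono_ae ?_
      filter_upwards [hjump] with ω ⟨m, hm⟩ hω
      have hτ := (hnotN ω m hm).1
      have hlt : ENNReal.ofReal a < W (J ω) ω := hω
      refine mem_iUnion.2 ⟨J ω, ?_, ?_⟩
      · by_contra hcon
        have h1 := (hnotN ω _ hcon).2
        have h2 : ((J ω : ℕ) : ℝ≥0) < jumpTime z K T ω := by
          rw [← Nat.lt_ceil]
          have : 0 < ⌈jumpTime z K T ω⌉₊ := Nat.ceil_pos.2 (hT'0.trans_le hτ)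
          simp only [J]; omega
        rcases le_total ⌈T'⌉₊ (J ω) with h | h
        · have h3 : T' + ((J ω - ⌈T'⌉₊ : ℕ) : ℝ≥0) ≤ J ω := by
            calc T' + ((J ω - ⌈T'⌉₊ : ℕ) : ℝ≥0) ≤ ⌈T'⌉₊ + ((J ω - ⌈T'⌉₊ : ℕ) : ℝ≥0) := by
                  gcongr; exact Nat.le_ceil _
              _ = J ω := by rw [← Nat.cast_add, Nat.add_sub_cancel' h]
          exact absurd (h2.trans_le (h1.trans h3)) (lt_irrefl _)
        · refine hcon ?_
          rw [Nat.sub_eq_zero_of_le h]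
          intro t ht1 ht2
          simp only [Nat.cast_zero, add_zero] at ht2
          exact absurd ht1 (not_lt.2 ht2)
      · obtain ⟨t, ht⟩ := lt_iSup_iff.1 hlt
        obtain ⟨ht1, ht2⟩ := lt_iSup_iff.1 ht
        rw [Real.enorm_eq_ofReal_abs] at ht2
        exact ⟨t, ht1.1, ht1.2, (ENNReal.ofReal_lt_ofReal_iff'.1 ht2).1⟩
    refine hcov.trans ((measure_iUnion_le _).trans ?_)
    -- The two bounds are interpolated with weights `θ = q / r` and `1 - θ`: the first turns
    -- `a^{-r}` into `a^{-q}`, the second keeps a geometric factor in `j`.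
    have hterm : ∀ j : ℕ, P (N (j - ⌈T'⌉₊) ∩
        {ω | ∃ t : ℝ≥0, j ≤ t ∧ t ≤ j + 1 ∧ a < |expIntegral z lam t ω|}) ≤
        ENNReal.ofReal (C ^ θ * a ^ (-q) * A ^ (1 - θ) * ρ ^ j) := by
      intro j
      set u := P (N (j - ⌈T'⌉₊) ∩
        {ω | ∃ t : ℝ≥0, j ≤ t ∧ t ≤ j + 1 ∧ a < |expIntegral z lam t ω|})
      have h1 : u ≤ ENNReal.ofReal (C * a ^ (-r)) :=
        (measure_mono inter_subset_right).trans (hsup j a ha)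
      have h2 : u ≤ ENNReal.ofReal (A * Real.exp (-(c * j))) := by
        refine (measure_mono inter_subset_left).trans ((hno T' _).trans ?_)
        refine ENNReal.ofReal_le_ofReal ?_
        rw [← Real.exp_add]
        refine Real.exp_le_exp.2 ?_
        have : (j : ℝ) ≤ ((j - ⌈T'⌉₊ : ℕ) : ℝ) + ⌈T'⌉₊ := by
          exact_mod_cast Nat.sub_le_iff_le_add.1 le_rfl
        nlinarith
      have h3 : u = u ^ θ * u ^ (1 - θ) := by
        rw [← ENNReal.rpow_add_of_nonneg _ _ hθ0.le (by linarith)]; simp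
      rw [h3]
      refine (mul_le_mul' (ENNReal.rpow_le_rpow h1 hθ0.le)
        (ENNReal.rpow_le_rpow h2 (by linarith : 0 ≤ 1 - θ))).trans_eq ?_
      rw [ENNReal.ofReal_rpow_of_nonneg (by positivity) hθ0.le,
        ENNReal.ofReal_rpow_of_nonneg (by positivity) (by linarith),
        ← ENNReal.ofReal_mul (by positivity)]
      congr 1
      have e1 : (a ^ (-r)) ^ θ = a ^ (-q) := by
        rw [← Real.rpow_mul ha.le]; congr 1; simp only [θ]; field_simp
      have e2 : (Real.exp (-(c * j))) ^ (1 - θ) = ρ ^ j := by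
        simp only [ρ]
        rw [← Real.exp_mul, ← Real.exp_nat_mul]; congr 1; ring
      rw [Real.mul_rpow hC (by positivity), Real.mul_rpow (by positivity) (by positivity), e1, e2]
      ring
    calc _ ≤ ∑' j : ℕ, ENNReal.ofReal (C ^ θ * a ^ (-q) * A ^ (1 - θ) * ρ ^ j) :=
          ENNReal.tsum_le_tsum hterm
      _ = ENNReal.ofReal (∑' j : ℕ, C ^ θ * a ^ (-q) * A ^ (1 - θ) * ρ ^ j) :=
          (ENNReal.ofReal_tsum_of_nonneg (fun j => by positivity) (hs _)).symm
      _ = _ := by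
          rw [tsum_mul_left, tsum_geometric_of_lt_one hρ0 hρ1]
          ring_nf
  · filter_upwards [hjump] with ω ⟨m, hm⟩
    have hτ := (hnotN ω m hm).1
    refine ⟨hτ, ?_⟩
    have hceil : 0 < ⌈jumpTime z K T ω⌉₊ := Nat.ceil_pos.2 (hT'0.trans_le hτ)
    have h2 : ((J ω : ℕ) : ℝ≥0) < jumpTime z K T ω := by
      rw [← Nat.lt_ceil]
      simp only [J]; omega
    have h3 : jumpTime z K T ω ≤ (J ω : ℝ≥0) + 1 := by
      have : J ω + 1 = ⌈jumpTime z K T ω⌉₊ := by simp only [J]; omega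
      rw [← Nat.cast_add_one, this]
      exact Nat.le_ceil _
    filter_upwards [mem_nhdsWithin_of_mem_nhds (Ioi_mem_nhds h2), self_mem_nhdsWithin]
      with t ht1 ht2
    exact le_iSup₂_of_le t ⟨le_of_lt ht1, (le_of_lt ht2).trans h3⟩ le_rfl

end JumpTime

/-! ### Contraction of the solution towards a bounded region. -/

section Drift

/-- Variation of constants for paths with jumps: `D = y - w` is continuous, with a right derivative,
and `Q = e^{lam t} D + I - y₀` has right derivative `e^{lam t} G`. Comparison with `B / lam * e^{lam
t}` bounds `Q`. General `w` covers both coordinates, with `w = 0` for the second. -/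
theorem abs_sub_exp_mul_le {Ω : Type*} {y w G : ℝ≥0 → Ω → ℝ} {ω : Ω}
    (hy : IsCadlag fun t => y t ω) (hw : IsCadlag fun t => w t ω) (hG : IsCadlag fun t => G t ω)
    (hw0 : w 0 ω = 0) {lam B y₀ : ℝ} (hlam : 0 < lam) (hB : ∀ t, |G t ω| ≤ B)
    (heq : ∀ t : ℝ≥0, y t ω = y₀ +
      (∫ s in (0 : ℝ)..t, (-lam * y s.toNNReal ω + G s.toNNReal ω)) + w t ω) (t : ℝ≥0) :
    |y t ω - Real.exp (-(lam * t)) * y₀| ≤ B / lam + |expIntegral w lam t ω| := by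
  let k : ℝ → ℝ := fun s => -lam * y s.toNNReal ω + G s.toNNReal ω
  let D : ℝ → ℝ := fun t => y₀ + ∫ s in (0 : ℝ)..t, k s
  let I : ℝ → ℝ := fun t => ∫ u in (0 : ℝ)..t, lam * Real.exp (lam * u) * w u.toNNReal ω
  have hkint : ∀ a b, IntervalIntegrable k volume a b := fun a b =>
    ((hy.intervalIntegrable a b).const_mul (-lam)).add (hG.intervalIntegrable a b)
  have hkr : ∀ s, ContinuousWithinAt k (Ici s) s := fun s =>
    (continuousWithinAt_const.mul (hy.continuousWithinAt_toNNReal s)).add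
      (hG.continuousWithinAt_toNNReal s)
  have hD : ∀ t, HasDerivWithinAt D (k t) (Ici t) t := fun t =>
    (intervalIntegral.integral_hasDerivWithinAt_right (hkint 0 t)
      (measurable_of_continuousWithinAt_Ici hkr).stronglyMeasurable.stronglyMeasurableAtFilter
      ((hkr t).mono Ioi_subset_Ici_self)).const_add y₀
  have hIint := fun a b => hw.intervalIntegrable_mul (continuous_mul_exp lam) a b
  have hI : ∀ t, HasDerivWithinAt I (lam * Real.exp (lam * t) * w t.toNNReal ω) (Ici t) t := by
    intro t
    have hr : ContinuousWithinAt (fun u : ℝ => lam * Real.exp (lam * u) * w u.toNNReal ω)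
        (Ici t) t := (continuous_mul_exp lam).continuousWithinAt.mul
          (hw.continuousWithinAt_toNNReal t)
    refine intervalIntegral.integral_hasDerivWithinAt_right (hIint 0 t) ?_
      (hr.mono Ioi_subset_Ici_self)
    exact (((continuous_mul_exp lam).measurable.mul
      hw.measurable_toNNReal).stronglyMeasurable).stronglyMeasurableAtFilter
  have hDc : Continuous D := continuous_const.add (intervalIntegral.continuous_primitive hkint 0)
  have hIc : Continuous I := intervalIntegral.continuous_primitive hIint 0
  have hDy : ∀ s : ℝ, 0 ≤ s → D s = y s.toNNReal ω - w s.toNNReal ω := by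
    intro s hs
    have := heq s.toNNReal
    rw [Real.coe_toNNReal s hs] at this
    simp only [D, k]
    linarith
  let Q : ℝ → ℝ := fun t => Real.exp (lam * t) * D t + I t - y₀
  have hexp : ∀ s : ℝ, HasDerivAt (fun s => Real.exp (lam * s)) (lam * Real.exp (lam * s)) s := by
    intro s
    simpa [mul_comm] using ((hasDerivAt_id s).const_mul lam).exp
  have hQ : ∀ s ∈ Ico (0 : ℝ) t, HasDerivWithinAt Q (Real.exp (lam * s) * G s.toNNReal ω)
      (Ici s) s := by
    intro s hs
    refine ((((hexp s).hasDerivWithinAt.mul (hD s)).add (hI s)).sub_const y₀).congr_deriv ?_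
    rw [hDy s hs.1]
    simp only [k]
    ring
  have hB0 : 0 ≤ B := (abs_nonneg _).trans (hB 0)
  have hbound : ‖Q t‖ ≤ B / lam * Real.exp (lam * t) := by
    refine image_norm_le_of_norm_deriv_right_le_deriv_boundary (a := 0) (b := t) (f := Q)
      (B := fun s => B / lam * Real.exp (lam * s))
      (B' := fun s => B / lam * (lam * Real.exp (lam * s))) (by fun_prop) hQ ?_
      (fun s => (hexp s).const_mul _) (fun s _ => ?_) ⟨t.coe_nonneg, le_rfl⟩
    · simp only [Q, D, I, intervalIntegral.integral_same, mul_zero, Real.exp_zero, one_mul,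
        add_zero, sub_self, norm_zero, mul_one]
      positivity
    · rw [norm_mul, Real.norm_of_nonneg (Real.exp_pos _).le, Real.norm_eq_abs]
      have : B / lam * (lam * Real.exp (lam * s)) = Real.exp (lam * s) * B := by
        field_simp
      rw [this]
      exact mul_le_mul_of_nonneg_left (hB _) (Real.exp_pos _).le
  have hEE : Real.exp (-(lam * t)) * Real.exp (lam * t) = 1 := by rw [← Real.exp_add]; simp
  have hident : y t ω - Real.exp (-(lam * t)) * y₀ =
      Real.exp (-(lam * t)) * Q t + expIntegral w lam t ω := by
    have h1 := exp_mul_expIntegral lam t hw0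
    have h2 : expIntegral w lam t ω = Real.exp (-(lam * t)) *
        (Real.exp (lam * t) * expIntegral w lam t ω) := by rw [← mul_assoc, hEE, one_mul]
    have h3 := hDy t t.coe_nonneg
    rw [Real.toNNReal_coe] at h3
    rw [h2, h1]
    simp only [Q, I]
    rw [h3]
    linear_combination (-(y t ω)) * hEE
  rw [hident]
  refine (abs_add_le _ _).trans (add_le_add_left ?_ _)
  rw [abs_mul, Real.abs_exp]
  calc Real.exp (-(lam * t)) * |Q t| ≤
        Real.exp (-(lam * t)) * (B / lam * Real.exp (lam * t)) :=
        mul_le_mul_of_nonneg_left hbound (Real.exp_pos _).le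
    _ = B / lam := by linear_combination B / lam * hEE

theorem norm_le_add_abs (u v : Plane) : ‖u‖ ≤ ‖v‖ + (|u 0 - v 0| + |u 1 - v 1|) := by
  have h1 : ‖u - v‖ ≤ |u 0 - v 0| + |u 1 - v 1| := by
    rw [EuclideanSpace.norm_eq, Fin.sum_univ_two]
    refine Real.sqrt_le_iff.2 ⟨by positivity, ?_⟩
    simp only [PiLp.sub_apply, Real.norm_eq_abs]
    nlinarith [mul_nonneg (abs_nonneg (u 0 - v 0)) (abs_nonneg (u 1 - v 1))]
  have h2 := norm_sub_norm_le u v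
  linarith

theorem norm_contract_le {a b : ℝ} (hb : 0 ≤ b) (hab : b ≤ a) (x : Plane) :
    ‖(!₂[a * x 0, b * x 1] : Plane)‖ ≤ a * ‖x‖ := by
  have ha : 0 ≤ a := hb.trans hab
  rw [EuclideanSpace.norm_eq, EuclideanSpace.norm_eq, Fin.sum_univ_two, Fin.sum_univ_two]
  refine Real.sqrt_le_iff.2 ⟨by positivity, ?_⟩
  rw [mul_pow, Real.sq_sqrt (by positivity)]
  simp only [Real.norm_eq_abs, sq_abs, Matrix.cons_val_zero, Matrix.cons_val_one]
  have h1 : b ^ 2 ≤ a ^ 2 := pow_le_pow_left₀ hb hab 2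
  nlinarith [sq_nonneg (x 1), mul_le_mul_of_nonneg_right h1 (sq_nonneg (x 1))]

variable {Ω : Type*} [MeasurableSpace Ω] {P : Measure Ω} {z : ℝ≥0 → Ω → ℝ} {ν : Measure ℝ}

theorem IsSolution.ae_norm_le (hz : IsPureJumpLevyProcess P z ν) {lam₁ lam₂ : ℝ}
    (hlam₁ : 0 < lam₁) (hlam : lam₁ ≤ lam₂) {F : Plane → Plane} {B : ℝ} (hB : ∀ x, ‖F x‖ ≤ B)
    (hF : Continuous F) {x : Plane} {X : ℝ≥0 → Ω → Plane}
    (hX : IsSolution P z lam₁ lam₂ F x X) :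
    ∀ᵐ ω ∂P, IsCadlag (fun t => X t ω) ∧ ∀ t : ℝ≥0, ‖X t ω‖ ≤
      Real.exp (-(lam₁ * t)) * ‖x‖ + 2 * B / lam₁ + |expIntegral z lam₁ t ω| := by
  filter_upwards [hz.ae_cadlag_zero, hX.cadlag, hX.eq_fst, hX.eq_snd] with ω ⟨hzc, hz0⟩ hc h1 h2
  refine ⟨hc, fun t => ?_⟩
  have hcoord : ∀ i : Fin 2, Continuous fun u : Plane => u i := fun i => by fun_prop
  have hFb : ∀ (i : Fin 2) (u : Plane), |F u i| ≤ B := fun i u =>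
    (PiLp.norm_apply_le (F u) i).trans (hB u)
  have hB0 : 0 ≤ B := (norm_nonneg _).trans (hB 0)
  have e1 := abs_sub_exp_mul_le (y := fun t ω => X t ω 0) (w := z) (G := fun t ω => F (X t ω) 0)
    (hc.comp_continuous (hcoord 0)) hzc (hc.comp_continuous ((hcoord 0).comp hF)) hz0 hlam₁
    (fun t => hFb 0 _) h1 t
  have e2 := abs_sub_exp_mul_le (y := fun t ω => X t ω 1) (w := fun _ _ => 0)
    (G := fun t ω => F (X t ω) 1) (ω := ω)
    (hc.comp_continuous (hcoord 1)) ⟨fun t => continuousWithinAt_const, fun t => ⟨0, tendsto_const_nhds⟩⟩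
    (hc.comp_continuous ((hcoord 1).comp hF)) rfl (hlam₁.trans_le hlam)
    (fun t => hFb 1 _) (fun t => by rw [add_zero]; exact h2 t) t
  have e3 : expIntegral (fun _ _ => 0) lam₂ t ω = 0 := by simp [expIntegral]
  rw [e3, abs_zero, add_zero] at e2
  have e4 : B / lam₂ ≤ B / lam₁ := div_le_div_of_nonneg_left hB0 hlam₁ hlam
  have e5 := norm_le_add_abs (X t ω)
    !₂[Real.exp (-(lam₁ * t)) * x 0, Real.exp (-(lam₂ * t)) * x 1]
  have e6 := norm_contract_le (Real.exp_pos (-(lam₂ * t))).le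
    (Real.exp_le_exp.2 (by nlinarith [t.coe_nonneg]) :
      Real.exp (-(lam₂ * t)) ≤ Real.exp (-(lam₁ * t))) x
  simp only [Matrix.cons_val_zero, Matrix.cons_val_one] at e5
  have e7 : 2 * B / lam₁ = B / lam₁ + B / lam₁ := by ring
  linarith

/-- The path bound passes to the limit as `t` increases to `τ`, and `τ ≥ T` replaces the random
contraction factor by a fixed one. -/
theorem IsSolution.ae_enorm_leftLim_le (hz : IsPureJumpLevyProcess P z ν) {lam₁ lam₂ : ℝ}
    (hlam₁ : 0 < lam₁) (hlam : lam₁ ≤ lam₂) {F : Plane → Plane} {B : ℝ} (hB : ∀ x, ‖F x‖ ≤ B)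
    (hF : Continuous F) {x : Plane} {X : ℝ≥0 → Ω → Plane}
    (hX : IsSolution P z lam₁ lam₂ F x X) {K T : ℝ} (hT : 0 < T) {R : Ω → ℝ≥0∞}
    (hR : ∀ᵐ ω ∂P, T.toNNReal ≤ jumpTime z K T ω ∧
      ∀ᶠ t in 𝓝[<] (jumpTime z K T ω), ‖expIntegral z lam₁ t ω‖ₑ ≤ R ω) :
    ∀ᵐ ω ∂P, ‖Function.leftLim (fun s => X s ω) (jumpTime z K T ω)‖ₑ ≤
      ENNReal.ofReal (Real.exp (-(lam₁ * T))) * ‖x‖ₑ + (ENNReal.ofReal (2 * B / lam₁) + R ω) := by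
  have hB0 : 0 ≤ B := (norm_nonneg _).trans (hB 0)
  filter_upwards [hX.ae_norm_le hz hlam₁ hlam hB hF, hR] with ω ⟨hc, hb⟩ ⟨hτ, hev⟩
  set τ := jumpTime z K T ω
  have hτ0 : 0 < τ := (Real.toNNReal_pos.2 hT).trans_le hτ
  have hTτ : T ≤ τ := by rwa [Real.toNNReal_le_iff_le_coe] at hτ
  have hne : (𝓝[<] τ).NeBot := nhdsLT_neBot_of_exists_lt ⟨0, hτ0⟩
  obtain ⟨l, hl⟩ := hc.2 τ
  rw [leftLim_eq_of_tendsto hl]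
  have hlim : Tendsto (fun t : ℝ≥0 => ENNReal.ofReal (Real.exp (-(lam₁ * t)) * ‖x‖ + 2 * B / lam₁) +
      R ω) (𝓝[<] τ) (𝓝 (ENNReal.ofReal (Real.exp (-(lam₁ * τ)) * ‖x‖ + 2 * B / lam₁) + R ω)) := by
    refine Tendsto.add ?_ tendsto_const_nhds
    refine ENNReal.tendsto_ofReal (Tendsto.mono_left (Continuous.tendsto ?_ τ) nhdsWithin_le_nhds)
    fun_prop
  have hle : ‖l‖ₑ ≤ ENNReal.ofReal (Real.exp (-(lam₁ * τ)) * ‖x‖ + 2 * B / lam₁) + R ω := by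
    refine le_of_tendsto_of_tendsto hl.enorm hlim ?_
    filter_upwards [hev] with t ht
    refine le_trans ?_ (add_le_add_right ht _)
    rw [Real.enorm_eq_ofReal_abs, ← ENNReal.ofReal_add (by positivity) (abs_nonneg _),
      ← ofReal_norm]
    exact ENNReal.ofReal_le_ofReal (hb t)
  refine hle.trans ?_
  rw [ENNReal.ofReal_add (by positivity) (by positivity), add_assoc,
    ENNReal.ofReal_mul (Real.exp_pos _).le, ofReal_norm]
  gcongr

end Drift

/-! ### The drift condition for the coupling chain. -/

section Kernel

/-- A weighted triangle inequality for powers. -/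
theorem exists_mul_add_rpow_le {p : ℝ} (hp : 0 < p) {r q : ℝ} (hr : 0 ≤ r) (hrq : r ^ p < q) :
    ∃ C : ℝ≥0, ∀ a b : ℝ≥0∞,
      (ENNReal.ofReal r * a + b) ^ p ≤ ENNReal.ofReal q * a ^ p + C * b ^ p := by
  have hq : 0 < q := (Real.rpow_nonneg hr p).trans_lt hrq
  let s : ℝ := q ^ (1 / p)
  have hsp : s ^ p = q := by
    simp only [s]; rw [← Real.rpow_mul hq.le, one_div_mul_cancel hp.ne', Real.rpow_one]
  have hs0 : 0 ≤ s := Real.rpow_nonneg hq.le _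
  have hrs : r < s := by
    by_contra h
    have := Real.rpow_le_rpow hs0 (not_lt.1 h) hp.le
    rw [hsp] at this
    linarith
  -- With `s = q^{1/p} > r`, either `b ≤ δ a` and the sum is at most `s a`, or `a ≤ b / δ` and it is
  -- at most a multiple of `b`. No convexity of the power is used, so every `p > 0` is allowed.
  let δ : ℝ := s - r
  have hδ : 0 < δ := sub_pos.2 hrs
  refine ⟨((r / δ + 1) ^ p).toNNReal, fun a b => ?_⟩
  have hC : (((r / δ + 1) ^ p).toNNReal : ℝ≥0∞) = ENNReal.ofReal (r / δ + 1) ^ p := by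
    rw [ENNReal.ofReal_rpow_of_pos (by positivity)]; rfl
  rw [hC, ← hsp, ← ENNReal.ofReal_rpow_of_nonneg hs0 hp.le, ← ENNReal.mul_rpow_of_nonneg _ _ hp.le,
    ← ENNReal.mul_rpow_of_nonneg _ _ hp.le]
  rcases le_total b (ENNReal.ofReal δ * a) with h | h
  · refine le_trans (ENNReal.rpow_le_rpow ?_ hp.le) le_self_add
    calc ENNReal.ofReal r * a + b ≤ ENNReal.ofReal r * a + ENNReal.ofReal δ * a := by gcongr
      _ = ENNReal.ofReal s * a := by
        rw [← add_mul, ← ENNReal.ofReal_add hr hδ.le]; congr 2; simp only [δ]; ring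
  · refine le_trans (ENNReal.rpow_le_rpow ?_ hp.le) le_add_self
    calc ENNReal.ofReal r * a + b
        = ENNReal.ofReal (r / δ) * (ENNReal.ofReal δ * a) + b := by
          rw [← mul_assoc, ← ENNReal.ofReal_mul (by positivity), div_mul_cancel₀ _ hδ.ne']
      _ ≤ ENNReal.ofReal (r / δ) * b + b := by gcongr
      _ = ENNReal.ofReal (r / δ + 1) * b := by
          rw [ENNReal.ofReal_add (by positivity) zero_le_one, ENNReal.ofReal_one, add_mul, one_mul]

theorem measurable_coupledJumpLaw (Q : Kernel (ℝ × ℝ) (ℝ × ℝ)) [IsSFiniteKernel Q] :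
    Measurable (coupledJumpLaw Q) := by
  have hg : Measurable fun v : (Plane × Plane) × (ℝ × ℝ) =>
      ((!₂[v.2.1, v.1.1 1] : Plane), (!₂[v.2.2, v.1.2 1] : Plane)) := by
    refine Measurable.prodMk ?_ ?_ <;>
    · refine (WithLp.measurable_toLp 2 _).comp (measurable_pi_lambda _ fun i => ?_)
      fin_cases i <;> simp <;> fun_prop
  have hc : Measurable fun w : Plane × Plane => (w.1 0, w.2 0) := by fun_prop
  refine Measure.measurable_of_measurable_coe _ fun A hA => ?_
  have h1 := Kernel.measurable_kernel_prodMk_left (κ := Q.comap _ hc) (hg hA)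
  have h2 : (fun w => coupledJumpLaw Q w A) = fun w => Q.comap _ hc w (Prod.mk w ⁻¹'
      ((fun v : (Plane × Plane) × (ℝ × ℝ) =>
        ((!₂[v.2.1, v.1.1 1] : Plane), (!₂[v.2.2, v.1.2 1] : Plane))) ⁻¹' A)) := by
    funext w
    exact Measure.map_apply (hg.comp (measurable_const.prodMk measurable_id)) hA
  rw [h2]
  exact h1

theorem norm_update_le (w : Plane) (η : ℝ) : ‖(!₂[w 0 + η, w 1] : Plane)‖ ≤ ‖w‖ + |η| := by
  have := norm_le_add_abs !₂[w 0 + η, w 1] w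
  simpa using this

variable {ν : Measure ℝ} {K : ℝ}

/-- The integrand sees one component only, so the marginal of the coupling, the law of `w.1 0 + η`,
determines the integral. -/
theorem lintegral_fst_coupledJumpLaw_le {Q : Kernel (ℝ × ℝ) (ℝ × ℝ)}
    (hQ : IsMaximalJumpCoupling ν K Q) {p : ℝ} (hp : 0 < p) (w : Plane × Plane) :
    ∫⁻ v, ‖v.1‖ₑ ^ p ∂(coupledJumpLaw Q w) ≤
      ∫⁻ η, (‖w.1‖ₑ + ‖η‖ₑ) ^ p ∂(bigJumpLaw ν K) := by
  have hm : Measurable fun a : ℝ => ‖(!₂[a, w.1 1] : Plane)‖ₑ ^ p := by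
    refine Measurable.pow_const (Measurable.enorm ?_) p
    refine (WithLp.measurable_toLp 2 _).comp (measurable_pi_lambda _ fun i => ?_)
    fin_cases i <;> simp
    fun_prop
  calc ∫⁻ v, ‖v.1‖ₑ ^ p ∂(coupledJumpLaw Q w)
      ≤ ∫⁻ u, ‖(!₂[u.1, w.1 1] : Plane)‖ₑ ^ p ∂(Q (w.1 0, w.2 0)) := lintegral_map_le _ _
    _ = ∫⁻ a, ‖(!₂[a, w.1 1] : Plane)‖ₑ ^ p ∂((Q (w.1 0, w.2 0)).map Prod.fst) :=
        (lintegral_map hm measurable_fst).symm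
    _ = ∫⁻ η, ‖(!₂[w.1 0 + η, w.1 1] : Plane)‖ₑ ^ p ∂(bigJumpLaw ν K) := by
        rw [(hQ (w.1 0) (w.2 0)).fst, lintegral_map hm (measurable_const_add _)]
    _ ≤ _ := by
        refine lintegral_mono fun η => ENNReal.rpow_le_rpow ?_ hp.le
        rw [← ofReal_norm, ← ofReal_norm, ← ofReal_norm,
          ← ENNReal.ofReal_add (norm_nonneg _) (norm_nonneg _)]
        exact ENNReal.ofReal_le_ofReal (norm_update_le _ _)

theorem lintegral_snd_coupledJumpLaw_le {Q : Kernel (ℝ × ℝ) (ℝ × ℝ)}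
    (hQ : IsMaximalJumpCoupling ν K Q) {p : ℝ} (hp : 0 < p) (w : Plane × Plane) :
    ∫⁻ v, ‖v.2‖ₑ ^ p ∂(coupledJumpLaw Q w) ≤
      ∫⁻ η, (‖w.2‖ₑ + ‖η‖ₑ) ^ p ∂(bigJumpLaw ν K) := by
  have hm : Measurable fun a : ℝ => ‖(!₂[a, w.2 1] : Plane)‖ₑ ^ p := by
    refine Measurable.pow_const (Measurable.enorm ?_) p
    refine (WithLp.measurable_toLp 2 _).comp (measurable_pi_lambda _ fun i => ?_)
    fin_cases i <;> simp
    fun_prop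
  calc ∫⁻ v, ‖v.2‖ₑ ^ p ∂(coupledJumpLaw Q w)
      ≤ ∫⁻ u, ‖(!₂[u.2, w.2 1] : Plane)‖ₑ ^ p ∂(Q (w.1 0, w.2 0)) := lintegral_map_le _ _
    _ = ∫⁻ a, ‖(!₂[a, w.2 1] : Plane)‖ₑ ^ p ∂((Q (w.1 0, w.2 0)).map Prod.snd) :=
        (lintegral_map hm measurable_snd).symm
    _ = ∫⁻ η, ‖(!₂[w.2 0 + η, w.2 1] : Plane)‖ₑ ^ p ∂(bigJumpLaw ν K) := by
        rw [(hQ (w.1 0) (w.2 0)).snd, lintegral_map hm (measurable_const_add _)]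
    _ ≤ _ := by
        refine lintegral_mono fun η => ENNReal.rpow_le_rpow ?_ hp.le
        rw [← ofReal_norm, ← ofReal_norm, ← ofReal_norm,
          ← ENNReal.ofReal_add (norm_nonneg _) (norm_nonneg _)]
        exact ENNReal.ofReal_le_ofReal (norm_update_le _ _)

theorem bigJumpLaw_univ_le : bigJumpLaw ν K univ ≤ 1 := by
  rw [bigJumpLaw, Measure.smul_apply, Measure.restrict_apply_univ, smul_eq_mul]
  exact ENNReal.inv_mul_le_one _

theorem IsMaximalJumpCoupling.measure_univ_le {Q : Kernel (ℝ × ℝ) (ℝ × ℝ)}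
    (hQ : IsMaximalJumpCoupling ν K Q) (a : ℝ × ℝ) : Q a univ ≤ 1 := by
  have h1 : (Q a).map Prod.fst univ = bigJumpLaw ν K univ := by
    rw [(hQ a.1 a.2).fst, Measure.map_apply (measurable_const_add _) MeasurableSet.univ,
      preimage_univ]
  rw [Measure.map_apply measurable_fst MeasurableSet.univ, preimage_univ] at h1
  exact h1.trans_le bigJumpLaw_univ_le

theorem IsMaximalJumpCoupling.coupledJumpLaw_univ_le {Q : Kernel (ℝ × ℝ) (ℝ × ℝ)}
    (hQ : IsMaximalJumpCoupling ν K Q) (w : Plane × Plane) : coupledJumpLaw Q w univ ≤ 1 := by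
  rw [← lintegral_one, coupledJumpLaw]
  refine (lintegral_map_le _ _).trans ?_
  rw [lintegral_one]
  exact hQ.measure_univ_le _

theorem IsMaximalJumpCoupling.isFiniteKernel {Q : Kernel (ℝ × ℝ) (ℝ × ℝ)}
    (hQ : IsMaximalJumpCoupling ν K Q) : IsFiniteKernel Q :=
  ⟨1, ENNReal.one_lt_top, hQ.measure_univ_le⟩

variable {Ω : Type*} [MeasurableSpace Ω] {P : Measure Ω} {z : ℝ≥0 → Ω → ℝ}

theorem IsCouplingKernel.eq_bind {T : ℝ} {X : Plane → ℝ≥0 → Ω → Plane}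
    {Q : Kernel (ℝ × ℝ) (ℝ × ℝ)} [IsSFiniteKernel Q] {κ : Kernel (Plane × Plane) (Plane × Plane)}
    (hκ : IsCouplingKernel P z K T X Q κ) (w : Plane × Plane) :
    κ w = (preJumpLaw P z K T X w.1 w.2).bind (coupledJumpLaw Q) := by
  ext A hA
  rw [Measure.bind_apply hA (measurable_coupledJumpLaw Q).aemeasurable]
  exact hκ w.1 w.2 A hA

variable [IsProbabilityMeasure P]

/-- The push-forward in `preJumpLaw` is zero if the pair is not a.e. measurable; `lintegral_map_le`
bounds the mass by one in either case. -/
theorem IsCouplingKernel.isFiniteKernel {T : ℝ} {X : Plane → ℝ≥0 → Ω → Plane}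
    {Q : Kernel (ℝ × ℝ) (ℝ × ℝ)} (hQ : IsMaximalJumpCoupling ν K Q)
    {κ : Kernel (Plane × Plane) (Plane × Plane)}
    (hκ : IsCouplingKernel P z K T X Q κ) : IsFiniteKernel κ := by
  refine ⟨1, ENNReal.one_lt_top, fun w => ?_⟩
  rw [show w = (w.1, w.2) from rfl, hκ w.1 w.2 univ MeasurableSet.univ]
  calc ∫⁻ v, coupledJumpLaw Q v univ ∂(preJumpLaw P z K T X w.1 w.2)
      ≤ ∫⁻ _, coupledJumpLaw Q _ univ ∂P := lintegral_map_le _ _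
    _ ≤ ∫⁻ _, 1 ∂P := by
        exact lintegral_mono fun ω => hQ.coupledJumpLaw_univ_le _
    _ = 1 := by simp

/-- The Foster-Lyapunov drift condition for the coupling chain. -/
theorem exists_drift (hz : IsPureJumpLevyProcess P z ν) {α : ℝ} (hα₂ : α < 2)
    (hmom : MomentAssumption P z α) (hK : 0 < K) (hν : ν {y | K < |y|} ≠ 0)
    {lam₁ lam₂ : ℝ} (hlam₁ : 0 < lam₁) (hlam : lam₁ ≤ lam₂) {p : ℝ} (hp : 0 < p) (hpα : p < α)
    {T : ℝ} (hT : 0 < T) (B : ℝ) :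
    ∃ q : ℝ, 0 < q ∧ q < 1 ∧ ∃ C : ℝ≥0, ∀ F : Plane → Plane, (∀ x, ‖F x‖ ≤ B) → Continuous F →
      ∀ X : Plane → ℝ≥0 → Ω → Plane, (∀ x, IsSolution P z lam₁ lam₂ F x (X x)) →
      ∀ Q : Kernel (ℝ × ℝ) (ℝ × ℝ), IsMaximalJumpCoupling ν K Q →
      ∀ κ : Kernel (Plane × Plane) (Plane × Plane), IsCouplingKernel P z K T X Q κ →
      ∀ w : Plane × Plane, ∫⁻ v, (‖v.1‖ₑ ^ p + ‖v.2‖ₑ ^ p) ∂(κ w) ≤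
        ENNReal.ofReal q * (‖w.1‖ₑ ^ p + ‖w.2‖ₑ ^ p) + C := by
  have hνb : 0 < ν (bigJumps K) := by
    refine (pos_iff_ne_zero.2 hν).trans_le (measure_mono fun y hy => ?_)
    rcases lt_abs.1 (show K < |y| from hy) with h | h
    · exact Or.inr h.le
    · exact Or.inl (by simpa using (le_neg.1 h.le))
  have hJ := lintegral_bigJumpLaw_lt_top hz hα₂ hmom hp hpα hK hνb
  set J := ∫⁻ y, ‖y‖ₑ ^ p ∂(bigJumpLaw ν K)
  obtain ⟨R, hRp, hR⟩ := exists_dominating_jumpTime hz hK hν hmom hlam₁ hp hpα hT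
  have hr : Real.exp (-(lam₁ * T)) ^ p < 1 := by
    rw [← Real.exp_mul, ← Real.exp_zero]
    exact Real.exp_lt_exp.2 (by nlinarith [mul_pos (mul_pos hlam₁ hT) hp])
  -- `q₂ < 1` absorbs the contraction between jumps; the jump costs a factor `q₁ > 1`, chosen so
  -- close to `1` that `q₁ * q₂ < 1`.
  obtain ⟨q₂, hrq, hq21⟩ := exists_between hr
  have hq2 : 0 < q₂ := (by positivity : 0 ≤ Real.exp (-(lam₁ * T)) ^ p).trans_lt hrq
  obtain ⟨q₁, hq11, hq12⟩ := exists_between (one_lt_inv_iff₀.2 ⟨hq2, hq21⟩)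
  have hq1 : 0 < q₁ := one_pos.trans hq11
  obtain ⟨C₁, hC₁⟩ := exists_mul_add_rpow_le hp zero_le_one (by rwa [Real.one_rpow] : (1:ℝ) ^ p < q₁)
  obtain ⟨C₂, hC₂⟩ := exists_mul_add_rpow_le hp (Real.exp_pos _).le hrq
  simp only [ENNReal.ofReal_one, one_mul] at hC₁
  set b := ENNReal.ofReal (2 * B / lam₁)
  let L := ∫⁻ ω, (b + R ω) ^ p ∂P
  have hL : L < ⊤ := by
    calc L ≤ ∫⁻ ω, (ENNReal.ofReal q₁ * b ^ p + C₁ * R ω ^ p) ∂P :=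
          lintegral_mono fun ω => hC₁ _ _
      _ = ENNReal.ofReal q₁ * b ^ p + C₁ * ∫⁻ ω, R ω ^ p ∂P := by
          rw [lintegral_add_left measurable_const, lintegral_const_mul' _ _ ENNReal.coe_ne_top]
          simp
      _ < ⊤ := ENNReal.add_lt_top.2 ⟨ENNReal.mul_lt_top ENNReal.ofReal_lt_top
          (ENNReal.rpow_lt_top_of_nonneg hp.le ENNReal.ofReal_ne_top),
          ENNReal.mul_lt_top ENNReal.coe_lt_top hRp⟩
  let D : ℝ≥0∞ := ENNReal.ofReal q₁ * (C₂ * L) + C₁ * J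
  have hD : D < ⊤ := ENNReal.add_lt_top.2
    ⟨ENNReal.mul_lt_top ENNReal.ofReal_lt_top (ENNReal.mul_lt_top ENNReal.coe_lt_top hL),
      ENNReal.mul_lt_top ENNReal.coe_lt_top hJ⟩
  refine ⟨q₁ * q₂, by positivity, ?_, (D + D).toNNReal, ?_⟩
  · rwa [← lt_inv_mul_iff₀' hq2, mul_one] at *
  intro F hB hF X hX Q hQ κ hκ w
  have := hQ.isFiniteKernel
  rw [ENNReal.coe_toNNReal (ENNReal.add_lt_top.2 ⟨hD, hD⟩).ne]
  have hjump : ∀ a : ℝ≥0∞, ∫⁻ η, (a + ‖η‖ₑ) ^ p ∂(bigJumpLaw ν K) ≤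
      ENNReal.ofReal q₁ * a ^ p + C₁ * J := by
    intro a
    calc ∫⁻ η, (a + ‖η‖ₑ) ^ p ∂(bigJumpLaw ν K)
        ≤ ∫⁻ η, (ENNReal.ofReal q₁ * a ^ p + C₁ * ‖η‖ₑ ^ p) ∂(bigJumpLaw ν K) :=
          lintegral_mono fun η => hC₁ _ _
      _ = ENNReal.ofReal q₁ * a ^ p * bigJumpLaw ν K univ + C₁ * J := by
          rw [lintegral_add_left measurable_const, lintegral_const_mul' _ _ ENNReal.coe_ne_top,
            lintegral_const]
      _ ≤ ENNReal.ofReal q₁ * a ^ p * 1 + C₁ * J := by gcongr; exact bigJumpLaw_univ_le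
      _ = _ := by rw [mul_one]
  have hpre : ∀ x : Plane,
      ∫⁻ ω, ‖Function.leftLim (fun s => X x s ω) (jumpTime z K T ω)‖ₑ ^ p ∂P ≤
        ENNReal.ofReal q₂ * ‖x‖ₑ ^ p + C₂ * L := by
    intro x
    calc _ ≤ ∫⁻ ω, (ENNReal.ofReal q₂ * ‖x‖ₑ ^ p + C₂ * (b + R ω) ^ p) ∂P := by
          refine lintegral_mono_ae ?_
          filter_upwards [(hX x).ae_enorm_leftLim_le hz hlam₁ hlam hB hF hT hR] with ω hω
          exact (ENNReal.rpow_le_rpow hω hp.le).trans (hC₂ _ _)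
      _ = _ := by
          rw [lintegral_add_left measurable_const, lintegral_const_mul' _ _ ENNReal.coe_ne_top]
          simp [L]
  have hVm : Measurable fun v : Plane × Plane => ‖v.1‖ₑ ^ p + ‖v.2‖ₑ ^ p := by fun_prop
  have hsum : ∀ v : Plane × Plane, ∫⁻ u, (‖u.1‖ₑ ^ p + ‖u.2‖ₑ ^ p) ∂(coupledJumpLaw Q v) ≤
      (ENNReal.ofReal q₁ * ‖v.1‖ₑ ^ p + C₁ * J) + (ENNReal.ofReal q₁ * ‖v.2‖ₑ ^ p + C₁ * J) := by
    intro v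
    rw [lintegral_add_left (by fun_prop)]
    exact add_le_add ((lintegral_fst_coupledJumpLaw_le hQ hp v).trans (hjump _))
      ((lintegral_snd_coupledJumpLaw_le hQ hp v).trans (hjump _))
  have hm1 : Measurable fun v : Plane × Plane => ENNReal.ofReal q₁ * ‖v.1‖ₑ ^ p + C₁ * J := by
    fun_prop
  have hmarg : ∀ (f : Plane × Plane → ℝ≥0∞), Measurable f → ∀ a : ℝ≥0∞,
      (∫⁻ ω, f (Function.leftLim (fun s => X w.1 s ω) (jumpTime z K T ω),
        Function.leftLim (fun s => X w.2 s ω) (jumpTime z K T ω)) ∂P ≤ a) →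
      ∫⁻ v, (ENNReal.ofReal q₁ * f v + C₁ * J) ∂(preJumpLaw P z K T X w.1 w.2) ≤
        ENNReal.ofReal q₁ * a + C₁ * J := by
    intro f hf a ha
    refine (lintegral_map_le _ _).trans ?_
    rw [lintegral_add_right _ measurable_const, lintegral_const_mul' _ _ ENNReal.ofReal_ne_top]
    simp only [lintegral_const, measure_univ, mul_one]
    gcongr
  rw [hκ.eq_bind, Measure.lintegral_bind (measurable_coupledJumpLaw Q).aemeasurable
    hVm.aemeasurable]
  calc _ ≤ ∫⁻ v, ((ENNReal.ofReal q₁ * ‖v.1‖ₑ ^ p + C₁ * J) +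
        (ENNReal.ofReal q₁ * ‖v.2‖ₑ ^ p + C₁ * J)) ∂(preJumpLaw P z K T X w.1 w.2) :=
        lintegral_mono hsum
    _ ≤ (ENNReal.ofReal q₁ * (ENNReal.ofReal q₂ * ‖w.1‖ₑ ^ p + C₂ * L) + C₁ * J) +
        (ENNReal.ofReal q₁ * (ENNReal.ofReal q₂ * ‖w.2‖ₑ ^ p + C₂ * L) + C₁ * J) := by
        rw [lintegral_add_left hm1]
        exact add_le_add (hmarg (fun v => ‖v.1‖ₑ ^ p) (by fun_prop) _ (hpre w.1))
          (hmarg (fun v => ‖v.2‖ₑ ^ p) (by fun_prop) _ (hpre w.2))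
    _ = _ := by
        rw [ENNReal.ofReal_mul hq1.le]
        simp only [D]
        ring

end Kernel

/-! ### Geometric decay for a Markov chain outside a set. -/

section Chain

variable {Ω E : Type*} [MeasurableSpace Ω] [MeasurableSpace E] {P : Measure Ω}
  [IsProbabilityMeasure P] {κ : Kernel E E} [IsFiniteKernel κ] {w : E} {S : ℕ → Ω → E}

/-- The Markov property integrated over an event of the history up to time `k`. -/
theorem IsMarkovChain.setLIntegral_step (hS : IsMarkovChain P κ w S) (k : ℕ)
    {B : Set (Fin (k + 1) → E)} (hB : MeasurableSet B) {U : E → ℝ≥0∞} (hU : Measurable U) :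
    ∫⁻ ω in (fun ω (i : Fin (k + 1)) => S i ω) ⁻¹' B, U (S (k + 1) ω) ∂P =
      ∫⁻ ω in (fun ω (i : Fin (k + 1)) => S i ω) ⁻¹' B, ∫⁻ v, U v ∂(κ (S k ω)) ∂P := by
  have hh : Measurable fun ω (i : Fin (k + 1)) => S i ω :=
    measurable_pi_lambda _ fun i => hS.measurable i
  have hlaw := (hS.step k).map_eq
  have hf : Measurable fun q : (Fin (k + 1) → E) × E => B.indicator (fun _ => U q.2) q.1 := by
    have : (fun q : (Fin (k + 1) → E) × E => B.indicator (fun _ => U q.2) q.1) =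
        (Prod.fst ⁻¹' B).indicator fun q => U q.2 := by
      funext q; rfl
    rw [this]
    exact (hU.comp measurable_snd).indicator (measurable_fst hB)
  have hg : Measurable fun h : Fin (k + 1) → E =>
      ∫⁻ y, B.indicator (fun _ => U y) h ∂(κ (h (Fin.last k))) :=
    Measurable.lintegral_kernel_prod_right (κ := κ.comap (fun h : Fin (k + 1) → E =>
      h (Fin.last k)) (measurable_pi_apply _)) (f := fun h y => B.indicator (fun _ => U y) h) hf
  calc ∫⁻ ω in (fun ω (i : Fin (k + 1)) => S i ω) ⁻¹' B, U (S (k + 1) ω) ∂P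
      = ∫⁻ ω, B.indicator (fun _ => U (S (k + 1) ω)) (fun i : Fin (k + 1) => S i ω) ∂P := by
        rw [← lintegral_indicator (hh hB)]; rfl
    _ = ∫⁻ q, B.indicator (fun _ => U q.2) q.1
          ∂(P.map fun ω => ((fun i : Fin (k + 1) => S i ω), S (k + 1) ω)) := by
        rw [lintegral_map hf (hh.prodMk (hS.measurable _))]
    _ = ∫⁻ h, ∫⁻ y, B.indicator (fun _ => U y) h ∂(κ (h (Fin.last k)))
          ∂(P.map fun ω (i : Fin (k + 1)) => S i ω) := by
        rw [hlaw, Measure.lintegral_compProd hf]; rfl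
    _ = ∫⁻ ω, ∫⁻ y, B.indicator (fun _ => U y) (fun i : Fin (k + 1) => S i ω) ∂(κ (S k ω)) ∂P := by
        rw [lintegral_map hg hh]; rfl
    _ = _ := by
        rw [← lintegral_indicator (hh hB)]
        congr 1; funext ω
        by_cases h : (fun i : Fin (k + 1) => S i ω) ∈ B
        · rw [indicator_of_mem (show ω ∈ (fun ω (i : Fin (k + 1)) => S i ω) ⁻¹' B from h)]
          simp [h]
        · rw [indicator_of_notMem (show ω ∉ (fun ω (i : Fin (k + 1)) => S i ω) ⁻¹' B from h)]
          simp [h]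

/-- The expected Lyapunov function of a chain that has not returned to `A` decays
geometrically. -/
theorem IsMarkovChain.setLIntegral_le_pow (hS : IsMarkovChain P κ w S) {A : Set E}
    (hA : MeasurableSet A) {U : E → ℝ≥0∞} (hU : Measurable U) {r : ℝ≥0∞}
    (hr : ∀ v, v ∉ A → ∫⁻ u, U u ∂(κ v) ≤ r * U v) (k : ℕ) :
    ∫⁻ ω in {ω | ∀ i ∈ Finset.Icc 1 k, S i ω ∉ A}, U (S (k + 1) ω) ∂P ≤
      r ^ k * ∫⁻ u, U u ∂(κ w) := by
  have hrep : ∀ k, ∃ B : Set (Fin (k + 1) → E), MeasurableSet B ∧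
      {ω | ∀ i ∈ Finset.Icc 1 k, S i ω ∉ A} = (fun ω (i : Fin (k + 1)) => S i ω) ⁻¹' B := by
    intro k
    refine ⟨⋂ i : Fin (k + 1), ⋂ (_ : 1 ≤ (i : ℕ)), {h | h i ∉ A}, ?_, ?_⟩
    · exact MeasurableSet.iInter fun i => MeasurableSet.iInter fun _ =>
        (measurable_pi_apply i hA).compl
    · ext ω
      simp only [mem_ofPred_eq, mem_preimage, mem_iInter, Finset.mem_Icc]
      exact ⟨fun h i hi => h i ⟨hi, Nat.lt_succ_iff.1 i.2⟩,
        fun h i hi => h ⟨i, Nat.lt_succ_iff.2 hi.2⟩ hi.1⟩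
  induction k with
  -- Only times `i ≥ 1` are constrained, so the first step starts from `w`, possibly inside `A`, and
  -- contributes no factor `r`.
  | zero =>
    obtain ⟨B, hB, hBe⟩ := hrep 0
    rw [hBe, hS.setLIntegral_step 0 hB hU, pow_zero, one_mul]
    calc _ ≤ ∫⁻ ω, ∫⁻ v, U v ∂(κ (S 0 ω)) ∂P := setLIntegral_le_lintegral _ _
      _ = ∫⁻ ω, ∫⁻ v, U v ∂(κ w) ∂P := by
          refine lintegral_congr_ae ?_
          filter_upwards [hS.initial] with ω hω
          rw [hω]
      _ = _ := by simp
  | succ k ih =>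
    obtain ⟨B, hB, hBe⟩ := hrep (k + 1)
    have hUS : Measurable fun ω => r * U (S (k + 1) ω) :=
      (hU.comp (hS.measurable _)).const_mul r
    have hstep := hS.setLIntegral_step (k + 1) hB hU
    rw [← hBe] at hstep
    rw [hstep]
    calc _ ≤ ∫⁻ ω in {ω | ∀ i ∈ Finset.Icc 1 (k + 1), S i ω ∉ A}, r * U (S (k + 1) ω) ∂P :=
          setLIntegral_mono hUS fun ω hω =>
            hr _ (hω (k + 1) (Finset.mem_Icc.2 ⟨by omega, le_rfl⟩))
      _ ≤ ∫⁻ ω in {ω | ∀ i ∈ Finset.Icc 1 k, S i ω ∉ A}, r * U (S (k + 1) ω) ∂P :=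
          lintegral_mono_set fun ω hω i hi =>
            hω i (Finset.Icc_subset_Icc le_rfl (Nat.le_succ k) hi)
      _ = r * ∫⁻ ω in {ω | ∀ i ∈ Finset.Icc 1 k, S i ω ∉ A}, U (S (k + 1) ω) ∂P :=
          lintegral_const_mul r (hU.comp (hS.measurable _))
      _ ≤ r * (r ^ k * ∫⁻ u, U u ∂(κ w)) := mul_le_mul_right ih r
      _ = _ := by rw [pow_succ]; ring

end Chain

/-! ### Exponential moments of the return time. -/

section ReturnTime

/-- If the return time is `n`, the term `k = n - 1` alone equals the left side. If it is infinite,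
every indicator is one and the series diverges. -/
theorem exp_mul_returnTime_le {Ω : Type*} {M θ : ℝ} (hθ : 0 < θ) (S : ℕ → Ω → Plane × Plane)
    (ω : Ω) :
    EReal.exp ((θ : EReal) * (((returnTime M S ω : ℕ∞) : ℝ≥0∞) : EReal)) ≤
      ∑' k : ℕ, {ω | ∀ i ∈ Finset.Icc 1 k,
        S i ω ∉ {v : Plane × Plane | ‖v.1‖ + ‖v.2‖ ≤ M}}.indicator
          (fun _ => ENNReal.ofReal (Real.exp (θ * (k + 1)))) ω := by
  classical
  by_cases hex : ∃ k, 0 < k ∧ ‖(S k ω).1‖ + ‖(S k ω).2‖ ≤ M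
  · obtain ⟨hn0, hnM⟩ := Nat.find_spec hex
    set n := Nat.find hex
    have hσ : returnTime M S ω = (n : ℕ∞) := by
      refine le_antisymm (iInf₂_le n ⟨hn0, hnM⟩) (le_iInf₂ fun k hk => ?_)
      exact_mod_cast Nat.find_min' hex hk
    have hexp : EReal.exp ((θ : EReal) * (((returnTime M S ω : ℕ∞) : ℝ≥0∞) : EReal)) =
        ENNReal.ofReal (Real.exp (θ * n)) := by
      rw [hσ, ENat.toENNReal_coe, ← EReal.exp_coe, EReal.coe_mul,
        EReal.coe_coe_eq_natCast]
      rfl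
    rw [hexp]
    refine le_trans ?_ (ENNReal.le_tsum (n - 1))
    rw [indicator_of_mem]
    · rw [Nat.cast_sub (by omega : 1 ≤ n)]
      simp
    · intro i hi
      have hi' := Finset.mem_Icc.1 hi
      have := Nat.find_min hex (m := i) (by omega)
      exact fun h => this ⟨hi'.1, h⟩
  · push Not at hex
    have htop : ∑' k : ℕ, {ω | ∀ i ∈ Finset.Icc 1 k,
        S i ω ∉ {v : Plane × Plane | ‖v.1‖ + ‖v.2‖ ≤ M}}.indicator
          (fun _ => ENNReal.ofReal (Real.exp (θ * (k + 1)))) ω = ⊤ := by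
      refine top_unique ?_
      rw [← ENNReal.tsum_const_eq_top_of_ne_zero (α := ℕ) one_ne_zero]
      refine ENNReal.tsum_le_tsum fun k => ?_
      rw [indicator_of_mem]
      · exact ENNReal.one_le_ofReal.2 (Real.one_le_exp (by positivity))
      · exact fun i hi => not_le.2 (hex i (Finset.mem_Icc.1 hi).1)
    rw [htop]
    exact le_top

/-- As `U ≥ 1`, the decay of its integral bounds the probability of no return, and the series
becomes geometric with ratio `e^θ r`. In `ℝ≥0∞` the formula for its sum needs no condition on the
ratio. -/
theorem expMoment_returnTime_le {Ω : Type*} [MeasurableSpace Ω] {P : Measure Ω}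
    [IsProbabilityMeasure P] {κ : Kernel (Plane × Plane) (Plane × Plane)} [IsFiniteKernel κ]
    {w : Plane × Plane} {S : ℕ → Ω → Plane × Plane} (hS : IsMarkovChain P κ w S) {M : ℝ}
    {U : Plane × Plane → ℝ≥0∞} (hU : Measurable U) (hU1 : ∀ v, 1 ≤ U v) {r : ℝ≥0∞}
    (hr : ∀ v : Plane × Plane, M < ‖v.1‖ + ‖v.2‖ → ∫⁻ u, U u ∂(κ v) ≤ r * U v)
    {θ : ℝ} (hθ : 0 < θ) :
    expMoment P θ (returnTime M S) ≤ ENNReal.ofReal (Real.exp θ) *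
      (1 - ENNReal.ofReal (Real.exp θ) * r)⁻¹ * ∫⁻ u, U u ∂(κ w) := by
  set A : Set (Plane × Plane) := {v | ‖v.1‖ + ‖v.2‖ ≤ M}
  have hA : MeasurableSet A := measurableSet_le (by fun_prop) measurable_const
  have hEm : ∀ k, MeasurableSet {ω | ∀ i ∈ Finset.Icc 1 k, S i ω ∉ A} := fun k => by
    have : {ω | ∀ i ∈ Finset.Icc 1 k, S i ω ∉ A} = ⋂ i ∈ Finset.Icc 1 k, (S i ⁻¹' A)ᶜ := by
      ext ω; simp
    rw [this]
    exact Finset.measurableSet_biInter _ fun i _ => (hS.measurable i hA).compl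
  have htail : ∀ k, P {ω | ∀ i ∈ Finset.Icc 1 k, S i ω ∉ A} ≤ r ^ k * ∫⁻ u, U u ∂(κ w) := by
    intro k
    refine le_trans ?_ (hS.setLIntegral_le_pow hA hU (fun v hv => hr v (not_le.1 hv)) k)
    rw [← setLIntegral_one]
    exact lintegral_mono fun ω => hU1 _
  set e := ENNReal.ofReal (Real.exp θ)
  have hek : ∀ k : ℕ, ENNReal.ofReal (Real.exp (θ * (k + 1))) = e * e ^ k := fun k => by
    rw [← ENNReal.ofReal_pow (Real.exp_pos _).le, ← ENNReal.ofReal_mul (Real.exp_pos _).le,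
      ← Real.exp_nat_mul, ← Real.exp_add]
    ring_nf
  calc expMoment P θ (returnTime M S)
      ≤ ∫⁻ ω, ∑' k : ℕ, {ω | ∀ i ∈ Finset.Icc 1 k, S i ω ∉ A}.indicator
          (fun _ => ENNReal.ofReal (Real.exp (θ * (k + 1)))) ω ∂P :=
        lintegral_mono fun ω => exp_mul_returnTime_le hθ S ω
    _ = ∑' k : ℕ, ENNReal.ofReal (Real.exp (θ * (k + 1))) *
          P {ω | ∀ i ∈ Finset.Icc 1 k, S i ω ∉ A} := by
        rw [lintegral_tsum fun k => (measurable_const.indicator (hEm k)).aemeasurable]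
        congr 1; funext k
        rw [lintegral_indicator_const (hEm k)]
    _ ≤ ∑' k : ℕ, e * (e * r) ^ k * ∫⁻ u, U u ∂(κ w) := by
        refine ENNReal.tsum_le_tsum fun k => ?_
        rw [hek]
        refine (mul_le_mul_right (htail k) _).trans_eq ?_
        rw [mul_pow]; ring
    _ = _ := by rw [ENNReal.tsum_mul_right, ENNReal.tsum_mul_left, ENNReal.tsum_geometric]

end ReturnTime

/-- The bump function argument needs mass on the open set `{K < |y|}`, while big jumps include size
exactly `K`. The density excludes atoms at `±K`; finiteness of the mass keeps the normalising factor
nonzero. -/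
theorem BigJumpAssumption.measure_lt_abs_ne_zero {ν : Measure ℝ} {K L : ℝ}
    (h : BigJumpAssumption ν K L) (hfin : ν (bigJumps K) ≠ ⊤) : ν {y | K < |y|} ≠ 0 := by
  obtain ⟨hpos, pK, -, -, -, -, -, -, hdens, -⟩ := h
  have hac : bigJumpLaw ν K ≪ volume := by rw [hdens]; exact withDensity_absolutelyContinuous _ _
  have hKK : bigJumpLaw ν K {K, -K} = 0 := hac (Set.Finite.measure_zero (by simp) _)
  have h2 : ν (({K, -K} : Set ℝ) ∩ bigJumps K) = 0 := by
    rw [bigJumpLaw, Measure.smul_apply, Measure.restrict_apply (by measurability), smul_eq_mul,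
      mul_eq_zero] at hKK
    exact hKK.resolve_left (ENNReal.inv_ne_zero.2 hfin)
  intro h0
  refine hpos.ne' (measure_mono_null (t := {y | K < |y|} ∪ (({K, -K} : Set ℝ) ∩ bigJumps K)) ?_
    (measure_union_null h0 h2))
  intro y hy
  by_cases hKy : K < |y|
  · exact Or.inl hKy
  · refine Or.inr ⟨?_, hy⟩
    have h3 := abs_le.1 (not_lt.1 hKy)
    rcases hy with hy' | hy'
    · exact Or.inr (le_antisymm hy' h3.1)
    · exact Or.inl (le_antisymm h3.2 hy')

end LevySDE

theorem theorem4p1 {Ω : Type*} [MeasurableSpace Ω] (P : Measure Ω) [IsProbabilityMeasure P]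
    (ν : Measure ℝ) (z : ℝ≥0 → Ω → ℝ) (hz : IsPureJumpLevyProcess P z ν)
    (α : ℝ) (hα₀ : 0 < α) (hα₂ : α < 2) (hmom : MomentAssumption P z α)
    (K : ℝ) (hK : 0 < K)
    (lam₁ lam₂ : ℝ) (hlam₁ : 0 < lam₁) (hlam : lam₁ ≤ lam₂)
    (p : ℝ) (hp₀ : 0 < p) (hpα : p < α)
    (T : ℝ) (hT : max ((p - 1) * Real.log 3 / (p * lam₁)) 0 < T) (B : ℝ) :
    ∃ M θ C : ℝ, 0 < M ∧ 0 < θ ∧ 0 < C ∧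
      ∀ F : Plane → Plane, (∀ x, ‖F x‖ ≤ B) → (∃ L, LipschitzWith L F) →
        BigJumpAssumption ν K (lipNorm F) →
      ∀ X : Plane → ℝ≥0 → Ω → Plane, (∀ x, IsSolution P z lam₁ lam₂ F x (X x)) →
      ∀ Q : Kernel (ℝ × ℝ) (ℝ × ℝ), IsMaximalJumpCoupling ν K Q →
      ∀ κ : Kernel (Plane × Plane) (Plane × Plane), IsCouplingKernel P z K T X Q κ →
      ∀ (Ω' : Type*) [MeasurableSpace Ω'] (P' : Measure Ω') [IsProbabilityMeasure P']
        (x y : Plane) (S : ℕ → Ω' → Plane × Plane), IsMarkovChain P' κ (x, y) S →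
        expMoment P' θ (returnTime M S) < ENNReal.ofReal (C * (1 + ‖x‖ ^ p + ‖y‖ ^ p)) := by
  have hT0 : 0 < T := (le_max_right _ _).trans_lt hT
  have hfin : ν (bigJumps K) ≠ ⊤ := by
    refine ((measure_mono fun y hy => ?_).trans_lt (hz.levyMeasure.measure_le_abs_lt_top hK)).ne
    rcases hy with hy | hy
    · exact (le_neg.1 hy).trans (neg_le_abs y)
    · exact (mem_Ici.1 hy).trans (le_abs_self y)
  -- The constants are chosen before `F` and its assumptions. If `ν` has no mass beyond `K`, no `F`
  -- satisfies them and any constants will do.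
  by_cases hν : ν {y | K < |y|} = 0
  · exact ⟨1, 1, 1, one_pos, one_pos, one_pos, fun F _ _ hbig =>
      absurd hν (hbig.measure_lt_abs_ne_zero hfin)⟩
  obtain ⟨q, hq0, hq1, D, hdrift⟩ := exists_drift hz hα₂ hmom hK hν hlam₁ hlam hp₀ hpα hT0 B
  obtain ⟨r, hqr, hr1⟩ := exists_between hq1
  have hr0 : 0 < r := hq0.trans hqr
  -- If `|x| + |y| > M`, one norm is at least `M / 2`, so `V ≥ (D + 1)/(r - q)` and `qV + 1 + D ≤
  -- rV`.
  let M : ℝ := 2 * ((D + 1) / (r - q) + 1) ^ (1 / p)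
  have hrq : 0 < r - q := sub_pos.2 hqr
  have hM0 : 0 < M := by positivity
  have hMp : (M / 2) ^ p = (D + 1) / (r - q) + 1 := by
    simp only [M]
    rw [mul_div_cancel_left₀ _ two_ne_zero, ← Real.rpow_mul (by positivity),
      one_div_mul_cancel hp₀.ne', Real.rpow_one]
  -- This makes `e^θ r` the square root of `r`, which is below one.
  let θ : ℝ := -Real.log r / 2
  have hlog : Real.log r < 0 := Real.log_neg hr0 hr1
  have hθ0 : 0 < θ := by simp only [θ]; linarith
  have her : Real.exp θ * r < 1 := by
    have h : Real.exp θ * r = Real.exp (θ + Real.log r) := by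
      rw [Real.exp_add, Real.exp_log hr0]
    rw [h, ← Real.exp_zero]
    exact Real.exp_lt_exp.2 (by simp only [θ]; linarith)
  let C : ℝ := Real.exp θ * (1 - Real.exp θ * r)⁻¹ * (2 + D)
  have hC0 : 0 < C := by
    have : 0 < 1 - Real.exp θ * r := sub_pos.2 her
    positivity
  -- The added `1` makes the final inequality strict.
  refine ⟨M, θ, C + 1, hM0, hθ0, by positivity, ?_⟩
  intro F hFB hFL _ X hX Q hQ κ hκ Ω' _ P' _ x y S hS
  obtain ⟨L, hL⟩ := hFL
  have := hκ.isFiniteKernel hQ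
  let U : Plane × Plane → ℝ≥0∞ := fun v => 1 + (‖v.1‖ₑ ^ p + ‖v.2‖ₑ ^ p)
  have hU : Measurable U := by fun_prop
  have hUreal : ∀ v, U v = ENNReal.ofReal (1 + ‖v.1‖ ^ p + ‖v.2‖ ^ p) := by
    intro v
    simp only [U]
    rw [← ofReal_norm, ← ofReal_norm, ENNReal.ofReal_rpow_of_nonneg (norm_nonneg _) hp₀.le,
      ENNReal.ofReal_rpow_of_nonneg (norm_nonneg _) hp₀.le, ← ENNReal.ofReal_add (by positivity)
      (by positivity), ← ENNReal.ofReal_one, ← ENNReal.ofReal_add (by positivity) (by positivity),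
      add_assoc]
  have hκ1 : ∀ v, κ v univ ≤ 1 := fun v => by
    rw [show v = (v.1, v.2) from rfl, hκ v.1 v.2 univ MeasurableSet.univ]
    refine (lintegral_map_le _ _).trans ?_
    refine (lintegral_mono fun ω => hQ.coupledJumpLaw_univ_le _).trans ?_
    simp
  have hUdrift : ∀ v, ∫⁻ u, U u ∂(κ v) ≤
      ENNReal.ofReal (q * (‖v.1‖ ^ p + ‖v.2‖ ^ p) + (1 + D)) := by
    intro v
    have h1 := hdrift F hFB hL.continuous X hX Q hQ κ hκ v
    calc ∫⁻ u, U u ∂(κ v) = κ v univ + ∫⁻ u, (‖u.1‖ₑ ^ p + ‖u.2‖ₑ ^ p) ∂(κ v) := by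
          simp only [U]; rw [lintegral_add_left measurable_const]; simp
      _ ≤ 1 + (ENNReal.ofReal q * (‖v.1‖ₑ ^ p + ‖v.2‖ₑ ^ p) + D) := add_le_add (hκ1 v) h1
      _ = _ := by
          rw [← ofReal_norm, ← ofReal_norm, ENNReal.ofReal_rpow_of_nonneg (norm_nonneg _) hp₀.le,
            ENNReal.ofReal_rpow_of_nonneg (norm_nonneg _) hp₀.le,
            ← ENNReal.ofReal_add (by positivity) (by positivity), ← ENNReal.ofReal_mul hq0.le,
            ENNReal.ofReal_add (by positivity) (by positivity),
            ENNReal.ofReal_add zero_le_one (by positivity), ENNReal.ofReal_one,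
            ENNReal.ofReal_coe_nnreal]
          ring
  have hrU : ∀ v : Plane × Plane, M < ‖v.1‖ + ‖v.2‖ →
      ∫⁻ u, U u ∂(κ v) ≤ ENNReal.ofReal r * U v := by
    intro v hv
    refine (hUdrift v).trans ?_
    rw [hUreal, ← ENNReal.ofReal_mul hr0.le]
    refine ENNReal.ofReal_le_ofReal ?_
    have h1 : (M / 2) ^ p ≤ ‖v.1‖ ^ p + ‖v.2‖ ^ p := by
      have e1 : 0 ≤ ‖v.1‖ ^ p := by positivity
      have e2 : 0 ≤ ‖v.2‖ ^ p := by positivity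
      rcases le_total (M / 2) ‖v.1‖ with h | h
      · have := Real.rpow_le_rpow (by positivity) h hp₀.le
        linarith
      · have := Real.rpow_le_rpow (by positivity) (by linarith : M / 2 ≤ ‖v.2‖) hp₀.le
        linarith
    rw [hMp] at h1
    have h2 : (r - q) * ((D + 1) / (r - q) + 1) ≤ (r - q) * (‖v.1‖ ^ p + ‖v.2‖ ^ p) :=
      mul_le_mul_of_nonneg_left h1 hrq.le
    rw [mul_add, mul_div_cancel₀ _ hrq.ne'] at h2
    nlinarith
  have hmain := expMoment_returnTime_le hS hU (fun v => le_self_add) hrU hθ0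
  refine hmain.trans_lt ?_
  have hgeo : (1 - ENNReal.ofReal (Real.exp θ) * ENNReal.ofReal r)⁻¹ =
      ENNReal.ofReal ((1 - Real.exp θ * r)⁻¹) := by
    rw [← ENNReal.ofReal_mul (Real.exp_pos _).le, ← ENNReal.ofReal_one,
      ← ENNReal.ofReal_sub _ (by positivity), ENNReal.ofReal_inv_of_pos (sub_pos.2 her)]
  have hinv : 0 < (1 - Real.exp θ * r)⁻¹ := inv_pos.2 (sub_pos.2 her)
  have hxy : 0 ≤ ‖x‖ ^ p + ‖y‖ ^ p := by positivity
  calc _ ≤ ENNReal.ofReal (Real.exp θ) * ENNReal.ofReal ((1 - Real.exp θ * r)⁻¹) *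
        ENNReal.ofReal ((2 + D) * (1 + ‖x‖ ^ p + ‖y‖ ^ p)) := by
        rw [hgeo]
        refine mul_le_mul_right ((hUdrift (x, y)).trans (ENNReal.ofReal_le_ofReal ?_)) _
        simp only
        nlinarith [D.coe_nonneg, mul_nonneg D.coe_nonneg hxy]
    _ = ENNReal.ofReal (C * (1 + ‖x‖ ^ p + ‖y‖ ^ p)) := by
        rw [← ENNReal.ofReal_mul (by positivity), ← ENNReal.ofReal_mul (by positivity)]
        congr 1; simp only [C]; ring
    _ < _ := by
        refine (ENNReal.ofReal_lt_ofReal_iff (by positivity)).2 ?_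
        nlinarith
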